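/- Identify the plane with $\mathbb C$. A polygon $P$ is a closed polygonal region homeomorphic to a disk, bounded by a simple closed polygonal line; $V_P$ denotes its set of vertices (straight angles at vertices are allowed). Let $\mathcal S=\{S_1,\dots,S_m\}$ be contracting similarities $S_k(z)=q_ke^{i\alpha_k}(z-z_k)+z_k$, $0<q_k<1$; for a nonempty finite word $\mathbf i=i_1\dots i_k$ over $\{1,\dots,m\}$ put $S_{\mathbf i}=S_{i_1}\circ\dots\circ S_{i_k}$ and $|\mathbf i|=k$. Write $P_{\mathbf i}=S_{\mathbf i}(P)$ and $V_{P_{\mathbf i}}=S_{\mathbf i}(V_P)$. The attractor $K(\mathcal S)$ is the unique nonempty compact set $K$ with $K=\bigcup_k S_k(K)$. Consider the conditions: (D1) $P_k\subset P$ for all $k$; (D2) for $k\ne l$, $P_k\cap P_l=V_{P_k}\cap V_{P_l}$, and this set has fewer than two points; (D3) $V_P\subset\bigcup_kV_{P_k}$; (D4) $\bigcup_kP_k$ is contractible. $\mathcal S$ is a contractible $P$-polygonal system if (D1)–(D4) hold, and a generalized $P$-polygonal system if (D2)–(D4) hold. For $\delta>0$, a generalized $P'$-polygonal system $\mathcal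 S'=\{S_1',\dots,S_m'\}$ is a $\delta$-deformation of a contractible $P$-polygonal system $\mathcal S=\{S_1,\dots,S_m\}$ if there is a bijection $f:\bigcup_kV_{P_k}\to\bigcup_kV_{P_k'}$ with $f(V_P)=V_{P'}$ such that (a) $f|_{V_P}$ extends to a homeomorphism $P\to P'$; (b) $|f(x)-x|<\delta$ for all $x\in\bigcup_kV_{P_k}$; (c) $f(S_k(x))=S_k'(f(x))$ for all $k$ and all $x\in V_P$. Let $\mathcal S$ be a generalized $P$-polygonal system. A vertex $A\in V_P$ is cyclic if $S_{\mathbf i}(A)=A$ for some nonempty word $\mathbf i$. For a shortest such word $\mathbf i$ write $S_{\mathbf i}(z)=re^{i\alpha}(z-A)+A$, $r>0$, where the real number $\alpha$ (not only its class modulo $2\pi$) is the variation of $\arg(z-A)$ along a path from a vertex $B\in V_P\setminus\{A\}$ to $S_{\mathbf i}(B)$ in $\bigcup_{|\mathbf u|=|\mathbf i|}P_{\mathbf u}\setminus\{A\}$; then $\lambda_A=\alpha/\ln r$ is the parameter of $A$. $\mathcal S$ satisfies the parameter matching condition if $\lambda_A=\lambda_{A'}$ (for all values of these parameters obtained in this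 way) whenever $A,A'$ are cyclic vertices and $S_{\mathbf i}(A)=S_{\mathbf j}(A')=B$ for some nonempty words $\mathbf i,\mathbf j$ and some $B\in\bigcup_kV_{P_k}$. Theorem. Let $\mathcal S$ be a contractible $P$-polygonal system. Then there is $\delta>0$ such that for every $\delta$-deformation $\mathcal S'$ of $\mathcal S$ that satisfies the parameter matching condition, the attractor $K(\mathcal S')$ is a dendrite (a locally connected continuum containing no simple closed curve) homeomorphic to $K(\mathcal S)$. -/

import Mathlib

open Set Topology

noncomputable section

/-! ### Polygons in the plane -/

/-- A polygon in the plane `ℂ` that is homeomorphic to a disk, with `n` vertices.  The underlying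
`Polygon ℂ n` is the cyclic sequence of vertices; its closed boundary line is simple, and `carrier`
is the closed region that this line bounds. -/
structure DiskPolygon (n : ℕ) extends Polygon ℂ n where
  three_le : 3 ≤ n
  vertices_injective : Function.Injective vertices
  /-- Two consecutive sides meet only in their common vertex. -/
  edge_inter_next : ∀ i : Fin n,
    toPolygon.edgeSet ℝ i ∩ toPolygon.edgeSet ℝ (finRotate n i) = {vertices (finRotate n i)}
  /-- Two sides that are not consecutive do not meet. -/
  edge_disjoint : ∀ i j : Fin n, i ≠ j → j ≠ finRotate n i → i ≠ finRotate n j →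
    Disjoint (toPolygon.edgeSet ℝ i) (toPolygon.edgeSet ℝ j)
  /-- The closed region (the polygon as a subset of the plane). -/
  carrier : Set ℂ
  homeomorphic_disk : Nonempty (carrier ≃ₜ Metric.closedBall (0 : ℂ) 1)
  frontier_eq : frontier carrier = toPolygon.boundary ℝ

/-- The set of vertices of a polygon. -/
def DiskPolygon.vertexSet {n : ℕ} (P : DiskPolygon n) : Set ℂ := range P.vertices

/-! ### Systems of contracting similarities -/

/-- A contracting similarity `z ↦ a (z - c) + c` of the plane, where `a = q e ^ (i α)` with
`0 < q < 1`; `c` is its fixed point. -/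
structure ContractingSimilarity where
  mult : ℂ
  center : ℂ
  mult_ne_zero : mult ≠ 0
  norm_mult_lt_one : ‖mult‖ < 1

instance : CoeFun ContractingSimilarity (fun _ => ℂ → ℂ) where
  coe S := fun z => S.mult * (z - S.center) + S.center

/-- A system `S_1, …, S_m` (with `m ≥ 1`) of contracting similarities of the plane. -/
structure SimilaritySystem (m : ℕ) where
  map : Fin m → ContractingSimilarity
  pos : 0 < m

namespace SimilaritySystem

variable {m : ℕ}

/-- The map `S_w = S_{w_1} ∘ ⋯ ∘ S_{w_k}` of a multiindex `w = w_1 … w_k`. -/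
def wordMap (S : SimilaritySystem m) : List (Fin m) → ℂ → ℂ
  | [] => id
  | i :: w => S.map i ∘ S.wordMap w

/-- The multiplier of `S_w`, so that `S_w z - S_w z' = S.wordMult w * (z - z')`. -/
def wordMult (S : SimilaritySystem m) (w : List (Fin m)) : ℂ :=
  (w.map fun i => (S.map i).mult).prod

theorem wordMap_sub (S : SimilaritySystem m) (w : List (Fin m)) (z z' : ℂ) :
    S.wordMap w z - S.wordMap w z' = S.wordMult w * (z - z') := by
  induction w with
  | nil => simp [wordMap, wordMult]
  | cons i w ih =>
    simp only [wordMap, wordMult, Function.comp, List.map_cons, List.prod_cons] at ih ⊢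
    rw [mul_assoc, ← ih]; ring

/-- `K` is a nonempty compact set with `K = ⋃ i, S_i K`. -/
structure IsAttractor (S : SimilaritySystem m) (K : Set ℂ) : Prop where
  nonempty : K.Nonempty
  isCompact : IsCompact K
  eq_iUnion : K = ⋃ i, S.map i '' K

/-- Hutchinson's theorem: a system has exactly one attractor. -/
theorem existsUnique_isAttractor (S : SimilaritySystem m) : ∃! K : Set ℂ, S.IsAttractor K := by
  have : Nonempty (Fin m) := ⟨⟨0, S.pos⟩⟩
  have hcont : ∀ i, Continuous (S.map i : ℂ → ℂ) := fun i => by fun_prop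
  let T : TopologicalSpace.NonemptyCompacts ℂ → TopologicalSpace.NonemptyCompacts ℂ := fun A =>
    ⟨⟨⋃ i, S.map i '' A, isCompact_iUnion fun i => A.isCompact.image (hcont i)⟩,
      (A.nonempty.image (S.map (Classical.arbitrary _))).mono
        (subset_iUnion (fun i => S.map i '' (A : Set ℂ)) _)⟩
  obtain ⟨i₀, hi₀⟩ := Finite.exists_max fun i => ‖(S.map i).mult‖₊
  have hedist : ∀ i (x y : ℂ),
      edist (S.map i x) (S.map i y) ≤ ‖(S.map i₀).mult‖₊ * edist x y := fun i x y => by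
    rw [edist_eq_enorm_sub, edist_eq_enorm_sub]
    have h : S.map i x - S.map i y = (S.map i).mult * (x - y) := by ring
    rw [h, enorm_mul]
    gcongr
    exact ENNReal.coe_le_coe.2 (hi₀ i)
  have hlip : LipschitzWith ‖(S.map i₀).mult‖₊ T := fun A B => by
    change Metric.hausdorffEDist (⋃ i, S.map i '' (A : Set ℂ)) (⋃ i, S.map i '' (B : Set ℂ)) ≤ _
    have key : ∀ A B : TopologicalSpace.NonemptyCompacts ℂ, ∀ x ∈ ⋃ i, S.map i '' (A : Set ℂ),
        ∃ y ∈ ⋃ i, S.map i '' (B : Set ℂ), edist x y ≤ ‖(S.map i₀).mult‖₊ * edist A B := by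
      intro A B x hx
      obtain ⟨i, a, ha, rfl⟩ := mem_iUnion.1 hx
      obtain ⟨b, hb, hab⟩ := B.isCompact.exists_infEDist_eq_edist B.nonempty a
      refine ⟨S.map i b, mem_iUnion.2 ⟨i, b, hb, rfl⟩, (hedist i a b).trans ?_⟩
      gcongr
      rw [← hab]
      exact Metric.infEDist_le_hausdorffEDist_of_mem ha
    refine Metric.hausdorffEDist_le_of_mem_edist (key A B) ?_
    rw [edist_comm A B]
    exact key B A
  have hT : ContractingWith ‖(S.map i₀).mult‖₊ T :=
    ⟨by exact_mod_cast (S.map i₀).norm_mult_lt_one, hlip⟩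
  have : Nonempty (TopologicalSpace.NonemptyCompacts ℂ) := ⟨{0}⟩
  refine ⟨(ContractingWith.fixedPoint T hT : TopologicalSpace.NonemptyCompacts ℂ),
    ⟨TopologicalSpace.NonemptyCompacts.nonempty _, TopologicalSpace.NonemptyCompacts.isCompact _,
      (congrArg (fun A : TopologicalSpace.NonemptyCompacts ℂ => (A : Set ℂ))
        hT.fixedPoint_isFixedPt).symm⟩, ?_⟩
  intro L hL
  have hfix : Function.IsFixedPt T ⟨⟨L, hL.isCompact⟩, hL.nonempty⟩ :=
    TopologicalSpace.NonemptyCompacts.ext hL.eq_iUnion.symm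
  exact congrArg (fun A : TopologicalSpace.NonemptyCompacts ℂ => (A : Set ℂ))
    (hT.fixedPoint_unique hfix)

/-- The attractor `K(S)`. -/
def attractor (S : SimilaritySystem m) : Set ℂ := S.existsUnique_isAttractor.choose

theorem isAttractor_attractor (S : SimilaritySystem m) : S.IsAttractor S.attractor :=
  S.existsUnique_isAttractor.choose_spec.1

/-! ### Polygonal systems -/

/-- The set `⋃ i, V_{P_i}` of all vertices of the polygons `P_i = S_i P`. -/
def pieceVertices (S : SimilaritySystem m) {n : ℕ} (P : DiskPolygon n) : Set ℂ :=
  ⋃ i, S.map i '' P.vertexSet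

/-- The union of the polygons `P_u = S_u P` over all multiindices `u` of length `k`. -/
def levelUnion (S : SimilaritySystem m) {n : ℕ} (P : DiskPolygon n) (k : ℕ) : Set ℂ :=
  ⋃ u : {u : List (Fin m) // u.length = k}, S.wordMap u '' P.carrier

/-- `S` is a generalized `P`-polygonal system of similarities. -/
structure IsGeneralizedPolygonal (S : SimilaritySystem m) {n : ℕ} (P : DiskPolygon n) : Prop where
  inter_eq : ∀ i j, i ≠ j → S.map i '' P.carrier ∩ S.map j '' P.carrier =
    S.map i '' P.vertexSet ∩ S.map j '' P.vertexSet
  encard_inter_lt : ∀ i j, i ≠ j → (S.map i '' P.vertexSet ∩ S.map j '' P.vertexSet).encard < 2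
  vertexSet_subset : P.vertexSet ⊆ ⋃ i, S.map i '' P.vertexSet
  contractible : ContractibleSpace ↥(⋃ i, S.map i '' P.carrier)

/-- `S` is a contractible `P`-polygonal system of similarities. -/
structure IsContractiblePolygonal (S : SimilaritySystem m) {n : ℕ} (P : DiskPolygon n) : Prop
    extends S.IsGeneralizedPolygonal P where
  image_subset : ∀ i, S.map i '' P.carrier ⊆ P.carrier

/-- The `P'`-polygonal system `S'` is a `δ`-deformation of the `P`-polygonal system `S`, where `S'`
is assumed to be generalized `P'`-polygonal. -/
def IsDeformation (δ : ℝ) {n n' : ℕ} (S : SimilaritySystem m) (P : DiskPolygon n)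
    (S' : SimilaritySystem m) (P' : DiskPolygon n') : Prop :=
  ∃ f : ℂ → ℂ,
    BijOn f (S.pieceVertices P) (S'.pieceVertices P') ∧
    BijOn f P.vertexSet P'.vertexSet ∧
    (∃ h : P.carrier ≃ₜ P'.carrier,
      ∀ x : P.carrier, (x : ℂ) ∈ P.vertexSet → (h x : ℂ) = f x) ∧
    (∀ x ∈ S.pieceVertices P, ‖f x - x‖ < δ) ∧
    ∀ k, ∀ x ∈ P.vertexSet, f (S.map k x) = S'.map k (f x)

/-! ### Cyclic vertices and parameter matching -/

/-- `A` is a cyclic vertex: `A` is a vertex of `P`, fixed by `S_w` for some multiindex `w`. -/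
def IsCyclicVertex (S : SimilaritySystem m) {n : ℕ} (P : DiskPolygon n) (A : ℂ) : Prop :=
  A ∈ P.vertexSet ∧ ∃ w : List (Fin m), w ≠ [] ∧ S.wordMap w A = A

/-- `w` is a shortest multiindex with `S_w A = A`; its length is the order of `A`. -/
def IsShortestFixing (S : SimilaritySystem m) (A : ℂ) (w : List (Fin m)) : Prop :=
  w ≠ [] ∧ S.wordMap w A = A ∧
    ∀ u : List (Fin m), u ≠ [] → S.wordMap u A = A → w.length ≤ u.length

/-- The rotation angle of `S_w` at its fixed point `A`, as a real number and not modulo `2π`.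
It is the variation of `arg (z - A)` along a path from some vertex `B ≠ A` of `P` to `S_w B` that
avoids `A` and runs inside the union of the polygons `P_u`, `|u| = |w|` (for `|w| = 1` this is the
union of the `P_i`).  As `S_w B - A = S.wordMult w * (B - A)`, this is an argument of the
multiplier of `S_w`. -/
def IsRotationAngle (S : SimilaritySystem m) {n : ℕ} (P : DiskPolygon n) (A : ℂ)
    (w : List (Fin m)) (α : ℝ) : Prop :=
  ∃ B ∈ P.vertexSet, B ≠ A ∧ ∃ (γ : Path B (S.wordMap w B)) (θ : C(unitInterval, ℝ)),
    (∀ t, γ t ∈ S.levelUnion P w.length \ {A}) ∧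
    (∀ t, γ t - A = ‖γ t - A‖ * Complex.exp (θ t * Complex.I)) ∧
    α = θ 1 - θ 0

/-- `lam = α / log r` is the parameter of the cyclic vertex `A`, where
`S_w z = r e ^ (i α) (z - A) + A` for a shortest multiindex `w` that fixes `A`. -/
def IsVertexParameter (S : SimilaritySystem m) {n : ℕ} (P : DiskPolygon n) (A : ℂ) (lam : ℝ) :
    Prop :=
  ∃ w α, S.IsShortestFixing A w ∧ S.IsRotationAngle P A w α ∧
    lam = α / Real.log ‖S.wordMult w‖

/-- The parameter matching condition. -/
def ParameterMatching (S : SimilaritySystem m) {n : ℕ} (P : DiskPolygon n) : Prop :=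
  ∀ B ∈ S.pieceVertices P, ∀ A A' : ℂ, S.IsCyclicVertex P A → S.IsCyclicVertex P A' →
    ∀ i j : List (Fin m), i ≠ [] → j ≠ [] → S.wordMap i A = B → S.wordMap j A' = B →
      ∀ lam lam' : ℝ, S.IsVertexParameter P A lam → S.IsVertexParameter P A' lam' → lam = lam'

end SimilaritySystem

/-! ### Dendrites -/

/-- A dendrite: a locally connected continuum that contains no simple closed curve. -/
structure IsDendrite (K : Set ℂ) : Prop where
  isCompact : IsCompact K
  isConnected : IsConnected K
  locallyConnected : LocallyConnectedSpace K
  no_simple_closed_curve : ¬ ∃ c : Circle → ℂ, Continuous c ∧ Function.Injective c ∧ ∀ t, c t ∈ K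

end

/-! Every attractor is the image of the Cantor set of addresses under the coding map, so two
attractors are homeomorphic as soon as both systems identify the same pairs of addresses
(`nonempty_homeomorph_of_coding`). If the pieces `S_i K` meet only in images of vertices, all
identifications come from the vertices, and a conjugacy of the vertices carries them to the other
system (`IsSeparatedBy.coding_eq_coding`). For the original system this separation holds because `K
⊆ P`. A deformed attractor may leave its polygon, so the task is to prove separation for it
(`eventually_inter_subset`).

Disjoint polygons, and parts of two polygons far from their common vertex `B`, are at a positive
distance, and small deformations move coded points uniformly little. The delicate place is the
neighbourhood of `B`, where pieces of all sizes accumulate. Near `B` the polygons are cones, so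
`P_i` and `P_j` are separated there by an angle (`exists_direction_gap`). A deformed point near the
image of `B` is a deformed `S_w` applied to a point at a definite distance from a vertex `a`, with
`S_w a = B` (`exists_zoom`), so only the rotation accumulated along `w` matters. A long `w` repeats
loops at cyclic vertices. In `S` such loops do not rotate; in the deformed system they turn by `lam
* log r`, with the same `lam` for all loops over `B` by parameter matching. The factor `e ^ (-i lam
log |z|)` cancels these rotations exactly, and after the loops are removed at most `n` letters
remain, with small total error (`eventually_exists_parameter`). The untwisted direction of a
deformed point is thus close to the direction of the original point. As untwisting depends only on
the deformed point, a common point of two deformed pieces other than the image of `B` would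
contradict the angular gap (`eventually_direction`).

The parameter is an honest real angle, so it must be shown to be small and not just small modulo
`2π`. In `P` minus a boundary point `A`, `arg (z - A)` has a bounded continuous branch, so a map
`S_v` fixing `A` has rotation angle exactly `0` (`argument_wordMap`). The angle of the deformation
is computed along a chain of deformed edges and depends continuously on the deformation
(`exists_variation`). Planar invariance of domain is needed to know that homeomorphisms respect
boundaries.

Finally `K(S)` is a dendrite because the polygons `P_i` are arranged like a tree: a simple closed
curve lies in a single polygon at every level, hence has diameter `0`. -/

noncomputable section

/-! ### Continuous arguments of nonvanishing functions -/

/-- `θ` is an argument of the complex valued function `g`. -/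
def IsArgument {X : Type*} (g : X → ℂ) (θ : X → ℝ) : Prop :=
  ∀ x, g x = ‖g x‖ * Complex.exp (θ x * Complex.I)

theorem IsArgument.mul {X : Type*} {g g' : X → ℂ} {θ θ' : X → ℝ} (h : IsArgument g θ)
    (h' : IsArgument g' θ') : IsArgument (fun x => g x * g' x) (fun x => θ x + θ' x) := fun x => by
  dsimp only
  conv_lhs => rw [h x, h' x]
  rw [norm_mul]; push_cast; rw [add_mul, Complex.exp_add]; ring

theorem isArgument_arg {X : Type*} (g : X → ℂ) : IsArgument g (fun x => (g x).arg) := fun x =>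
  (Complex.norm_mul_exp_arg_mul_I (g x)).symm

/-- The values of `θ` lie in one coset of `2πℤ`, which is discrete. Two continuous arguments on a
connected space are compared by applying this to their difference. -/
theorem eq_of_exp_mul_I_eq {X : Type*} [TopologicalSpace X] [PreconnectedSpace X] {θ : X → ℝ}
    (hθ : Continuous θ)
    (h : ∀ x y, Complex.exp (θ x * Complex.I) = Complex.exp (θ y * Complex.I)) (x y : X) :
    θ x = θ y :=
  Circle.isCoveringMap_exp.const_of_comp hθ
    (fun a b => Circle.ext (by simpa [Circle.coe_exp] using h a b)) x y

theorem inv_mem_slitPlane {z : ℂ} (hz : z ∈ Complex.slitPlane) : z⁻¹ ∈ Complex.slitPlane := by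
  rw [Complex.mem_slitPlane_iff_arg] at hz ⊢
  refine ⟨?_, inv_ne_zero hz.2⟩
  rw [Complex.arg_inv, if_neg hz.1]
  intro h
  linarith [Complex.neg_pi_lt_arg z]

/-- The direction of a nonvanishing function as a map to the circle. -/
def unitMap {X : Type*} [TopologicalSpace X] (g : X → ℂ) (hg : Continuous g) (h0 : ∀ x, g x ≠ 0) :
    C(X, Circle) where
  toFun x := ⟨g x / ‖g x‖, by
    change g x / ‖g x‖ ∈ Metric.sphere (0 : ℂ) 1
    simp [h0 x]⟩
  continuous_toFun := by
    refine Continuous.subtype_mk (hg.div (by fun_prop) fun x => ?_) _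
    simpa using h0 x

theorem isArgument_of_exp_eq {X : Type*} [TopologicalSpace X] {g : X → ℂ} {hg : Continuous g}
    {h0 : ∀ x, g x ≠ 0} {θ : X → ℝ} (h : ∀ x, Circle.exp (θ x) = unitMap g hg h0 x) :
    IsArgument g θ := fun x => by
  have h1 : Complex.exp (θ x * Complex.I) = g x / ‖g x‖ := by
    rw [← Circle.coe_exp, h x]; rfl
  rw [h1]
  have : (‖g x‖ : ℂ) ≠ 0 := by simpa using h0 x
  field_simp

theorem IsArgument.exp_eq {X : Type*} [TopologicalSpace X] {g : X → ℂ} (hg : Continuous g)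
    (h0 : ∀ x, g x ≠ 0) {θ : X → ℝ} (h : IsArgument g θ) (x : X) :
    unitMap g hg h0 x = Circle.exp (θ x) := by
  apply Circle.ext
  change g x / ‖g x‖ = _
  rw [Circle.coe_exp]
  have : (‖g x‖ : ℂ) ≠ 0 := by simpa using h0 x
  rw [div_eq_iff this, mul_comm]
  exact h x

/-- This is homotopy lifting along the covering of the circle by the line. -/
theorem exists_argument_of_homotopy {X : Type*} [TopologicalSpace X] (H : unitInterval × X → ℂ)
    (hH : Continuous H) (h0 : ∀ p, H p ≠ 0) (θ : C(X, ℝ)) (hθ : IsArgument (fun x => H (0, x)) θ) :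
    ∃ θ' : C(X, ℝ), IsArgument (fun x => H (1, x)) θ' := by
  have hcomp : ∀ a, unitMap H hH h0 (0, a) = Circle.exp (θ a) := fun a =>
    hθ.exp_eq (by fun_prop) (fun x => h0 (0, x)) a
  let G := Circle.isCoveringMap_exp.liftHomotopy (unitMap H hH h0) θ hcomp
  refine ⟨G.comp ⟨fun x => ((1 : unitInterval), x), by fun_prop⟩, ?_⟩
  have hl := Circle.isCoveringMap_exp.liftHomotopy_lifts (unitMap H hH h0) θ hcomp
  have : IsArgument H G := isArgument_of_exp_eq (hg := hH) (h0 := h0) fun p => congrFun hl p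
  exact fun x => this (1, x)

theorem exists_argument_of_contractible {X : Type*} [TopologicalSpace X] [ContractibleSpace X]
    (g : X → ℂ) (hg : Continuous g) (h0 : ∀ x, g x ≠ 0) : ∃ θ : C(X, ℝ), IsArgument g θ := by
  obtain ⟨y, ⟨F⟩⟩ := id_nullhomotopic X
  have := exists_argument_of_homotopy (fun p => g (F.symm p)) (by fun_prop) (fun p => h0 _)
    (ContinuousMap.const X (g y).arg) (fun x => by simp)
  simpa using this

/-! ### Invariance of domain in the plane -/

instance : PreconnectedSpace Circle := by
  have h : range Circle.exp = univ := by
    rw [range_eq_univ]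
    intro z
    exact ⟨Complex.arg z, Circle.exp_arg z⟩
  refine ⟨?_⟩
  rw [← h]
  exact isPreconnected_range Circle.exp.continuous

/-- A nonvanishing odd function on the circle has no continuous argument. -/
theorem not_isArgument_of_odd (g : Circle → ℂ) (h0 : ∀ u, g u ≠ 0) (hodd : ∀ u, g (-u) = -g u)
    (θ : C(Circle, ℝ)) : ¬ IsArgument g θ := by
  intro h
  -- The difference `θ (-u) - θ u` is an odd multiple of `π`, hence constant; exchanging `u` and
  -- `-u` changes its sign, so it would be `0`.
  have key : ∀ u, Complex.exp (((θ (-u) - θ u : ℝ) : ℂ) * Complex.I) = -1 := fun u => by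
    have h1 := h u
    have h2 := h (-u)
    rw [hodd, norm_neg] at h2
    have hn : (‖g u‖ : ℂ) ≠ 0 := by simpa using h0 u
    push_cast
    rw [sub_mul, Complex.exp_sub, div_eq_iff (Complex.exp_ne_zero _)]
    apply mul_left_cancel₀ hn
    rw [← h2, neg_one_mul, mul_neg, ← h1]
  have hc := eq_of_exp_mul_I_eq (θ := fun u => θ (-u) - θ u) (by fun_prop)
    (fun a b => (key a).trans (key b).symm) 1 (-1)
  simp only [neg_neg] at hc
  have h3 : θ (-1) - θ 1 = 0 := by linarith
  have h4 := key 1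
  rw [h3] at h4
  norm_num at h4

/-- Otherwise some omitted value `y` is nearer to `ψ p` than the image of the boundary circle is.
Then `ψ - y` has a continuous argument on the contractible ball, and so has `ψ - ψ p` on the circle,
since the quotient of the two stays in the slit plane. The homotopy `ψ (p + r u) - ψ (p - t r u)`,
free of zeros by injectivity, carries this argument to an odd function at `t = 1`, which has none.
-/
theorem mem_interior_image_closedBall {ψ : ℂ → ℂ} {p : ℂ} {r : ℝ} (hr : 0 < r)
    (hψ : ContinuousOn ψ (Metric.closedBall p r)) (hinj : InjOn ψ (Metric.closedBall p r)) :
    ψ p ∈ interior (ψ '' Metric.closedBall p r) := by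
  by_contra hcon
  have hmem : ∀ (u : Circle) (t : ℝ), |t| ≤ 1 → p + t * r * u ∈ Metric.closedBall p r := by
    intro u t ht
    simp only [Metric.mem_closedBall, dist_self_add_left, norm_mul, Complex.norm_real,
      Circle.norm_coe, mul_one, Real.norm_eq_abs, abs_of_pos hr]
    nlinarith
  have hmem1 : ∀ u : Circle, p + r * u ∈ Metric.closedBall p r := fun u => by
    simpa using hmem u 1 (by simp)
  have hp : p ∈ Metric.closedBall p r := Metric.mem_closedBall_self hr.le
  have hg : Continuous fun u : Circle => ψ (p + r * u) :=
    hψ.comp_continuous (by fun_prop) hmem1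
  have hne : ∀ u : Circle, ψ (p + r * u) ≠ ψ p := fun u h => by
    have := hinj (hmem1 u) hp h
    simp [hr.ne'] at this
  obtain ⟨u₀, -, hu₀⟩ := isCompact_univ.exists_isMinOn (univ_nonempty (α := Circle))
    (f := fun u => ‖ψ (p + r * u) - ψ p‖) (hg.sub continuous_const).norm.continuousOn
  set d := ‖ψ (p + r * u₀) - ψ p‖ with hd
  have hd0 : 0 < d := norm_pos_iff.2 (sub_ne_zero.2 (hne u₀))
  have hdle : ∀ u : Circle, d ≤ ‖ψ (p + r * u) - ψ p‖ := fun u => hu₀ (mem_univ u)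
  obtain ⟨y, hy1, hy2⟩ : ∃ y, y ∉ ψ '' Metric.closedBall p r ∧ ‖y - ψ p‖ < d := by
    by_contra! hc
    refine hcon (mem_interior_iff_mem_nhds.2 (Filter.mem_of_superset (Metric.ball_mem_nhds _ hd0) ?_))
    intro z hz
    by_contra hz'
    have := hc z hz'
    rw [Metric.mem_ball, dist_eq_norm] at hz
    linarith
  have hy0 : ∀ z ∈ Metric.closedBall p r, ψ z - y ≠ 0 := fun z hz h =>
    hy1 ⟨z, hz, sub_eq_zero.1 h⟩
  have : ContractibleSpace (Metric.closedBall p r) :=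
    (convex_closedBall p r).contractibleSpace ⟨p, hp⟩
  obtain ⟨θ, hθ⟩ := exists_argument_of_contractible
    (fun z : Metric.closedBall p r => ψ z - y) ((hψ.domRestrict).sub continuous_const) (fun z => hy0 z z.2)
  have hslit : ∀ u : Circle, (ψ (p + r * u) - ψ p) / (ψ (p + r * u) - y) ∈ Complex.slitPlane := by
    intro u
    have h1 : ψ (p + r * u) - ψ p ≠ 0 := sub_ne_zero.2 (hne u)
    have : (ψ (p + r * u) - y) / (ψ (p + r * u) - ψ p) ∈ Complex.slitPlane := by
      have h2 : (ψ (p + r * u) - y) / (ψ (p + r * u) - ψ p) =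
          1 + (ψ p - y) / (ψ (p + r * u) - ψ p) := by field_simp; ring
      rw [h2]
      apply Complex.mem_slitPlane_of_norm_lt_one
      rw [norm_div, div_lt_one (norm_pos_iff.2 h1), norm_sub_rev]
      exact hy2.trans_le (hdle u)
    simpa using inv_mem_slitPlane this
  have hcont : Continuous fun u : Circle => ((ψ (p + r * u) - ψ p) / (ψ (p + r * u) - y)).arg := by
    rw [continuous_iff_continuousAt]
    intro u
    refine ContinuousAt.comp (g := Complex.arg) (Complex.continuousAt_arg (hslit u)) ?_
    exact ((hg.sub continuous_const).div (hg.sub continuous_const)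
      fun u => hy0 _ (hmem1 u)).continuousAt
  let l : C(Circle, ℝ) := ⟨fun u => θ ⟨p + r * u, hmem1 u⟩ +
    ((ψ (p + r * u) - ψ p) / (ψ (p + r * u) - y)).arg, by fun_prop⟩
  have hl : IsArgument (fun u : Circle => ψ (p + r * u) - ψ p) l := by
    have h1 : IsArgument (fun u : Circle => ψ (p + r * u) - y) fun u => θ ⟨p + r * u, hmem1 u⟩ :=
      fun u => hθ ⟨p + r * u, hmem1 u⟩
    have h2 := h1.mul (isArgument_arg fun u : Circle => (ψ (p + r * u) - ψ p) / (ψ (p + r * u) - y))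
    have h3 : (fun u : Circle => (ψ (p + r * u) - y) *
        ((ψ (p + r * u) - ψ p) / (ψ (p + r * u) - y))) = fun u : Circle => ψ (p + r * u) - ψ p := by
      funext u
      exact mul_div_cancel₀ _ (hy0 _ (hmem1 u))
    rw [h3] at h2
    exact h2
  have hmem2 : ∀ q : unitInterval × Circle, p - (q.1 : ℝ) * r * q.2 ∈ Metric.closedBall p r := by
    intro q
    have := hmem q.2 (-(q.1 : ℝ)) (by rw [abs_neg, abs_of_nonneg q.1.2.1]; exact q.1.2.2)
    convert this using 1
    push_cast; ring
  obtain ⟨θ', hθ'⟩ := exists_argument_of_homotopy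
    (fun q : unitInterval × Circle => ψ (p + r * q.2) - ψ (p - (q.1 : ℝ) * r * q.2))
    ((hg.comp continuous_snd).sub (hψ.comp_continuous (by fun_prop) hmem2))
    (fun q h => by
      have h1 := hinj (hmem1 q.2) (hmem2 q) (sub_eq_zero.1 h)
      have h2 : ((1 + (q.1 : ℝ) : ℝ) : ℂ) * (r * q.2) = 0 := by
        push_cast; linear_combination h1
      have h3 : (0:ℝ) < 1 + (q.1 : ℝ) := by linarith [q.1.2.1]
      rcases mul_eq_zero.1 h2 with h | h
      · exact h3.ne' (by exact_mod_cast h)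
      · simp [hr.ne'] at h) l (by simpa using hl)
  refine not_isArgument_of_odd _ ?_ ?_ θ' hθ'
  · intro u h
    have h1 := hinj (hmem1 u) (hmem2 (1, u)) (sub_eq_zero.1 h)
    have h2 : (r : ℂ) * u = 0 := by
      simp only [Icc.coe_one] at h1; push_cast at h1; linear_combination (1/2) * h1
    simp [hr.ne'] at h2
  · intro u
    simp [sub_eq_add_neg]

theorem isOpen_image_of_injOn {ψ : ℂ → ℂ} {U : Set ℂ} (hU : IsOpen U) (hψ : ContinuousOn ψ U)
    (hinj : InjOn ψ U) : IsOpen (ψ '' U) := by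
  rw [isOpen_iff_mem_nhds]
  rintro _ ⟨p, hp, rfl⟩
  obtain ⟨r, hr, hsub⟩ := Metric.nhds_basis_closedBall.mem_iff.1 (hU.mem_nhds hp)
  exact Filter.mem_of_superset (mem_interior_iff_mem_nhds.1
    (mem_interior_image_closedBall hr (hψ.mono hsub) (hinj.mono hsub))) (image_mono hsub)

theorem isClosed_segment (a b : ℂ) : IsClosed (segment ℝ a b) := by
  rw [segment_eq_image']
  exact (isCompact_Icc.image (by fun_prop)).isClosed

theorem reflTransGen_swap {α : Type*} {r : α → α → Prop} (h : ∀ a b, r a b → r b a) {a b : α}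
    (hab : Relation.ReflTransGen r a b) : Relation.ReflTransGen r b a := by
  induction hab with
  | refl => exact .refl
  | tail _ hbc ih => exact ih.head (h _ _ hbc)

theorem exists_mem_frontier {X : Type*} [TopologicalSpace X] {s C : Set X} (hs : IsPreconnected s)
    {x y : X} (hx : x ∈ s) (hy : y ∈ s) (hxC : x ∈ C) (hyC : y ∉ C) : ∃ z ∈ s, z ∈ frontier C := by
  by_contra! h
  have hx' : x ∈ interior C := by
    by_contra hc
    exact h x hx ⟨subset_closure hxC, hc⟩
  have hy' : y ∈ (closure C)ᶜ := fun hc => h y hy ⟨hc, fun hi => hyC (interior_subset hi)⟩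
  obtain ⟨z, -, hz1, hz2⟩ := hs (interior C) (closure C)ᶜ isOpen_interior
    isClosed_closure.isOpen_compl (fun z hz => by
      by_contra hc
      simp only [mem_union, mem_compl_iff, not_or, not_not] at hc
      exact h z hz ⟨hc.2, hc.1⟩) ⟨x, hx, hx'⟩ ⟨y, hy, hy'⟩
  exact hz2 (interior_subset_closure hz1)

/-! ### Planar sets homeomorphic to the disk -/

/-- Invariance of domain makes the interior of a planar set intrinsic, and hence also the part of
its frontier that belongs to it. -/
theorem map_interior_subset {C C' : Set ℂ} (h : C ≃ₜ C') {x : C} (hx : (x : ℂ) ∈ interior C) :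
    (h x : ℂ) ∈ interior C' := by
  classical
  let ψ : ℂ → ℂ := fun z => if hz : z ∈ C then h ⟨z, hz⟩ else 0
  have hψ : ∀ z (hz : z ∈ C), ψ z = h ⟨z, hz⟩ := fun z hz => by simp [ψ, hz]
  have hc : ContinuousOn ψ C := by
    rw [continuousOn_iff_continuous_domRestrict]
    have : C.domRestrict ψ = fun z => (h z : ℂ) := by
      funext z; exact hψ z z.2
    rw [this]; fun_prop
  have hinj : InjOn ψ C := fun a ha b hb hab => by
    rw [hψ a ha, hψ b hb] at hab
    simpa using h.injective (Subtype.ext hab)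
  have ho := isOpen_image_of_injOn isOpen_interior (hc.mono interior_subset)
    (hinj.mono interior_subset)
  have hsub : ψ '' interior C ⊆ C' := by
    rintro _ ⟨z, hz, rfl⟩
    rw [hψ z (interior_subset hz)]
    exact (h _).2
  refine interior_maximal hsub ho ⟨x, hx, ?_⟩
  rw [hψ x x.2]

theorem map_frontier_subset {C C' : Set ℂ} (h : C ≃ₜ C') {x : C} (hx : (x : ℂ) ∈ frontier C) :
    (h x : ℂ) ∈ frontier C' := by
  refine ⟨subset_closure (h x).2, fun hi => hx.2 ?_⟩
  simpa using map_interior_subset h.symm hi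

theorem convex_closedBall_diff_singleton {p : ℂ} (hp : ‖p‖ = 1) :
    Convex ℝ (Metric.closedBall (0 : ℂ) 1 \ {p}) := by
  rw [convex_iff_openSegment_subset]
  rintro x ⟨hx, hxp⟩ y ⟨hy, hyp⟩ z hz
  by_cases hxy : x = y
  · subst hxy
    rw [openSegment_same] at hz
    rw [mem_singleton_iff.1 hz]
    exact ⟨hx, hxp⟩
  · have := (strictConvex_closedBall ℝ (0 : ℂ) 1).openSegment_subset hx hy hxy hz
    rw [interior_closedBall _ one_ne_zero] at this
    refine ⟨Metric.ball_subset_closedBall this, fun h => ?_⟩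
    rw [mem_singleton_iff.1 h, mem_ball_zero_iff] at this
    exact this.ne hp

namespace DiskPolygon

variable {n : ℕ} (P : DiskPolygon n)

theorem isCompact_carrier : IsCompact P.carrier := by
  obtain ⟨φ⟩ := P.homeomorphic_disk
  have := isCompact_iff_compactSpace.1 (isCompact_closedBall (0 : ℂ) 1)
  exact isCompact_iff_compactSpace.2 φ.symm.compactSpace

theorem isClosed_carrier : IsClosed P.carrier := P.isCompact_carrier.isClosed

theorem frontier_subset : frontier P.carrier ⊆ P.carrier := P.isClosed_carrier.frontier_subset

theorem isPreconnected_carrier : IsPreconnected P.carrier := by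
  obtain ⟨φ⟩ := P.homeomorphic_disk
  have : PreconnectedSpace (Metric.closedBall (0 : ℂ) 1) :=
    isPreconnected_iff_preconnectedSpace.1 (convex_closedBall (0 : ℂ) 1).isPreconnected
  have : PreconnectedSpace P.carrier :=
    φ.symm.surjective.denseRange.preconnectedSpace φ.symm.continuous
  exact isPreconnected_iff_preconnectedSpace.2 this

theorem edgeSet_eq (i : Fin n) : P.toPolygon.edgeSet ℝ i =
    segment ℝ (P.vertices i) (P.vertices (finRotate n i)) := by
  rw [Polygon.edgeSet, affineSegment_eq_segment]

theorem frontier_eq_iUnion : frontier P.carrier =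
    ⋃ i, segment ℝ (P.vertices i) (P.vertices (finRotate n i)) := by
  rw [P.frontier_eq, Polygon.boundary]
  simp_rw [edgeSet_eq]

theorem segment_subset_frontier (i : Fin n) :
    segment ℝ (P.vertices i) (P.vertices (finRotate n i)) ⊆ frontier P.carrier := by
  rw [frontier_eq_iUnion]
  exact subset_iUnion (fun i => segment ℝ (P.vertices i) (P.vertices (finRotate n i))) i

theorem segment_subset_carrier (i : Fin n) :
    segment ℝ (P.vertices i) (P.vertices (finRotate n i)) ⊆ P.carrier :=
  (P.segment_subset_frontier i).trans P.frontier_subset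

theorem vertex_mem_frontier (i : Fin n) : P.vertices i ∈ frontier P.carrier :=
  P.segment_subset_frontier i (left_mem_segment _ _ _)

theorem vertexSet_subset_frontier : P.vertexSet ⊆ frontier P.carrier := by
  rintro _ ⟨i, rfl⟩
  exact P.vertex_mem_frontier i

theorem vertexSet_subset_carrier : P.vertexSet ⊆ P.carrier :=
  P.vertexSet_subset_frontier.trans P.frontier_subset

theorem vertexSet_finite : P.vertexSet.Finite := finite_range _

theorem two_le {n : ℕ} (P : DiskPolygon n) : 2 ≤ n := (by decide : 2 ≤ 3).trans P.three_le

theorem finRotate_ne {n : ℕ} (P : DiskPolygon n) (i : Fin n) : finRotate n i ≠ i := by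
  have := support_finRotate_of_le P.two_le
  rw [← Equiv.Perm.mem_support, this]
  exact Finset.mem_univ _

theorem vertices_finRotate_ne (i : Fin n) : P.vertices (finRotate n i) ≠ P.vertices i :=
  fun h => P.finRotate_ne i (P.vertices_injective h)

/-- An index, which exists as `3 ≤ n`. -/
def zeroIndex : Fin n := ⟨0, by linarith [P.three_le]⟩

theorem vertexSet_nonempty : P.vertexSet.Nonempty := ⟨_, P.zeroIndex, rfl⟩

theorem carrier_nonempty : P.carrier.Nonempty := P.vertexSet_nonempty.mono P.vertexSet_subset_carrier

/-- A homeomorphism to the disk sends the frontier point `A` to the circle, and a disk without one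
boundary point is still convex. -/
theorem contractibleSpace_diff {A : ℂ} (hA : A ∈ frontier P.carrier) :
    ContractibleSpace ↥(P.carrier \ {A}) := by
  obtain ⟨φ⟩ := P.homeomorphic_disk
  have hAC := P.frontier_subset hA
  set p : Metric.closedBall (0 : ℂ) 1 := φ ⟨A, hAC⟩ with hpdef
  have hp : ‖(p : ℂ)‖ = 1 := by
    have := map_frontier_subset φ (x := ⟨A, hAC⟩) hA
    rw [frontier_closedBall _ one_ne_zero] at this
    simpa using this
  have hne : (Metric.closedBall (0 : ℂ) 1 \ {(p : ℂ)}).Nonempty := by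
    refine ⟨0, by simp, fun h => ?_⟩
    rw [← mem_singleton_iff.1 h] at hp
    simp at hp
  have := (convex_closedBall_diff_singleton hp).contractibleSpace hne
  let e : ↥(P.carrier \ {A}) ≃ₜ ↥(Metric.closedBall (0 : ℂ) 1 \ {(p : ℂ)}) :=
    { toFun := fun z => ⟨φ ⟨z, z.2.1⟩, (φ _).2, fun h => z.2.2 (by
        have := φ.injective (Subtype.ext (mem_singleton_iff.1 h))
        exact congrArg Subtype.val this)⟩
      invFun := fun z => ⟨φ.symm ⟨z, z.2.1⟩, (φ.symm _).2, fun h => z.2.2 (by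
        have : φ.symm ⟨z, z.2.1⟩ = ⟨A, hAC⟩ := Subtype.ext (mem_singleton_iff.1 h)
        have h2 : φ (φ.symm ⟨z, z.2.1⟩) = p := by rw [this]
        rw [φ.apply_symm_apply] at h2
        exact congrArg Subtype.val h2)⟩
      left_inv := fun z => by simp
      right_inv := fun z => by simp
      continuous_toFun := by fun_prop
      continuous_invFun := by fun_prop }
  exact e.contractibleSpace

/-! ### Radial structure near a point -/

theorem _root_.exists_radial_segment (B a b : ℂ) : ∃ ρ > 0, ∀ y ∈ segment ℝ a b, dist y B < ρ →
    ∀ t : ℝ, 0 < t → dist (B + t * (y - B)) B < ρ → B + t * (y - B) ∈ segment ℝ a b := by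
  by_cases hB : B ∈ segment ℝ a b
  swap
  · obtain ⟨ρ, hρ, h⟩ := Metric.isOpen_iff.1 (isClosed_segment a b).isOpen_compl B hB
    exact ⟨ρ, hρ, fun y hy hyB => absurd hy (h hyB)⟩
  by_cases hab : a = b
  · subst hab
    refine ⟨1, one_pos, fun y hy _ t _ _ => ?_⟩
    rw [segment_same, mem_singleton_iff] at hy hB ⊢
    rw [hy, hB]; ring
  have hab' : 0 < ‖b - a‖ := norm_pos_iff.2 (sub_ne_zero.2 (Ne.symm hab))
  rw [segment_eq_image'] at hB
  obtain ⟨s, ⟨hs0, hs1⟩, rfl⟩ := hB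
  -- Here `B` has parameter `s`. The product is at most the distance from `B` to each endpoint other
  -- than `B`; a factor that vanishes because `B` is an endpoint is replaced by `1`.
  refine ⟨(if s = 0 then 1 else s) * (if s = 1 then 1 else 1 - s) * ‖b - a‖, ?_, ?_⟩
  · have h1 : 0 < (if s = 0 then 1 else s) := by
      split_ifs with h
      · exact one_pos
      · exact lt_of_le_of_ne hs0 (Ne.symm h)
    have h2 : 0 < (if s = 1 then 1 else 1 - s) := by
      split_ifs with h
      · exact one_pos
      · exact sub_pos.2 (lt_of_le_of_ne hs1 h)
    positivity
  · intro y hy _ t ht hd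
    rw [segment_eq_image'] at hy ⊢
    obtain ⟨u, ⟨hu0, hu1⟩, rfl⟩ := hy
    have e : (a + s • (b - a) + t * (a + u • (b - a) - (a + s • (b - a))) : ℂ) =
        a + (s + t * (u - s)) • (b - a) := by
      simp only [Complex.real_smul]; push_cast; ring
    simp only [e] at hd ⊢
    refine ⟨_, ⟨?_, ?_⟩, rfl⟩
    all_goals
      have e2 : dist (a + (s + t * (u - s)) • (b - a)) (a + s • (b - a)) =
          |t * (u - s)| * ‖b - a‖ := by
        rw [dist_eq_norm, ← Real.norm_eq_abs, ← norm_smul]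
        congr 1
        simp only [Complex.real_smul]; push_cast; ring
      rw [e2] at hd
      have hd' := lt_of_mul_lt_mul_right hd hab'.le
      rw [abs_lt] at hd'
      obtain ⟨hd1, hd2⟩ := hd'
    · rcases eq_or_lt_of_le hs0 with h | h
      · subst h
        simp only [sub_zero, zero_add]; positivity
      · have h1 : (if s = 1 then 1 else 1 - s) ≤ 1 := by split_ifs <;> linarith
        rw [if_neg h.ne'] at hd1
        nlinarith
    · rcases eq_or_lt_of_le hs1 with h | h
      · subst h
        nlinarith
      · have h1 : (if s = 0 then 1 else s) ≤ 1 := by split_ifs <;> linarith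
        rw [if_neg h.ne] at hd2
        nlinarith

theorem exists_radial_frontier (B : ℂ) : ∃ ρ > 0, ∀ y ∈ frontier P.carrier, dist y B < ρ →
    ∀ t : ℝ, 0 < t → dist (B + t * (y - B)) B < ρ → B + t * (y - B) ∈ frontier P.carrier := by
  choose ρ hρ h using fun i : Fin n =>
    exists_radial_segment B (P.vertices i) (P.vertices (finRotate n i))
  have : Nonempty (Fin n) := ⟨P.zeroIndex⟩
  obtain ⟨i₀, hi₀⟩ := Finite.exists_min ρ
  refine ⟨ρ i₀, hρ i₀, fun y hy hyB t ht hd => ?_⟩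
  rw [frontier_eq_iUnion] at hy ⊢
  obtain ⟨i, hi⟩ := mem_iUnion.1 hy
  exact mem_iUnion.2 ⟨i, h i y hi (hyB.trans_le (hi₀ i)) t ht (hd.trans_le (hi₀ i))⟩

/-- Near any point `B` the region is invariant under homotheties with center `B`. -/
theorem exists_radial (B : ℂ) : ∃ ρ > 0, ∀ y ∈ P.carrier, dist y B < ρ →
    ∀ t : ℝ, 0 < t → dist (B + t * (y - B)) B < ρ → B + t * (y - B) ∈ P.carrier := by
  obtain ⟨ρ, hρ, h⟩ := P.exists_radial_frontier B
  refine ⟨ρ, hρ, fun y hy hyB t ht hd => ?_⟩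
  by_contra hcon
  -- If the scaled point were outside, the segment to it from `y`, which lies on a ray from `B`,
  -- would cross the frontier. Radial invariance of the frontier would then put the scaled point on
  -- the frontier, hence in the region.
  obtain ⟨z, hz, hzf⟩ := exists_mem_frontier
    (convex_segment (𝕜 := ℝ) y (B + t * (y - B))).isPreconnected
    (left_mem_segment _ _ _) (right_mem_segment _ _ _) hy hcon
  have hzb : dist z B < ρ :=
    (convex_ball B ρ).segment_subset (Metric.mem_ball.2 hyB) (Metric.mem_ball.2 hd) hz
  rw [segment_eq_image'] at hz
  obtain ⟨s, ⟨hs0, hs1⟩, rfl⟩ := hz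
  set τ := 1 + s * (t - 1) with hτ
  have hτ0 : 0 < τ := by
    rcases eq_or_lt_of_le hs1 with h | h
    · rw [hτ, h]; linarith
    · nlinarith [mul_nonneg hs0 ht.le]
  have e : (y + s • (B + t * (y - B) - y) : ℂ) = B + τ * (y - B) := by
    rw [hτ, Complex.real_smul]; push_cast; ring
  simp only [e] at hzf hzb
  have e2 : ∀ r : ℝ, B + ((r / τ : ℝ) : ℂ) * (B + τ * (y - B) - B) = B + r * (y - B) := fun r => by
    have : (τ : ℂ) ≠ 0 := by exact_mod_cast hτ0.ne'
    push_cast; field_simp; ring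
  exact hcon (P.frontier_subset (by
    have := h _ hzf hzb (t / τ) (by positivity) (by rwa [e2])
    rwa [e2] at this))

/-! ### Edges and vertices -/

theorem mem_edge_inter {i j : Fin n} (hij : i ≠ j) {z : ℂ}
    (hi : z ∈ segment ℝ (P.vertices i) (P.vertices (finRotate n i)))
    (hj : z ∈ segment ℝ (P.vertices j) (P.vertices (finRotate n j))) :
    (j = finRotate n i ∧ z = P.vertices j) ∨ (i = finRotate n j ∧ z = P.vertices i) := by
  rw [← edgeSet_eq] at hi hj
  by_cases h1 : j = finRotate n i
  · left
    have := P.edge_inter_next i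
    rw [← h1] at this
    exact ⟨h1, by simpa [this] using (mem_inter hi hj)⟩
  by_cases h2 : i = finRotate n j
  · right
    have := P.edge_inter_next j
    rw [← h2] at this
    exact ⟨h2, by simpa [this] using (mem_inter hj hi)⟩
  · exact absurd hj (disjoint_left.1 (P.edge_disjoint i j hij h1 h2) hi)

theorem eq_or_eq_of_mem_edge {i j : Fin n}
    (h : P.vertices j ∈ segment ℝ (P.vertices i) (P.vertices (finRotate n i))) :
    j = i ∨ j = finRotate n i := by
  by_cases hij : i = j
  · exact Or.inl hij.symm
  · rcases P.mem_edge_inter hij h (left_mem_segment _ _ _) with h | h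
    · exact Or.inr h.1
    · exact Or.inl (P.vertices_injective h.2)

/-- Different sides share only vertices, so a connected set without vertices cannot pass from one
closed side to another. -/
theorem exists_edge_of_isPreconnected {s : Set ℂ} (hs : IsPreconnected s) (hne : s.Nonempty)
    (hsub : s ⊆ frontier P.carrier) (hV : Disjoint s P.vertexSet) :
    ∃ j, s ⊆ segment ℝ (P.vertices j) (P.vertices (finRotate n j)) := by
  obtain ⟨z, hz⟩ := hne
  have hz' := hsub hz
  rw [frontier_eq_iUnion] at hz'
  obtain ⟨j, hj⟩ := mem_iUnion.1 hz'
  have hno : ∀ k ≠ j, ∀ w ∈ s, w ∈ segment ℝ (P.vertices j) (P.vertices (finRotate n j)) →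
      w ∉ segment ℝ (P.vertices k) (P.vertices (finRotate n k)) := by
    intro k hk w hw hwj hwk
    rcases P.mem_edge_inter hk.symm hwj hwk with h | h
    · exact disjoint_left.1 hV hw ⟨k, h.2.symm⟩
    · exact disjoint_left.1 hV hw ⟨j, h.2.symm⟩
  refine ⟨j, ?_⟩
  have hcl : IsClosed (⋃ k : {k // k ≠ j},
      segment ℝ (P.vertices k) (P.vertices (finRotate n k))) :=
    isClosed_iUnion_of_finite fun k => isClosed_segment _ _
  have hcov : s ⊆ segment ℝ (P.vertices j) (P.vertices (finRotate n j)) ∪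
      ⋃ k : {k // k ≠ j}, segment ℝ (P.vertices k) (P.vertices (finRotate n k)) := by
    intro w hw
    have := hsub hw
    rw [frontier_eq_iUnion] at this
    obtain ⟨k, hk⟩ := mem_iUnion.1 this
    by_cases hkj : k = j
    · subst hkj; exact Or.inl hk
    · exact Or.inr (mem_iUnion.2 ⟨⟨k, hkj⟩, hk⟩)
  have hdisj : s ∩ (segment ℝ (P.vertices j) (P.vertices (finRotate n j)) ∩
      ⋃ k : {k // k ≠ j}, segment ℝ (P.vertices k) (P.vertices (finRotate n k))) = ∅ := by
    rw [eq_empty_iff_forall_notMem]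
    rintro w ⟨hw, hwj, hwk⟩
    obtain ⟨k, hk⟩ := mem_iUnion.1 hwk
    exact hno k k.2 w hw hwj hk
  rcases isPreconnected_iff_subset_of_disjoint_closed.1 hs _ _ (isClosed_segment _ _) hcl hcov hdisj
    with h | h
  · exact h
  · obtain ⟨k, hk⟩ := mem_iUnion.1 (h hz)
    exact absurd hk (hno k k.2 z hz hj)

/-- A homeomorphism of polygons that maps vertices to vertices maps adjacent vertices to adjacent
vertices. -/
theorem segment_subset_of_homeomorph {n' : ℕ} {P' : DiskPolygon n'} {f : ℂ → ℂ}
    (hf : BijOn f P.vertexSet P'.vertexSet) (h : P.carrier ≃ₜ P'.carrier)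
    (hfh : ∀ x : P.carrier, (x : ℂ) ∈ P.vertexSet → (h x : ℂ) = f x) (i : Fin n) :
    segment ℝ (f (P.vertices i)) (f (P.vertices (finRotate n i))) ⊆ P'.carrier := by
  set a := P.vertices i with ha
  set b := P.vertices (finRotate n i) with hb
  have hsegC : segment ℝ a b ⊆ P.carrier := P.segment_subset_carrier i
  have hmap : ∀ s : Set ℂ, s ⊆ segment ℝ a b → IsPreconnected s →
      IsPreconnected ((fun x => (h x : ℂ)) '' (Subtype.val ⁻¹' s)) := fun s hs hc => by
    refine IsPreconnected.image ?_ _ (by fun_prop)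
    have : IsInducing (Subtype.val : P.carrier → ℂ) := IsInducing.subtypeVal
    rw [← this.isPreconnected_image]
    rwa [Subtype.image_preimage_coe, inter_eq_right.2 (hs.trans hsegC)]
  have hO : openSegment ℝ a b ⊆ segment ℝ a b := openSegment_subset_segment ℝ a b
  have hab : a ≠ b := (P.vertices_finRotate_ne i).symm
  have hnot : ∀ z ∈ openSegment ℝ a b, z ∉ P.vertexSet := by
    rintro z hz ⟨j, rfl⟩
    rcases P.eq_or_eq_of_mem_edge (hO hz) with h | h
    · subst h
      exact hab (left_mem_openSegment_iff.1 hz)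
    · subst h
      exact hab (right_mem_openSegment_iff.1 hz)
  -- The image of the open side is connected, lies in the frontier and contains no vertex, so one
  -- side of `P'` contains it. Passing to the closure adds the images of the two endpoints.
  obtain ⟨j, hj⟩ := P'.exists_edge_of_isPreconnected
    (hmap _ hO (convex_openSegment a b).isPreconnected) (by
      obtain ⟨z, hz⟩ : (openSegment ℝ a b).Nonempty :=
        ⟨_, 1 / 2, 1 / 2, by norm_num, by norm_num, by norm_num, rfl⟩
      exact ⟨_, ⟨z, hsegC (hO hz)⟩, hz, rfl⟩) (by
      rintro _ ⟨z, hz, rfl⟩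
      exact map_frontier_subset h (P.segment_subset_frontier i (hO hz))) (by
      rw [disjoint_left]
      rintro _ ⟨z, hz, rfl⟩ hV
      obtain ⟨y, hy, hyz⟩ := hf.surjOn hV
      have h1 := hfh ⟨y, P.vertexSet_subset_carrier hy⟩ hy
      have h2 : h ⟨y, P.vertexSet_subset_carrier hy⟩ = h z := Subtype.ext (by
        rw [h1]; exact hyz)
      rw [← h.injective h2] at hz
      exact hnot y hz hy)
  set e := segment ℝ (P'.vertices j) (P'.vertices (finRotate n' j)) with he
  have hcl : IsClosed (Subtype.val '' ((fun x => (h x : ℂ)) ⁻¹' e)) :=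
    P.isClosed_carrier.isClosedEmbedding_subtypeVal.isClosedMap _
      ((isClosed_segment _ _).preimage (by fun_prop))
  have hsub : segment ℝ a b ⊆ Subtype.val '' ((fun x => (h x : ℂ)) ⁻¹' e) := by
    rw [← closure_openSegment]
    refine closure_minimal (fun z hz => ?_) hcl
    exact ⟨⟨z, hsegC (hO hz)⟩, hj ⟨_, hz, rfl⟩, rfl⟩
  have hend : ∀ k, P.vertices k ∈ segment ℝ a b → f (P.vertices k) ∈ e := by
    intro k hk
    obtain ⟨x, hx, hxk⟩ := hsub hk
    have h2 := hfh x (hxk ▸ ⟨k, rfl⟩)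
    rw [← hxk, ← h2]
    exact hx
  exact ((convex_segment _ _).segment_subset (hend _ (left_mem_segment _ _ _))
    (hend _ (right_mem_segment _ _ _))).trans (P'.segment_subset_carrier j)

/-- Any two vertices other than `A` are joined by a chain of edges that avoids `A`. -/
theorem reflTransGen_edge (A : ℂ) {i₁ i₂ : Fin n} (h₁ : P.vertices i₁ ≠ A)
    (h₂ : P.vertices i₂ ≠ A) :
    Relation.ReflTransGen (fun a b => (b = finRotate n a ∨ a = finRotate n b) ∧
      P.vertices a ≠ A ∧ P.vertices b ≠ A) i₁ i₂ := by
  -- A cycle without the index `j` is a path that starts at `finRotate n j`.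
  have key : ∀ j i₁ i₂ : Fin n, i₁ ≠ j → i₂ ≠ j → Relation.ReflTransGen
      (fun a b => (b = finRotate n a ∨ a = finRotate n b) ∧ a ≠ j ∧ b ≠ j) i₁ i₂ := by
    intro j
    have reach : ∀ t : ℕ, (finRotate n ^ t) j ≠ j → Relation.ReflTransGen
        (fun a b => (b = finRotate n a ∨ a = finRotate n b) ∧ a ≠ j ∧ b ≠ j)
        (finRotate n j) ((finRotate n ^ t) j) := by
      intro t
      induction t with
      | zero => intro h; exact absurd rfl h
      | succ t ih =>
        intro h
        rw [pow_succ', Equiv.Perm.mul_apply] at h ⊢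
        by_cases ht : (finRotate n ^ t) j = j
        · rw [ht]
        · exact (ih ht).tail ⟨Or.inl rfl, ht, h⟩
    have reach' : ∀ i ≠ j, Relation.ReflTransGen
        (fun a b => (b = finRotate n a ∨ a = finRotate n b) ∧ a ≠ j ∧ b ≠ j)
        (finRotate n j) i := by
      intro i hi
      obtain ⟨t, ht⟩ := (isCycle_finRotate_of_le P.two_le).exists_pow_eq
        (P.finRotate_ne j) (P.finRotate_ne i)
      rw [← ht]
      exact reach t (by rwa [ht])
    intro i₁ i₂ h₁ h₂
    exact (reflTransGen_swap (fun a b h => ⟨h.1.symm, h.2.2, h.2.1⟩) (reach' i₁ h₁)).trans (reach' i₂ h₂)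
  by_cases hA : ∃ j, P.vertices j = A
  · obtain ⟨j, rfl⟩ := hA
    refine Relation.ReflTransGen.mono ?_ _ _
      (key j i₁ i₂ (fun h => h₁ (by rw [h])) (fun h => h₂ (by rw [h])))
    rintro a b ⟨h, ha, hb⟩
    exact ⟨h, P.vertices_injective.ne ha, P.vertices_injective.ne hb⟩
  · push Not at hA
    -- If `A` is no vertex, any third index can be removed instead; it exists because `3 ≤ n`.
    obtain ⟨j, hj⟩ : ∃ j, j ∉ ({i₁, i₂} : Finset (Fin n)) := by
      by_contra! hc
      have := Finset.card_le_card (fun j _ => hc j : (Finset.univ : Finset (Fin n)) ⊆ {i₁, i₂})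
      have h3 := P.three_le
      rw [Finset.card_univ, Fintype.card_fin] at this
      have h4 := Finset.card_le_two (a := i₁) (b := i₂)
      omega
    simp only [Finset.mem_insert, Finset.mem_singleton, not_or] at hj
    exact Relation.ReflTransGen.mono (fun a b h => ⟨h.1, hA a, hA b⟩) _ _
      (key j i₁ i₂ (Ne.symm hj.1) (Ne.symm hj.2))

end DiskPolygon

namespace SimilaritySystem

variable {m : ℕ} (S : SimilaritySystem m)

/-! ### Words and the coding map -/

theorem map_sub (i : Fin m) (z z' : ℂ) :
    S.map i z - S.map i z' = (S.map i).mult * (z - z') := by ring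

theorem map_injective (i : Fin m) : Function.Injective (S.map i) := fun z z' h => by
  have h1 := S.map_sub i z z'
  rw [h, sub_self] at h1
  exact sub_eq_zero.1 ((mul_eq_zero.1 h1.symm).resolve_left (S.map i).mult_ne_zero)

theorem continuous_map (i : Fin m) : Continuous (S.map i : ℂ → ℂ) := by fun_prop

theorem exists_ratio : ∃ q : ℝ, 0 < q ∧ q < 1 ∧ ∀ i, ‖(S.map i).mult‖ ≤ q := by
  have : Nonempty (Fin m) := ⟨⟨0, S.pos⟩⟩
  obtain ⟨i₀, hi₀⟩ := Finite.exists_max fun i => ‖(S.map i).mult‖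
  exact ⟨‖(S.map i₀).mult‖, norm_pos_iff.2 (S.map i₀).mult_ne_zero,
    (S.map i₀).norm_mult_lt_one, hi₀⟩

@[simp] theorem wordMap_nil : S.wordMap [] = id := rfl

@[simp] theorem wordMap_cons (i : Fin m) (w : List (Fin m)) (z : ℂ) :
    S.wordMap (i :: w) z = S.map i (S.wordMap w z) := rfl

theorem wordMap_append (u w : List (Fin m)) (z : ℂ) :
    S.wordMap (u ++ w) z = S.wordMap u (S.wordMap w z) := by
  induction u with
  | nil => rfl
  | cons i u ih => simp only [List.cons_append, wordMap_cons, ih]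

@[simp] theorem wordMult_nil : S.wordMult [] = 1 := rfl

theorem wordMult_cons (i : Fin m) (w : List (Fin m)) :
    S.wordMult (i :: w) = (S.map i).mult * S.wordMult w := by
  simp [wordMult]

theorem wordMult_append (u w : List (Fin m)) :
    S.wordMult (u ++ w) = S.wordMult u * S.wordMult w := by
  simp [wordMult]

theorem wordMult_ne_zero (w : List (Fin m)) : S.wordMult w ≠ 0 := by
  induction w with
  | nil => simp
  | cons i w ih => rw [wordMult_cons]; exact mul_ne_zero (S.map i).mult_ne_zero ih

theorem wordMap_injective (w : List (Fin m)) : Function.Injective (S.wordMap w) := fun z z' h => by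
  have h1 := S.wordMap_sub w z z'
  rw [h, sub_self] at h1
  exact sub_eq_zero.1 ((mul_eq_zero.1 h1.symm).resolve_left (S.wordMult_ne_zero w))

theorem continuous_wordMap (w : List (Fin m)) : Continuous (S.wordMap w) := by
  induction w with
  | nil => exact continuous_id
  | cons i w ih => exact (S.continuous_map i).comp ih

theorem norm_wordMult_le {q : ℝ} (hq : ∀ i, ‖(S.map i).mult‖ ≤ q) (w : List (Fin m)) :
    ‖S.wordMult w‖ ≤ q ^ w.length := by
  induction w with
  | nil => simp
  | cons i w ih =>
    rw [wordMult_cons, norm_mul, List.length_cons, pow_succ']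
    exact mul_le_mul (hq i) ih (norm_nonneg _) ((norm_nonneg _).trans (hq i))

theorem le_norm_wordMult {a : ℝ} (ha : 0 ≤ a) (h : ∀ i, a ≤ ‖(S.map i).mult‖) (w : List (Fin m)) :
    a ^ w.length ≤ ‖S.wordMult w‖ := by
  induction w with
  | nil => simp
  | cons i w ih =>
    rw [wordMult_cons, norm_mul, List.length_cons, pow_succ']
    exact mul_le_mul (h i) ih (by positivity) (norm_nonneg _)

theorem norm_wordMult_lt_one {w : List (Fin m)} (hw : w ≠ []) : ‖S.wordMult w‖ < 1 := by
  obtain ⟨q, hq0, hq1, hq⟩ := S.exists_ratio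
  exact (S.norm_wordMult_le hq w).trans_lt
    (pow_lt_one₀ hq0.le hq1 (by simpa using hw))

/-- The coding map: `S.coding σ` is the limit of `S_{σ_0} ∘ ⋯ ∘ S_{σ_k}`. -/
def coding (σ : ℕ → Fin m) : ℂ :=
  -- The partial sums are the values at `0` of the finite compositions, as a similarity takes the
  -- value `(1 - mult) * center` at `0`.
  ∑' k, (∏ j ∈ Finset.range k, (S.map (σ j)).mult) *
    ((1 - (S.map (σ k)).mult) * (S.map (σ k)).center)

theorem exists_bound_coding : ∃ q C : ℝ, 0 < q ∧ q < 1 ∧ ∀ (σ : ℕ → Fin m) (k : ℕ),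
    ‖(∏ j ∈ Finset.range k, (S.map (σ j)).mult) *
      ((1 - (S.map (σ k)).mult) * (S.map (σ k)).center)‖ ≤ C * q ^ k := by
  obtain ⟨q, hq0, hq1, hq⟩ := S.exists_ratio
  have : Nonempty (Fin m) := ⟨⟨0, S.pos⟩⟩
  obtain ⟨i₀, hi₀⟩ := Finite.exists_max fun i => ‖(1 - (S.map i).mult) * (S.map i).center‖
  refine ⟨q, ‖(1 - (S.map i₀).mult) * (S.map i₀).center‖, hq0, hq1, fun σ k => ?_⟩
  rw [norm_mul, mul_comm, norm_prod]
  refine mul_le_mul (hi₀ _) ?_ (Finset.prod_nonneg fun _ _ => norm_nonneg _) (norm_nonneg _)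
  calc ∏ j ∈ Finset.range k, ‖(S.map (σ j)).mult‖ ≤ ∏ j ∈ Finset.range k, q :=
        Finset.prod_le_prod (fun _ _ => norm_nonneg _) fun j _ => hq _
    _ = q ^ k := by simp

theorem continuous_coding : Continuous S.coding := by
  obtain ⟨q, C, hq0, hq1, h⟩ := S.exists_bound_coding
  refine continuous_tsum (u := fun k => C * q ^ k) (fun k => ?_)
    ((summable_geometric_of_lt_one hq0.le hq1).mul_left C) fun k σ => h σ k
  have hc : ∀ (g : Fin m → ℂ) (j : ℕ), Continuous fun σ : ℕ → Fin m => g (σ j) := fun g j =>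
    continuous_of_discreteTopology.comp (continuous_apply j)
  exact (continuous_finsetProd _ fun j _ => hc (fun i => (S.map i).mult) j).mul
    (hc (fun i => (1 - (S.map i).mult) * (S.map i).center) k)

theorem coding_eq (σ : ℕ → Fin m) : S.coding σ = S.map (σ 0) (S.coding fun k => σ (k + 1)) := by
  obtain ⟨q, C, hq0, hq1, h⟩ := S.exists_bound_coding
  have hs : ∀ σ : ℕ → Fin m, Summable fun k => (∏ j ∈ Finset.range k, (S.map (σ j)).mult) *
      ((1 - (S.map (σ k)).mult) * (S.map (σ k)).center) := fun σ =>
    Summable.of_norm_bounded ((summable_geometric_of_lt_one hq0.le hq1).mul_left C) (h σ)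
  rw [coding, (hs σ).tsum_eq_zero_add]
  simp only [Finset.prod_range_succ']
  rw [coding]
  have : ∀ k, (∏ j ∈ Finset.range k, (S.map (σ (j + 1))).mult) * (S.map (σ 0)).mult *
      ((1 - (S.map (σ (k + 1))).mult) * (S.map (σ (k + 1))).center) =
      (S.map (σ 0)).mult * ((∏ j ∈ Finset.range k, (S.map (σ (j + 1))).mult) *
      ((1 - (S.map (σ (k + 1))).mult) * (S.map (σ (k + 1))).center)) := fun k => by ring
  simp only [this, tsum_mul_left, Finset.range_zero, Finset.prod_empty]
  ring

/-- The address `i σ`. -/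
def consAddress (i : Fin m) (σ : ℕ → Fin m) : ℕ → Fin m
  | 0 => i
  | k + 1 => σ k

theorem coding_consAddress (i : Fin m) (σ : ℕ → Fin m) :
    S.coding (consAddress i σ) = S.map i (S.coding σ) := S.coding_eq _

theorem attractor_eq_range : S.attractor = range S.coding := by
  have : Nonempty (Fin m) := ⟨⟨0, S.pos⟩⟩
  refine S.existsUnique_isAttractor.unique S.isAttractor_attractor
    ⟨range_nonempty _, isCompact_range S.continuous_coding, ?_⟩
  ext z
  simp only [mem_range, mem_iUnion, mem_image, exists_exists_eq_and]
  constructor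
  · rintro ⟨σ, rfl⟩
    exact ⟨σ 0, _, (S.coding_eq σ).symm⟩
  · rintro ⟨i, σ, rfl⟩
    exact ⟨consAddress i σ, S.coding_consAddress i σ⟩

theorem coding_mem (σ : ℕ → Fin m) : S.coding σ ∈ S.attractor := by
  rw [attractor_eq_range]; exact ⟨σ, rfl⟩

theorem map_mem_attractor (i : Fin m) {z : ℂ} (hz : z ∈ S.attractor) :
    S.map i z ∈ S.attractor := by
  rw [S.isAttractor_attractor.eq_iUnion]
  exact mem_iUnion.2 ⟨i, z, hz, rfl⟩

theorem wordMap_mem_attractor (w : List (Fin m)) {z : ℂ} (hz : z ∈ S.attractor) :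
    S.wordMap w z ∈ S.attractor := by
  induction w with
  | nil => exact hz
  | cons i w ih => exact S.map_mem_attractor i ih

theorem exists_map_eq {z : ℂ} (hz : z ∈ S.attractor) : ∃ i, ∃ y ∈ S.attractor, S.map i y = z := by
  rw [S.isAttractor_attractor.eq_iUnion] at hz
  obtain ⟨i, y, hy, rfl⟩ := mem_iUnion.1 hz
  exact ⟨i, y, hy, rfl⟩

theorem exists_wordMap_eq {X : Set ℂ} (hX : X ⊆ ⋃ i, S.map i '' X) (k : ℕ) {z : ℂ} (hz : z ∈ X) :
    ∃ w : List (Fin m), w.length = k ∧ ∃ y ∈ X, S.wordMap w y = z := by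
  induction k generalizing z with
  | zero => exact ⟨[], rfl, z, hz, rfl⟩
  | succ k ih =>
    obtain ⟨i, y, hy, rfl⟩ := mem_iUnion.1 (hX hz)
    obtain ⟨w, hw, x, hx, rfl⟩ := ih hy
    exact ⟨i :: w, by simp [hw], x, hx, rfl⟩

theorem wordMap_mem {Y : Set ℂ} (hY : ∀ i, S.map i '' Y ⊆ Y) (w : List (Fin m)) {z : ℂ}
    (hz : z ∈ Y) : S.wordMap w z ∈ Y := by
  induction w with
  | nil => exact hz
  | cons i w ih => exact hY i ⟨_, ih, rfl⟩

/-- A point of `X` is `S_w z` with `w` as long as desired, and `S_w y` with `y ∈ Y` is a nearby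
point of `Y`. This gives both `V_P ⊆ K` and `K ⊆ P`. -/
theorem subset_of_invariant {X Y : Set ℂ} (hX : X ⊆ ⋃ i, S.map i '' X)
    (hXb : Bornology.IsBounded X) (hY : ∀ i, S.map i '' Y ⊆ Y) (hYc : IsClosed Y)
    (hYn : Y.Nonempty) : X ⊆ Y := by
  intro x hx
  obtain ⟨y, hy⟩ := hYn
  obtain ⟨q, hq0, hq1, hq⟩ := S.exists_ratio
  obtain ⟨D, hD⟩ := (hXb.union (Bornology.isBounded_singleton (x := y))).exists_norm_le
  have hD0 : 0 ≤ D := (norm_nonneg y).trans (hD y (by simp))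
  rw [← hYc.closure_eq, Metric.mem_closure_iff]
  intro ε hε
  obtain ⟨k, hk⟩ := exists_pow_lt_of_lt_one (show 0 < ε / (2 * D + 1) by positivity) hq1
  obtain ⟨w, hw, z, hz, rfl⟩ := S.exists_wordMap_eq hX k hx
  refine ⟨S.wordMap w y, S.wordMap_mem hY w hy, ?_⟩
  rw [dist_eq_norm, wordMap_sub, norm_mul]
  have h1 := S.norm_wordMult_le hq w
  rw [hw] at h1
  have h2 : ‖z - y‖ ≤ 2 * D := by
    have := norm_sub_le z y
    linarith [hD z (Or.inl hz), hD y (by simp)]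
  calc _ ≤ q ^ k * (2 * D) := mul_le_mul h1 h2 (norm_nonneg _) (by positivity)
    _ ≤ q ^ k * (2 * D + 1) := by gcongr; linarith
    _ < ε := (lt_div_iff₀ (by positivity)).1 hk

/-! ### Systems with the same symbolic structure -/

/-- The pieces `S_i K` of the attractor meet only in images of the points of a set `V ⊆ K` with
`V ⊆ ⋃ i, S_i V`. -/
structure IsSeparatedBy (V : Set ℂ) : Prop where
  subset_attractor : V ⊆ S.attractor
  subset_iUnion : V ⊆ ⋃ i, S.map i '' V
  inter_subset : ∀ i j, i ≠ j →
    S.map i '' S.attractor ∩ S.map j '' S.attractor ⊆ S.map i '' V ∩ S.map j '' V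

variable {S} {S' : SimilaritySystem m} {V : Set ℂ}

/-- Consequently, all tails of an address of a point of `V` are addresses of points of `V`. -/
theorem IsSeparatedBy.mem_image (h : S.IsSeparatedBy V) {A : ℂ} (hA : A ∈ V) {i : Fin m} {z : ℂ}
    (hz : z ∈ S.attractor) (e : S.map i z = A) : z ∈ V := by
  obtain ⟨k, a, ha, hk⟩ := mem_iUnion.1 (h.subset_iUnion hA)
  by_cases hki : k = i
  · subst hki
    rwa [S.map_injective _ (e.trans hk.symm)]
  · obtain ⟨-, b, hb, hb'⟩ := h.inter_subset k i hki
      ⟨⟨a, h.subset_attractor ha, hk⟩, ⟨z, hz, e⟩⟩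
    rwa [S.map_injective _ (e.trans hb'.symm)]

theorem eq_zero_of_forall_le {q D x : ℝ} (hq0 : 0 < q) (hq1 : q < 1) (hx : 0 ≤ x)
    (h : ∀ N : ℕ, x ≤ q ^ N * D) : x = 0 := by
  refine le_antisymm ?_ hx
  have h1 : Filter.Tendsto (fun N : ℕ => q ^ N * D) Filter.atTop (𝓝 (0 * D)) :=
    (tendsto_pow_atTop_nhds_zero_of_lt_one hq0.le hq1).mul_const D
  rw [zero_mul] at h1
  exact ge_of_tendsto' h1 h

/-- Remove common first letters from the two addresses. Where they first differ, the coded point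
lies in two pieces, so both tails code points of `V`, and there the coding of `S'` is determined by
`f`. If they never differ, there is nothing to prove. The bounds with `q ^ N` run both cases in one
induction. -/
theorem IsSeparatedBy.coding_eq_coding (h : S.IsSeparatedBy V) {f : ℂ → ℂ}
    (hfV : Bornology.IsBounded (f '' V))
    (hf : ∀ k, ∀ x ∈ V, f (S.map k x) = S'.map k (f x)) {σ τ : ℕ → Fin m}
    (hστ : S.coding σ = S.coding τ) : S'.coding σ = S'.coding τ := by
  obtain ⟨q, hq0, hq1, hq⟩ := S'.exists_ratio
  obtain ⟨D, hD⟩ := (hfV.union S'.isAttractor_attractor.isCompact.isBounded).exists_norm_le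
  have hcod : ∀ σ, ‖S'.coding σ‖ ≤ D := fun σ => hD _ (Or.inr (S'.coding_mem σ))
  -- The shift keeps addresses of points of `V` among such addresses and `f` intertwines it, so each
  -- letter gains a factor `q`.
  have hvert : ∀ (N : ℕ) (σ : ℕ → Fin m), S.coding σ ∈ V →
      ‖S'.coding σ - f (S.coding σ)‖ ≤ q ^ N * (2 * D) := by
    intro N
    induction N with
    | zero =>
      intro σ hσ
      have := norm_sub_le (S'.coding σ) (f (S.coding σ))
      have h1 := hcod σ
      have h2 := hD _ (Or.inl ⟨_, hσ, rfl⟩)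
      linarith
    | succ N ih =>
      intro σ hσ
      have h1 := h.mem_image hσ (S.coding_mem _) (S.coding_eq σ).symm
      rw [S.coding_eq σ, S'.coding_eq σ, hf _ _ h1, map_sub, norm_mul, pow_succ', mul_assoc]
      exact mul_le_mul (hq _) (ih _ h1) (norm_nonneg _) hq0.le
  have hvert' : ∀ σ, S.coding σ ∈ V → S'.coding σ = f (S.coding σ) := fun σ hσ =>
    sub_eq_zero.1 (norm_eq_zero.1 (eq_zero_of_forall_le hq0 hq1 (norm_nonneg _)
      fun N => hvert N σ hσ))
  have key : ∀ (N : ℕ) (σ τ : ℕ → Fin m), S.coding σ = S.coding τ →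
      ‖S'.coding σ - S'.coding τ‖ ≤ q ^ N * (2 * D) := by
    intro N
    induction N with
    | zero =>
      intro σ τ _
      have := norm_sub_le (S'.coding σ) (S'.coding τ)
      linarith [hcod σ, hcod τ]
    | succ N ih =>
      intro σ τ e
      rw [S.coding_eq σ, S.coding_eq τ] at e
      rw [S'.coding_eq σ, S'.coding_eq τ]
      by_cases h0 : σ 0 = τ 0
      · rw [h0] at e ⊢
        rw [map_sub, norm_mul, pow_succ', mul_assoc]
        exact mul_le_mul (hq _) (ih _ _ (S.map_injective _ e)) (norm_nonneg _) hq0.le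
      · obtain ⟨⟨a, ha, ha'⟩, b, hb, hb'⟩ := h.inter_subset _ _ h0
          ⟨⟨_, S.coding_mem _, rfl⟩, ⟨_, S.coding_mem _, e.symm⟩⟩
        have ea := S.map_injective _ ha'
        have eb := S.map_injective _ (hb'.trans e)
        rw [hvert' _ (ea ▸ ha), hvert' _ (eb ▸ hb), ← hf _ _ (ea ▸ ha), ← hf _ _ (eb ▸ hb), e,
          sub_self, norm_zero]
        have : 0 ≤ D := (norm_nonneg _).trans (hcod σ)
        positivity
  exact sub_eq_zero.1 (norm_eq_zero.1 (eq_zero_of_forall_le hq0 hq1 (norm_nonneg _)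
      fun N => key N σ τ hστ))

/-- Both coding maps are continuous surjections from a compact space to a Hausdorff space, hence
quotient maps, and here they have the same fibres. -/
theorem nonempty_homeomorph_of_coding
    (h : ∀ σ τ, S.coding σ = S.coding τ ↔ S'.coding σ = S'.coding τ) :
    Nonempty (S.attractor ≃ₜ S'.attractor) := by
  let π : ∀ T : SimilaritySystem m, C(ℕ → Fin m, T.attractor) := fun T =>
    ⟨fun σ => ⟨T.coding σ, T.coding_mem σ⟩, T.continuous_coding.subtype_mk _⟩
  have hquot : ∀ T : SimilaritySystem m, IsQuotientMap (π T) := fun T => by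
    refine (π T).continuous.isClosedMap.isQuotientMap (π T).continuous ?_
    rintro ⟨z, hz⟩
    rw [attractor_eq_range] at hz
    obtain ⟨σ, rfl⟩ := hz
    exact ⟨σ, rfl⟩
  have hker : Setoid.ker (π S) = Setoid.ker (π S') := by
    ext σ τ
    simp only [Setoid.ker_def, π, ContinuousMap.coe_mk, Subtype.mk.injEq]
    exact h σ τ
  have e1 := (hquot S).homeomorph
  rw [hker] at e1
  exact ⟨e1.symm.trans (hquot S').homeomorph⟩

end SimilaritySystem

theorem exists_pos_forall_le_dist {A B : Set ℂ} (hA : IsCompact A) (hB : IsClosed B)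
    (h : Disjoint A B) : ∃ r > 0, ∀ x ∈ A, ∀ y ∈ B, r ≤ dist x y := by
  obtain ⟨r, hr, h⟩ := Metric.exists_pos_forall_lt_edist hA hB h
  refine ⟨r, hr, fun x hx y hy => ?_⟩
  have := (h x hx y hy).le
  rw [edist_dist, ← ENNReal.ofReal_coe_nnreal] at this
  exact (ENNReal.ofReal_le_ofReal_iff dist_nonneg).1 this

namespace SimilaritySystem

variable {m n : ℕ} {S : SimilaritySystem m} {P : DiskPolygon n}

/-! ### Combinatorics of polygonal systems -/

theorem isClosed_piece (i : Fin m) : IsClosed (S.map i '' P.carrier) :=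
  (P.isCompact_carrier.image (S.continuous_map i)).isClosed

namespace IsGeneralizedPolygonal

variable (hS : S.IsGeneralizedPolygonal P)
include hS

theorem vertexSet_subset_attractor : P.vertexSet ⊆ S.attractor :=
  S.subset_of_invariant hS.vertexSet_subset P.vertexSet_finite.isBounded
    (fun i => by rintro _ ⟨z, hz, rfl⟩; exact S.map_mem_attractor i hz)
    S.isAttractor_attractor.isCompact.isClosed S.isAttractor_attractor.nonempty

theorem vertexSet_subset_pieceVertices : P.vertexSet ⊆ S.pieceVertices P := hS.vertexSet_subset

theorem mem_vertexSet_of_map {A z : ℂ} {i : Fin m} (hA : A ∈ P.vertexSet) (hz : z ∈ P.carrier)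
    (e : S.map i z = A) : z ∈ P.vertexSet := by
  obtain ⟨k, a, ha, hk⟩ := mem_iUnion.1 (hS.vertexSet_subset hA)
  by_cases hki : k = i
  · subst hki
    rwa [S.map_injective _ (e.trans hk.symm)]
  · have : A ∈ S.map k '' P.carrier ∩ S.map i '' P.carrier :=
      ⟨⟨a, P.vertexSet_subset_carrier ha, hk⟩, ⟨z, hz, e⟩⟩
    rw [hS.inter_eq k i hki] at this
    obtain ⟨-, b, hb, hb'⟩ := this
    rwa [S.map_injective _ (e.trans hb'.symm)]

theorem inter_subsingleton {i j : Fin m} (hij : i ≠ j) {x y : ℂ} (hxi : x ∈ S.map i '' P.carrier)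
    (hxj : x ∈ S.map j '' P.carrier) (hyi : y ∈ S.map i '' P.carrier)
    (hyj : y ∈ S.map j '' P.carrier) : x = y := by
  have hx : x ∈ S.map i '' P.carrier ∩ S.map j '' P.carrier := ⟨hxi, hxj⟩
  have hy : y ∈ S.map i '' P.carrier ∩ S.map j '' P.carrier := ⟨hyi, hyj⟩
  rw [hS.inter_eq i j hij] at hx hy
  have h1 : (S.map i '' P.vertexSet ∩ S.map j '' P.vertexSet).encard ≤ 1 :=
    Order.le_of_lt_add_one (by rw [one_add_one_eq_two]; exact hS.encard_inter_lt i j hij)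
  exact encard_le_one_iff.1 h1 x y hx hy

/-- The union of the polygons is connected, whereas the reachable and the unreachable polygons form
two disjoint closed sets. -/
theorem reflTransGen_piece (i j : Fin m) : Relation.ReflTransGen
    (fun i j => (S.map i '' P.vertexSet ∩ S.map j '' P.vertexSet).Nonempty) i j := by
  set r : Fin m → Fin m → Prop :=
    fun i j => (S.map i '' P.vertexSet ∩ S.map j '' P.vertexSet).Nonempty with hr
  have hmeet : ∀ k l : Fin m, ∀ z, z ∈ S.map k '' P.carrier → z ∈ S.map l '' P.carrier →
      Relation.ReflTransGen r k l := by
    intro k l z hk hl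
    by_cases hkl : k = l
    · rw [hkl]
    · refine .single ⟨z, ?_⟩
      rw [← hS.inter_eq k l hkl]
      exact ⟨hk, hl⟩
  have := hS.contractible
  have hQ : IsPreconnected (⋃ i, S.map i '' P.carrier) :=
    isPreconnected_iff_preconnectedSpace.2 inferInstance
  obtain ⟨p, hp⟩ := P.carrier_nonempty
  have hcU : IsClosed (⋃ k : {k // Relation.ReflTransGen r i k}, S.map k '' P.carrier) :=
    isClosed_iUnion_of_finite fun k => isClosed_piece _
  have hcW : IsClosed (⋃ k : {k // ¬ Relation.ReflTransGen r i k}, S.map k '' P.carrier) :=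
    isClosed_iUnion_of_finite fun k => isClosed_piece _
  rcases isPreconnected_iff_subset_of_disjoint_closed.1 hQ _ _ hcU hcW (by
    intro z hz
    obtain ⟨k, hk⟩ := mem_iUnion.1 hz
    by_cases h : Relation.ReflTransGen r i k
    · exact Or.inl (mem_iUnion.2 ⟨⟨k, h⟩, hk⟩)
    · exact Or.inr (mem_iUnion.2 ⟨⟨k, h⟩, hk⟩)) (by
    rw [eq_empty_iff_forall_notMem]
    rintro z ⟨-, h1, h2⟩
    obtain ⟨k, hk⟩ := mem_iUnion.1 h1
    obtain ⟨l, hl⟩ := mem_iUnion.1 h2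
    exact l.2 (k.2.trans (hmeet k l z hk hl))) with h | h
  · obtain ⟨k, hk⟩ := mem_iUnion.1 (h (mem_iUnion.2 ⟨j, p, hp, rfl⟩))
    exact k.2.trans (hmeet k j _ hk ⟨p, hp, rfl⟩)
  · obtain ⟨k, hk⟩ := mem_iUnion.1 (h (mem_iUnion.2 ⟨i, p, hp, rfl⟩))
    exact absurd (hmeet i k _ ⟨p, hp, rfl⟩ hk) k.2

/-- The polygons `P_j`, `j ≠ i`, hang on `P_i` like the branches of a tree. -/
theorem eq_of_isPreconnected {i : Fin m} {R : Set ℂ} (hR : IsPreconnected R)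
    (hsub : R ⊆ ⋃ j : {j // j ≠ i}, S.map j '' P.carrier) {a b : ℂ} (ha : a ∈ R) (hb : b ∈ R)
    (hai : a ∈ S.map i '' P.carrier) (hbi : b ∈ S.map i '' P.carrier) : a = b := by
  classical
  by_contra hab
  set Pi := S.map i '' P.carrier with hPi
  set W := ⋃ j : {j // j ≠ i}, S.map j '' P.carrier with hW
  have hWc : IsClosed W := isClosed_iUnion_of_finite fun k => isClosed_piece _
  have hfin : (Pi ∩ W).Finite := by
    rw [hW, inter_iUnion]
    refine finite_iUnion fun j => Set.Subsingleton.finite fun x hx y hy => ?_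
    exact hS.inter_subsingleton j.2.symm hx.1 hx.2 hy.1 hy.2
  obtain ⟨ε, hε, hdist⟩ := exists_pos_forall_le_dist (isCompact_singleton (x := a))
    (hfin.subset sdiff_subset : ((Pi ∩ W) \ {a}).Finite).isClosed (by simp)
  -- The function `u` is `0` at `a` and `1` at all other points where `P_i` meets the remaining
  -- polygons. So `e ^ (2π i u)` on `P_i` and `1` on the rest glue to a continuous map into the
  -- circle. Its argument on the contractible union is constant on `R`, but grows by `2π` from `a`
  -- to `b` inside `P_i`.
  let u : ℂ → ℝ := fun z => min 1 (dist a z / ε)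
  have hu : Continuous u := by fun_prop
  have hua : u a = 0 := by simp [u]
  have hub : ∀ z ∈ Pi ∩ W, z ≠ a → u z = 1 := fun z hz hza =>
    min_eq_left ((one_le_div hε).2 (hdist a rfl z ⟨hz, hza⟩))
  have hexp : ∀ z ∈ Pi ∩ W, Complex.exp (((2 * Real.pi * u z : ℝ) : ℂ) * Complex.I) = 1 := by
    intro z hz
    by_cases hza : z = a
    · rw [hza, hua]; simp
    · rw [hub z hz hza]
      push_cast
      rw [mul_one]
      exact Complex.exp_two_pi_mul_I
  let g : ℂ → ℂ := fun z => if z ∈ Pi then Complex.exp (((2 * Real.pi * u z : ℝ) : ℂ) * Complex.I)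
    else 1
  have hgP : ∀ z ∈ Pi, g z = Complex.exp (((2 * Real.pi * u z : ℝ) : ℂ) * Complex.I) :=
    fun z hz => if_pos hz
  have hgW : ∀ z ∈ W, g z = 1 := fun z hz => by
    by_cases h : z ∈ Pi
    · rw [hgP z h, hexp z ⟨h, hz⟩]
    · exact if_neg h
  have hgc : ContinuousOn g (Pi ∪ W) := by
    refine ContinuousOn.union_of_isClosed ?_ ?_ (isClosed_piece i) hWc
    · exact (Continuous.continuousOn (by fun_prop)).congr hgP
    · exact continuousOn_const.congr hgW
  have hQ : (⋃ i, S.map i '' P.carrier) ⊆ Pi ∪ W := by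
    intro z hz
    obtain ⟨k, hk⟩ := mem_iUnion.1 hz
    by_cases hki : k = i
    · subst hki; exact Or.inl hk
    · exact Or.inr (mem_iUnion.2 ⟨⟨k, hki⟩, hk⟩)
  have hPQ : Pi ⊆ ⋃ i, S.map i '' P.carrier := subset_iUnion (fun i => S.map i '' P.carrier) i
  have hWQ : W ⊆ ⋃ i, S.map i '' P.carrier := iUnion_subset fun j =>
    subset_iUnion (fun i => S.map i '' P.carrier) j
  have hg1 : ∀ z, ‖g z‖ = 1 := fun z => by
    by_cases h : z ∈ Pi
    · rw [hgP z h, Complex.norm_exp_ofReal_mul_I]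
    · rw [show g z = 1 from if_neg h, norm_one]
  have := hS.contractible
  obtain ⟨θ, hθ⟩ := exists_argument_of_contractible
    (fun z : ↥(⋃ i, S.map i '' P.carrier) => g z) (hgc.mono hQ).domRestrict
    (fun z h => by have := hg1 z; simp [h] at this)
  have hθ' : ∀ z : ↥(⋃ i, S.map i '' P.carrier), g z = Complex.exp (θ z * Complex.I) := fun z => by
    have := hθ z
    rwa [hg1, Complex.ofReal_one, one_mul] at this
  have : PreconnectedSpace R := isPreconnected_iff_preconnectedSpace.1 hR
  have h1 := eq_of_exp_mul_I_eq (X := R) (θ := fun z => θ ⟨z, hWQ (hsub z.2)⟩) (by fun_prop)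
    (fun x y => by rw [← hθ', ← hθ', hgW _ (hsub x.2), hgW _ (hsub y.2)]) ⟨a, ha⟩ ⟨b, hb⟩
  have : PreconnectedSpace Pi := isPreconnected_iff_preconnectedSpace.1
    (P.isPreconnected_carrier.image _ (S.continuous_map i).continuousOn)
  have hk : ∀ z : Pi,
      Complex.exp (((θ ⟨z, hPQ z.2⟩ - 2 * Real.pi * u z : ℝ) : ℂ) * Complex.I) = 1 := by
    intro z
    push_cast
    rw [sub_mul, Complex.exp_sub, ← hθ', hgP z z.2]
    push_cast
    exact div_self (Complex.exp_ne_zero _)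
  have h2 := eq_of_exp_mul_I_eq (X := Pi) (θ := fun z => θ ⟨z, hPQ z.2⟩ - 2 * Real.pi * u z)
    (by fun_prop) (fun x y => (hk x).trans (hk y).symm) ⟨a, hai⟩ ⟨b, hbi⟩
  simp only [hua, hub b ⟨hbi, hsub hb⟩ (Ne.symm hab)] at h1 h2
  have := Real.pi_pos
  linarith

/-- A simple closed curve in the union of the polygons `P_i` lies in one of them. -/
theorem exists_forall_mem_piece {c : Circle → ℂ} (hc : Continuous c) (hinj : Function.Injective c)
    (hsub : ∀ t, c t ∈ ⋃ i, S.map i '' P.carrier) : ∃ i, ∀ t, c t ∈ S.map i '' P.carrier := by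
  have : Infinite Circle := by
    have : Infinite ↥(Ioc (-Real.pi) Real.pi) :=
      (Ioc_infinite (by linarith [Real.pi_pos])).to_subtype
    exact Infinite.of_injective (fun x : ↥(Ioc (-Real.pi) Real.pi) => Circle.exp x)
      fun x y h => Subtype.ext (Circle.exp_injOn_Ioc (by linarith) x.2 y.2 h)
  choose k hk using fun t => mem_iUnion.1 (hsub t)
  -- The curve has infinitely many points, so one polygon contains two of them. The second one is
  -- needed to exclude an excursion that leaves the polygon and returns to its starting point after
  -- a full turn.
  obtain ⟨t₁, t₂, ht, htk⟩ := Finite.exists_ne_map_eq_of_infinite k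
  refine ⟨k t₁, ?_⟩
  by_contra! hx
  obtain ⟨t₀, ht₀⟩ := hx
  set Pi := S.map (k t₁) '' P.carrier with hPi
  let γ : ℝ → ℂ := fun s => c (t₁ * Circle.exp s)
  have hγ : Continuous γ := by fun_prop
  have hparam : ∀ t : Circle, ∃ s ∈ Ico 0 (2 * Real.pi), t₁ * Circle.exp s = t := fun t => by
    obtain ⟨s, hs⟩ : ∃ s, Circle.exp s = t₁⁻¹ * t := ⟨_, Circle.exp_arg _⟩
    refine ⟨toIcoMod Real.two_pi_pos 0 s, by simpa using toIcoMod_mem_Ico Real.two_pi_pos 0 s, ?_⟩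
    have : Circle.exp (toIcoMod Real.two_pi_pos 0 s) = Circle.exp s :=
      Circle.exp_eq_exp.2 ⟨-toIcoDiv Real.two_pi_pos 0 s, by
        rw [toIcoMod]; push_cast; rw [zsmul_eq_mul]; ring⟩
    rw [this, hs, mul_inv_cancel_left]
  obtain ⟨s₀, hs₀, e₀⟩ := hparam t₀
  obtain ⟨s₂, hs₂, e₂⟩ := hparam t₂
  have hs₂0 : 0 < s₂ := lt_of_le_of_ne hs₂.1 fun h => ht (by rw [← e₂, ← h]; simp)
  have hγ0 : γ 0 ∈ Pi := by
    simp only [γ, Circle.exp_zero, mul_one]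
    exact hk t₁
  have hγ2 : γ (2 * Real.pi) ∈ Pi := by
    simp only [γ, Circle.exp_two_pi, mul_one]
    exact hk t₁
  have hγs : γ s₀ ∉ Pi := by simpa [γ, e₀] using ht₀
  have hγs2 : γ s₂ ∈ Pi := by
    simp only [γ, e₂, hPi, htk]
    exact hk t₂
  have hcl : IsClosed (γ ⁻¹' Pi) := (isClosed_piece _).preimage hγ
  -- The interval from `l` to `r` is the maximal excursion around `s₀`. The tree structure makes its
  -- endpoints equal in the plane, so by injectivity it is a full turn, yet `t₂` on the way lies in
  -- the polygon.
  obtain ⟨l, hl, hlmax⟩ := (isCompact_Icc.inter_right hcl).exists_isGreatest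
    (⟨0, ⟨le_refl 0, hs₀.1⟩, hγ0⟩ : (Icc 0 s₀ ∩ γ ⁻¹' Pi).Nonempty)
  obtain ⟨r, hr, hrmin⟩ := (isCompact_Icc.inter_right hcl).exists_isLeast
    (⟨2 * Real.pi, ⟨hs₀.2.le, le_refl _⟩, hγ2⟩ : (Icc s₀ (2 * Real.pi) ∩ γ ⁻¹' Pi).Nonempty)
  have hls : l < s₀ := lt_of_le_of_ne hl.1.2 fun h => hγs (h ▸ hl.2)
  have hrs : s₀ < r := lt_of_le_of_ne hr.1.1 fun h => hγs (h ▸ hr.2)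
  set W := ⋃ j : {j // j ≠ k t₁}, S.map j '' P.carrier with hW
  have hWc : IsClosed W := isClosed_iUnion_of_finite fun k => isClosed_piece _
  have hsubW : γ '' Icc l r ⊆ W := by
    rw [image_subset_iff, ← closure_Ioo (hls.trans hrs).ne]
    refine closure_minimal (fun s hs => ?_) (hWc.preimage hγ)
    have hsP : γ s ∉ Pi := fun h => by
      rcases le_total s s₀ with hle | hle
      · exact absurd (hlmax ⟨⟨hl.1.1.trans hs.1.le, hle⟩, h⟩) (not_le.2 hs.1)
      · exact absurd (hrmin ⟨⟨hle, hs.2.le.trans hr.1.2⟩, h⟩) (not_le.2 hs.2)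
    obtain ⟨j, hj⟩ := mem_iUnion.1 (hsub (t₁ * Circle.exp s))
    exact mem_iUnion.2 ⟨⟨j, fun h => hsP (by rw [hPi, ← h]; exact hj)⟩, hj⟩
  have hlr := hS.eq_of_isPreconnected (isPreconnected_Icc.image _ hγ.continuousOn) hsubW
    ⟨l, ⟨le_refl _, (hls.trans hrs).le⟩, rfl⟩ ⟨r, ⟨(hls.trans hrs).le, le_refl _⟩, rfl⟩ hl.2 hr.2
  have hexp : Circle.exp l = Circle.exp r := mul_left_cancel (hinj hlr)
  obtain ⟨z, hz⟩ := Circle.exp_eq_exp.1 hexp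
  have hpi := Real.pi_pos
  have hz1 : z = -1 := by
    have h1 : (z : ℝ) < 0 := by
      by_contra! h
      nlinarith [hl.1.1, hr.1.2]
    have h2 : (-2 : ℝ) < z := by
      by_contra! h
      nlinarith [hl.1.1, hr.1.2]
    have h1' : z < 0 := by exact_mod_cast h1
    have h2' : -2 < z := by exact_mod_cast h2
    omega
  rw [hz1] at hz
  push_cast at hz
  have hl0 : l = 0 := by linarith [hl.1.1, hr.1.2]
  have hr0 : r = 2 * Real.pi := by linarith [hl.1.1, hr.1.2]
  rcases le_total s₂ s₀ with hle | hle
  · have := hlmax ⟨⟨hs₂.1, hle⟩, hγs2⟩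
    linarith
  · have := hrmin ⟨⟨hle, hs₂.2.le⟩, hγs2⟩
    linarith [hs₂.2]

end IsGeneralizedPolygonal

/-! ### The attractor of a contractible system is a dendrite -/

namespace IsContractiblePolygonal

variable (hS : S.IsContractiblePolygonal P)
include hS

theorem attractor_subset_carrier : S.attractor ⊆ P.carrier :=
  S.subset_of_invariant S.isAttractor_attractor.eq_iUnion.subset
    S.isAttractor_attractor.isCompact.isBounded hS.image_subset P.isClosed_carrier
    P.carrier_nonempty

theorem isSeparatedBy : S.IsSeparatedBy P.vertexSet where
  subset_attractor := hS.vertexSet_subset_attractor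
  subset_iUnion := hS.vertexSet_subset
  inter_subset := fun i j hij => by
    rw [← hS.inter_eq i j hij]
    exact inter_subset_inter (image_mono hS.attractor_subset_carrier)
      (image_mono hS.attractor_subset_carrier)

/-- Any two points are joined inside the attractor by chains with steps at most `q ^ N * (2 * D)`:
chains of the previous level are shrunk into the pieces and linked at shared vertices. A compact set
with arbitrarily fine chains is connected. -/
theorem isConnected_attractor : IsConnected S.attractor := by
  refine ⟨S.isAttractor_attractor.nonempty, ?_⟩
  obtain ⟨q, hq0, hq1, hq⟩ := S.exists_ratio
  obtain ⟨D, hD⟩ := S.isAttractor_attractor.isCompact.isBounded.exists_norm_le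
  let r : ℕ → ℂ → ℂ → Prop := fun N a b => a ∈ S.attractor ∧ b ∈ S.attractor ∧
    dist a b ≤ q ^ N * (2 * D)
  have hlift : ∀ N i a b, Relation.ReflTransGen (r N) a b →
      Relation.ReflTransGen (r (N + 1)) (S.map i a) (S.map i b) := fun N i a b hab => by
    refine hab.lift (S.map i) fun a b h => ⟨S.map_mem_attractor i h.1, S.map_mem_attractor i h.2.1, ?_⟩
    rw [dist_eq_norm, map_sub, norm_mul, pow_succ', mul_assoc, ← dist_eq_norm]
    exact mul_le_mul (hq i) h.2.2 dist_nonneg hq0.le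
  have key : ∀ N, ∀ x ∈ S.attractor, ∀ y ∈ S.attractor, Relation.ReflTransGen (r N) x y := by
    intro N
    induction N with
    | zero =>
      intro x hx y hy
      refine .single ⟨hx, hy, ?_⟩
      rw [dist_eq_norm]
      linarith [norm_sub_le x y, hD x hx, hD y hy]
    | succ N ih =>
      intro x hx y hy
      obtain ⟨i, x', hx', rfl⟩ := S.exists_map_eq hx
      obtain ⟨j, y', hy', rfl⟩ := S.exists_map_eq hy
      have hij := hS.reflTransGen_piece i j
      clear hy
      induction hij generalizing y' with
      | refl => exact hlift N i _ _ (ih x' hx' y' hy')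
      | tail _ hkl ih' =>
        obtain ⟨z, ⟨a, ha, rfl⟩, ⟨b, hb, hab⟩⟩ := hkl
        have h1 := ih' a (hS.vertexSet_subset_attractor ha)
        rw [← hab] at h1
        exact h1.trans (hlift N _ _ _ (ih b (hS.vertexSet_subset_attractor hb) y' hy'))
  rw [isPreconnected_closed_iff]
  rintro U W hU hW hcov ⟨x, hx, hxU⟩ ⟨y, hy, hyW⟩
  by_contra hne
  rw [not_nonempty_iff_eq_empty, eq_empty_iff_forall_notMem] at hne
  obtain ⟨d, hd, hdist⟩ := exists_pos_forall_le_dist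
    (S.isAttractor_attractor.isCompact.inter_right hU)
    (S.isAttractor_attractor.isCompact.isClosed.inter hW)
    (disjoint_left.2 fun z hz hz' => hne z ⟨hz.1, hz.2, hz'.2⟩)
  have hD0 : 0 ≤ D := (norm_nonneg x).trans (hD x hx)
  obtain ⟨N, hN⟩ := exists_pow_lt_of_lt_one (show 0 < d / (2 * D + 1) by positivity) hq1
  have hN' : q ^ N * (2 * D) < d := by
    rw [lt_div_iff₀ (by positivity)] at hN
    nlinarith [pow_pos hq0 N]
  have hstay : ∀ z, Relation.ReflTransGen (r N) x z → z ∈ U := by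
    intro z hz
    induction hz with
    | refl => exact hxU
    | tail _ hbc ih =>
      rcases hcov hbc.2.1 with h | h
      · exact h
      · exact absurd hbc.2.2 (not_le.2 (hN'.trans_le (hdist _ ⟨hbc.1, ih⟩ _ ⟨hbc.2.1, h⟩)))
  exact hne y ⟨hy, hstay y (key N x hx y hy), hyW⟩

/-- The pieces of level `N` that contain `x` form a connected neighbourhood of `x` of small
diameter. -/
theorem locallyConnectedSpace_attractor : LocallyConnectedSpace S.attractor := by
  rw [locallyConnectedSpace_iff_connected_subsets]
  intro x U hU
  obtain ⟨ε, hε, hεU⟩ := Metric.mem_nhds_iff.1 hU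
  obtain ⟨q, hq0, hq1, hq⟩ := S.exists_ratio
  obtain ⟨D, hD⟩ := S.isAttractor_attractor.isCompact.isBounded.exists_norm_le
  have hD0 : 0 ≤ D := (norm_nonneg _).trans (hD x x.2)
  obtain ⟨N, hN⟩ := exists_pow_lt_of_lt_one (show 0 < ε / (2 * D + 1) by positivity) hq1
  have hN' : q ^ N * (2 * D) < ε := by
    rw [lt_div_iff₀ (by positivity)] at hN
    nlinarith [pow_pos hq0 N]
  let T : List (Fin m) → Set S.attractor := fun w => Subtype.val ⁻¹' (S.wordMap w '' S.attractor)
  have hfin : Finite {w : List (Fin m) // w.length = N} :=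
    (List.finite_length_eq (Fin m) N).to_subtype
  have hTc : ∀ w, IsClosed (T w) := fun w =>
    (S.isAttractor_attractor.isCompact.image (S.continuous_wordMap w)).isClosed.preimage
      continuous_subtype_val
  refine ⟨⋃ w : {w : {w : List (Fin m) // w.length = N} // x ∈ T w}, T w.1, ?_, ?_, ?_⟩
  · have hcl : IsClosed (⋃ w : {w : {w : List (Fin m) // w.length = N} // x ∉ T w}, T w.1) :=
      isClosed_iUnion_of_finite fun w => hTc _
    refine Filter.mem_of_superset (hcl.isOpen_compl.mem_nhds ?_) ?_
    · intro h
      obtain ⟨w, hw⟩ := mem_iUnion.1 h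
      exact w.2 hw
    · intro y hy
      obtain ⟨w, hw, z, hz, hzy⟩ := S.exists_wordMap_eq S.isAttractor_attractor.eq_iUnion.subset N y.2
      have hyw : y ∈ T w := ⟨z, hz, hzy⟩
      by_cases hxw : x ∈ T w
      · exact mem_iUnion.2 ⟨⟨⟨w, hw⟩, hxw⟩, hyw⟩
      · exact absurd (mem_iUnion.2 ⟨⟨⟨w, hw⟩, hxw⟩, hyw⟩) hy
  · refine isPreconnected_iUnion ⟨x, mem_iInter.2 fun w => w.2⟩ fun w => ?_
    rw [← IsInducing.subtypeVal.isPreconnected_image, Subtype.image_preimage_coe,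
      inter_eq_right.2]
    · exact hS.isConnected_attractor.isPreconnected.image _ (S.continuous_wordMap _).continuousOn
    · rintro _ ⟨z, hz, rfl⟩
      exact S.wordMap_mem_attractor _ hz
  · intro y hy
    obtain ⟨⟨⟨w, hw⟩, hxw⟩, hyw⟩ := mem_iUnion.1 hy
    refine hεU ?_
    obtain ⟨a, ha, hax⟩ := hxw
    obtain ⟨b, hb, hby⟩ := hyw
    rw [Metric.mem_ball, Subtype.dist_eq, ← hax, ← hby, dist_eq_norm, wordMap_sub, norm_mul]
    have h1 := S.norm_wordMult_le hq w
    rw [hw] at h1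
    refine lt_of_le_of_lt (mul_le_mul h1 ?_ (norm_nonneg _) (by positivity)) hN'
    linarith [norm_sub_le b a, hD a ha, hD b hb]

/-- A simple closed curve in `K` lies in one piece, and the inverse of the corresponding similarity
magnifies it to another simple closed curve in `K`. Iteration contradicts the boundedness of `K`. -/
theorem not_exists_simple_closed_curve :
    ¬ ∃ c : Circle → ℂ, Continuous c ∧ Function.Injective c ∧ ∀ t, c t ∈ S.attractor := by
  rintro ⟨c, hc, hinj, hcK⟩
  obtain ⟨q, hq0, hq1, hq⟩ := S.exists_ratio
  obtain ⟨D, hD⟩ := S.isAttractor_attractor.isCompact.isBounded.exists_norm_le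
  have key : ∀ N : ℕ, ∃ c' : Circle → ℂ, Continuous c' ∧ Function.Injective c' ∧
      (∀ t, c' t ∈ S.attractor) ∧ ‖c 1 - c (-1)‖ ≤ q ^ N * ‖c' 1 - c' (-1)‖ := by
    intro N
    induction N with
    | zero => exact ⟨c, hc, hinj, hcK, by simp⟩
    | succ N ih =>
      obtain ⟨c', hc', hinj', hcK', hle⟩ := ih
      have hKQ : S.attractor ⊆ ⋃ i, S.map i '' P.carrier := by
        rw [S.isAttractor_attractor.eq_iUnion]
        exact iUnion_mono fun i => image_mono hS.attractor_subset_carrier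
      obtain ⟨i, hi⟩ := hS.exists_forall_mem_piece hc' hinj' fun t => hKQ (hcK' t)
      -- A point of the curve that comes from another piece `k` lies in `P_k ∩ P_i`, so it is the
      -- image under `S_i` of a vertex, and vertices belong to `K`.
      have hmem : ∀ t, ∃ z ∈ S.attractor, S.map i z = c' t := fun t => by
        obtain ⟨k, z, hz, hk⟩ := S.exists_map_eq (hcK' t)
        by_cases hki : k = i
        · exact ⟨z, hz, hki ▸ hk⟩
        · have : c' t ∈ S.map k '' P.carrier ∩ S.map i '' P.carrier :=
            ⟨⟨z, hS.attractor_subset_carrier hz, hk⟩, hi t⟩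
          rw [hS.inter_eq k i hki] at this
          obtain ⟨-, b, hb, hb'⟩ := this
          exact ⟨b, hS.vertexSet_subset_attractor hb, hb'⟩
      have hmult := (S.map i).mult_ne_zero
      let c'' : Circle → ℂ := fun t => (c' t - (S.map i).center) / (S.map i).mult + (S.map i).center
      have hc'' : ∀ t, S.map i (c'' t) = c' t := fun t => by
        simp only [c'', add_sub_cancel_right]
        rw [mul_div_cancel₀ _ hmult]; ring
      refine ⟨c'', by fun_prop, fun s t h => hinj' (by rw [← hc'' s, ← hc'' t, h]), fun t => ?_, ?_⟩
      · obtain ⟨z, hz, hzt⟩ := hmem t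
        rwa [S.map_injective i ((hc'' t).trans hzt.symm)]
      · refine hle.trans ?_
        rw [← hc'' 1, ← hc'' (-1), map_sub, norm_mul, pow_succ, mul_assoc]
        gcongr
        exact hq i
  have h0 : ‖c 1 - c (-1)‖ = 0 := by
    refine eq_zero_of_forall_le hq0 hq1 (norm_nonneg _) (D := 2 * D) fun N => ?_
    obtain ⟨c', -, -, hcK', hle⟩ := key N
    refine hle.trans ?_
    gcongr
    linarith [norm_sub_le (c' 1) (c' (-1)), hD _ (hcK' 1), hD _ (hcK' (-1))]
  have := hinj (sub_eq_zero.1 (norm_eq_zero.1 h0))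
  have h2 := congrArg (fun t : Circle => (t : ℂ)) this
  norm_num at h2

theorem isDendrite_attractor : IsDendrite S.attractor where
  isCompact := S.isAttractor_attractor.isCompact
  isConnected := hS.isConnected_attractor
  locallyConnected := hS.locallyConnectedSpace_attractor
  no_simple_closed_curve := hS.not_exists_simple_closed_curve

end IsContractiblePolygonal

end SimilaritySystem

theorem IsDendrite.of_homeomorph {K L : Set ℂ} (hK : IsDendrite K) (e : K ≃ₜ L) :
    IsDendrite L where
  isCompact := by
    have := isCompact_iff_compactSpace.1 hK.isCompact
    exact isCompact_iff_compactSpace.2 e.compactSpace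
  isConnected := by
    have := isConnected_iff_connectedSpace.1 hK.isConnected
    exact isConnected_iff_connectedSpace.2 (e.surjective.connectedSpace e.continuous)
  locallyConnected := by
    have := hK.locallyConnected
    exact e.symm.locallyConnectedSpace
  no_simple_closed_curve := by
    rintro ⟨c, hc, hinj, hcL⟩
    refine hK.no_simple_closed_curve ⟨fun t => e.symm ⟨c t, hcL t⟩, by fun_prop, ?_, fun t => (e.symm _).2⟩
    intro s t h
    have := e.symm.injective (Subtype.ext h)
    exact hinj (congrArg Subtype.val this)

/-! ### The argument of `z - A` on a polygon without the boundary point `A`. -/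

theorem eqOn_of_exp_mul_I_eq {X : Type*} [TopologicalSpace X] {s : Set X} (hs : IsPreconnected s)
    {θ : X → ℝ} (hθ : ContinuousOn θ s) (h : ∀ x ∈ s, ∀ y ∈ s,
      Complex.exp (θ x * Complex.I) = Complex.exp (θ y * Complex.I)) {x y : X} (hx : x ∈ s)
    (hy : y ∈ s) : θ x = θ y := by
  have := isPreconnected_iff_preconnectedSpace.1 hs
  exact eq_of_exp_mul_I_eq (X := s) (θ := fun z => θ z) hθ.domRestrict
    (fun a b => h a a.2 b b.2) ⟨x, hx⟩ ⟨y, hy⟩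

/-- `Θ` is a continuous argument of `z - A` on the set `s`. -/
structure IsArgumentOn (Θ : ℂ → ℝ) (A : ℂ) (s : Set ℂ) : Prop where
  continuousOn : ContinuousOn Θ s
  eq : ∀ z ∈ s, z - A = ‖z - A‖ * Complex.exp (Θ z * Complex.I)

theorem exp_eq_div_norm {z : ℂ} (hz : z ≠ 0) {θ : ℝ} (h : z = ‖z‖ * Complex.exp (θ * Complex.I)) :
    Complex.exp (θ * Complex.I) = z / ‖z‖ := by
  rw [eq_div_iff (by simpa using hz), mul_comm]
  exact h.symm

theorem IsArgumentOn.exp_eq {Θ : ℂ → ℝ} {A : ℂ} {s : Set ℂ} (h : IsArgumentOn Θ A s) {z : ℂ}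
    (hz : z ∈ s) (hzA : z ≠ A) : Complex.exp (Θ z * Complex.I) = (z - A) / ‖z - A‖ :=
  exp_eq_div_norm (sub_ne_zero.2 hzA) (h.eq z hz)

theorem div_norm_real_mul {t : ℝ} (ht : 0 < t) (z : ℂ) : (t * z) / ‖(t * z : ℂ)‖ = z / ‖z‖ := by
  rw [norm_mul, Complex.norm_real, Real.norm_of_nonneg ht.le]
  push_cast
  rw [mul_div_mul_left]
  exact_mod_cast ht.ne'

namespace DiskPolygon

variable {n : ℕ} (P : DiskPolygon n)

theorem exists_isArgumentOn {A : ℂ} (hA : A ∈ frontier P.carrier) :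
    ∃ Θ, IsArgumentOn Θ A (P.carrier \ {A}) := by
  classical
  have := P.contractibleSpace_diff hA
  obtain ⟨θ, hθ⟩ := exists_argument_of_contractible (fun z : ↥(P.carrier \ {A}) => (z : ℂ) - A)
    (by fun_prop) (fun z => sub_ne_zero.2 z.2.2)
  refine ⟨fun z => if h : z ∈ P.carrier \ {A} then θ ⟨z, h⟩ else 0, ?_, fun z hz => ?_⟩
  · rw [continuousOn_iff_continuous_domRestrict]
    convert θ.continuous using 1
    funext z
    exact dif_pos z.2
  · rw [dif_pos hz]
    exact hθ ⟨z, hz⟩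

theorem exists_vertex_ne (A : ℂ) : ∃ B ∈ P.vertexSet, B ≠ A := by
  by_cases h : P.vertices P.zeroIndex = A
  · exact ⟨_, ⟨finRotate n P.zeroIndex, rfl⟩, h ▸ P.vertices_finRotate_ne _⟩
  · exact ⟨_, ⟨_, rfl⟩, h⟩

theorem isPreconnected_diff {A : ℂ} (hA : A ∈ frontier P.carrier) :
    IsPreconnected (P.carrier \ {A}) := by
  have := P.contractibleSpace_diff hA
  exact isPreconnected_iff_preconnectedSpace.2 inferInstance

/-- Near `A` the region is a cone and the argument is constant along rays, so every value is
attained outside a small ball around `A`, where compactness applies. -/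
theorem exists_bound_isArgumentOn {A : ℂ} {Θ : ℂ → ℝ} (hΘ : IsArgumentOn Θ A (P.carrier \ {A})) :
    ∃ M, ∀ z ∈ P.carrier \ {A}, |Θ z| ≤ M := by
  obtain ⟨ρ, hρ, hrad⟩ := P.exists_radial A
  have hsub : P.carrier \ Metric.ball A (ρ / 2) ⊆ P.carrier \ {A} := fun z hz =>
    ⟨hz.1, fun h => hz.2 (by rw [mem_singleton_iff.1 h]; exact Metric.mem_ball_self (by positivity))⟩
  obtain ⟨M, hM⟩ := (P.isCompact_carrier.diff Metric.isOpen_ball).exists_bound_of_continuousOn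
    (hΘ.continuousOn.mono hsub)
  refine ⟨M, fun z hz => ?_⟩
  by_cases hzb : z ∈ Metric.ball A (ρ / 2)
  swap
  · exact hM z ⟨hz.1, hzb⟩
  have hzA : 0 < ‖z - A‖ := norm_pos_iff.2 (sub_ne_zero.2 hz.2)
  rw [Metric.mem_ball, dist_eq_norm] at hzb
  set s := ρ / 2 / ‖z - A‖ with hs
  have hs1 : 1 < s := (one_lt_div hzA).2 hzb
  have hdist : ∀ t : ℝ, 0 < t → dist (A + t * (z - A)) A = t * ‖z - A‖ := fun t ht => by
    rw [dist_eq_norm, add_sub_cancel_left, norm_mul, Complex.norm_real, Real.norm_of_nonneg ht.le]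
  have hsz : s * ‖z - A‖ = ρ / 2 := div_mul_cancel₀ _ hzA.ne'
  have hmem : ∀ t ∈ Icc 1 s, A + (t : ℂ) * (z - A) ∈ P.carrier \ {A} := by
    intro t ht
    have ht0 : 0 < t := one_pos.trans_le ht.1
    refine ⟨hrad z hz.1 (by rw [dist_eq_norm]; linarith) t ht0 ?_, fun h => ?_⟩
    · rw [hdist t ht0]
      nlinarith [ht.2]
    · have h1 := hdist t ht0
      rw [mem_singleton_iff.1 h, dist_self] at h1
      nlinarith
  have h1 := eqOn_of_exp_mul_I_eq (isPreconnected_Icc (a := (1 : ℝ)) (b := s))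
    (θ := fun t : ℝ => Θ (A + t * (z - A)))
    (hΘ.continuousOn.comp (by fun_prop) hmem) (fun t ht t' ht' => by
      rw [hΘ.exp_eq (hmem t ht) (hmem t ht).2, hΘ.exp_eq (hmem t' ht') (hmem t' ht').2,
        add_sub_cancel_left, add_sub_cancel_left, div_norm_real_mul (one_pos.trans_le ht.1),
        div_norm_real_mul (one_pos.trans_le ht'.1)])
    ⟨le_refl 1, hs1.le⟩ ⟨hs1.le, le_refl s⟩
  simp only [Complex.ofReal_one, one_mul, add_sub_cancel] at h1
  rw [h1]
  refine hM _ ⟨(hmem s ⟨hs1.le, le_refl s⟩).1, fun hb => ?_⟩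
  rw [Metric.mem_ball, hdist s (by linarith)] at hb
  linarith

end DiskPolygon

/-! ### The angular gap between two cones with a common apex. -/

/-- Near `B` the set `X` is invariant under homotheties with center `B`. -/
def IsRadialAt (X : Set ℂ) (B : ℂ) : Prop := ∃ ρ > 0, ∀ y ∈ X, dist y B < ρ →
    ∀ t : ℝ, 0 < t → dist (B + t * (y - B)) B < ρ → B + t * (y - B) ∈ X

/-- Radial projection to a small circle around `B` lands in two disjoint compact sets, which have a
positive distance. -/
theorem IsRadialAt.exists_direction_gap {X Y : Set ℂ} {B : ℂ} (hX : IsRadialAt X B)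
    (hY : IsRadialAt Y B) (hXc : IsCompact X) (hYc : IsCompact Y)
    (hXY : ∀ z ∈ X, z ∈ Y → z = B) :
    ∃ ρ > 0, ∃ η > 0, ∀ x ∈ X, ∀ y ∈ Y, x ≠ B → y ≠ B → dist x B < ρ → dist y B < ρ →
      η ≤ ‖(x - B) / ‖x - B‖ - (y - B) / ‖y - B‖‖ := by
  obtain ⟨ρ₁, hρ₁, h₁⟩ := hX
  obtain ⟨ρ₂, hρ₂, h₂⟩ := hY
  set ρ := min ρ₁ ρ₂ with hρdef
  have hρ : 0 < ρ := lt_min hρ₁ hρ₂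
  obtain ⟨r, hr, hdist⟩ := exists_pos_forall_le_dist
    (hXc.inter_right (Metric.isClosed_sphere (x := B) (ε := ρ / 2)))
    (hYc.isClosed.inter (Metric.isClosed_sphere (x := B) (ε := ρ / 2))) (by
      rw [disjoint_left]
      rintro z ⟨hzX, hz⟩ ⟨hzY, -⟩
      rw [hXY z hzX hzY, Metric.mem_sphere, dist_self] at hz
      linarith)
  have hproj : ∀ z : ℂ, z ≠ B → dist (B + ((ρ / 2 / ‖z - B‖ : ℝ) : ℂ) * (z - B)) B = ρ / 2 := by
    intro z hz
    have : 0 < ‖z - B‖ := norm_pos_iff.2 (sub_ne_zero.2 hz)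
    rw [dist_eq_norm, add_sub_cancel_left, norm_mul, Complex.norm_real,
      Real.norm_of_nonneg (by positivity), div_mul_cancel₀ _ this.ne']
  refine ⟨ρ, hρ, r / (ρ / 2), by positivity, fun x hx y hy hxB hyB hxρ hyρ => ?_⟩
  have hx0 : 0 < ‖x - B‖ := norm_pos_iff.2 (sub_ne_zero.2 hxB)
  have hy0 : 0 < ‖y - B‖ := norm_pos_iff.2 (sub_ne_zero.2 hyB)
  have h3 := hdist _ ⟨h₁ x hx (hxρ.trans_le (min_le_left _ _)) (ρ / 2 / ‖x - B‖) (by positivity)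
    (by rw [hproj x hxB]; linarith [min_le_left ρ₁ ρ₂]), hproj x hxB⟩
    _ ⟨h₂ y hy (hyρ.trans_le (min_le_right _ _)) (ρ / 2 / ‖y - B‖) (by positivity)
    (by rw [hproj y hyB]; linarith [min_le_right ρ₁ ρ₂]), hproj y hyB⟩
  rw [dist_eq_norm] at h3
  have e : B + ((ρ / 2 / ‖x - B‖ : ℝ) : ℂ) * (x - B) - (B + ((ρ / 2 / ‖y - B‖ : ℝ) : ℂ) * (y - B))
      = ((ρ / 2 : ℝ) : ℂ) * ((x - B) / ‖x - B‖ - (y - B) / ‖y - B‖) := by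
    push_cast; ring
  rw [e, norm_mul, Complex.norm_real, Real.norm_of_nonneg (by positivity)] at h3
  rw [div_le_iff₀ (by positivity), mul_comm]
  exact h3

namespace SimilaritySystem

variable {m n : ℕ} {S : SimilaritySystem m} {P : DiskPolygon n}

theorem isRadialAt_piece (i : Fin m) (B : ℂ) : IsRadialAt (S.map i '' P.carrier) B := by
  have hm := (S.map i).mult_ne_zero
  obtain ⟨b, hb⟩ : ∃ b, S.map i b = B :=
    ⟨(B - (S.map i).center) / (S.map i).mult + (S.map i).center, by field_simp; ring⟩
  obtain ⟨ρ, hρ, h⟩ := P.exists_radial b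
  have hm' : 0 < ‖(S.map i).mult‖ := norm_pos_iff.2 hm
  have e : ∀ z (t : ℝ), B + t * (S.map i z - B) = S.map i (b + t * (z - b)) := fun z t => by
    rw [← hb]; ring
  have hd : ∀ z, dist (S.map i z) B = ‖(S.map i).mult‖ * dist z b := fun z => by
    rw [← hb, dist_eq_norm, map_sub, norm_mul, dist_eq_norm]
  refine ⟨‖(S.map i).mult‖ * ρ, by positivity, ?_⟩
  rintro _ ⟨z, hz, rfl⟩ hzd t ht htd
  rw [hd] at hzd
  rw [e, hd] at htd
  rw [e]
  exact ⟨_, h z hz (lt_of_mul_lt_mul_left hzd hm'.le) t ht (lt_of_mul_lt_mul_left htd hm'.le), rfl⟩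

/-! ### Cyclic vertices of a contractible system. -/

theorem IsContractiblePolygonal.mem_vertexSet_of_wordMap (hS : S.IsContractiblePolygonal P)
    {w : List (Fin m)} {z A : ℂ} (hA : A ∈ P.vertexSet) (hz : z ∈ P.carrier)
    (e : S.wordMap w z = A) : z ∈ P.vertexSet := by
  induction w generalizing A with
  | nil => rw [← e] at hA; exact hA
  | cons i w ih =>
    exact ih (hS.mem_vertexSet_of_map hA (S.wordMap_mem hS.image_subset w hz) e) rfl

/-- A conjugacy on the vertices is a conjugacy for all words. -/
theorem IsContractiblePolygonal.wordMap_conj (hS : S.IsContractiblePolygonal P)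
    {S' : SimilaritySystem m} {f : ℂ → ℂ}
    (hf : ∀ k, ∀ x ∈ P.vertexSet, f (S.map k x) = S'.map k (f x))
    {w : List (Fin m)} {a A : ℂ} (hA : A ∈ P.vertexSet) (ha : a ∈ P.vertexSet)
    (e : S.wordMap w a = A) : S'.wordMap w (f a) = f A := by
  induction w generalizing A with
  | nil => exact congrArg f e
  | cons i w ih =>
    have h1 := hS.mem_vertexSet_of_map hA
      (S.wordMap_mem hS.image_subset w (P.vertexSet_subset_carrier ha)) e
    rw [wordMap_cons, ih h1 rfl, ← hf i _ h1, ← e, wordMap_cons]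

namespace IsContractiblePolygonal

variable (hS : S.IsContractiblePolygonal P)
include hS

theorem wordMap_mem_diff {A : ℂ} {v : List (Fin m)} (hv : S.wordMap v A = A) {z : ℂ}
    (hz : z ∈ P.carrier \ {A}) : S.wordMap v z ∈ P.carrier \ {A} :=
  ⟨S.wordMap_mem hS.image_subset v hz.1, fun h => hz.2 (S.wordMap_injective v
    ((mem_singleton_iff.1 h).trans hv.symm))⟩

/-- A map `S_v` that fixes a vertex `A` does not rotate about `A`. -/
theorem argument_wordMap {A : ℂ} (hA : A ∈ P.vertexSet) {v : List (Fin m)}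
    (hv : S.wordMap v A = A) {Θ : ℂ → ℝ} (hΘ : IsArgumentOn Θ A (P.carrier \ {A})) {z : ℂ}
    (hz : z ∈ P.carrier \ {A}) : Θ (S.wordMap v z) = Θ z := by
  have hAf := P.vertexSet_subset_frontier hA
  have hsub : ∀ z, S.wordMap v z - A = S.wordMult v * (z - A) := fun z => by
    conv_lhs => rw [← hv]
    rw [wordMap_sub]
  have hexp : ∀ z ∈ P.carrier \ {A},
      Complex.exp (((Θ (S.wordMap v z) - Θ z : ℝ) : ℂ) * Complex.I) =
        S.wordMult v / ‖S.wordMult v‖ := by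
    intro z hz
    have hzA : (‖z - A‖ : ℂ) ≠ 0 := by simpa [sub_eq_zero] using hz.2
    have hzA' : z - A ≠ 0 := sub_ne_zero.2 hz.2
    push_cast
    rw [sub_mul, Complex.exp_sub, hΘ.exp_eq hz hz.2,
      hΘ.exp_eq (hS.wordMap_mem_diff hv hz) (hS.wordMap_mem_diff hv hz).2, hsub, norm_mul]
    push_cast
    field_simp
  have hconst : ∀ y ∈ P.carrier \ {A}, Θ (S.wordMap v y) - Θ y = Θ (S.wordMap v z) - Θ z := by
    intro y hy
    exact eqOn_of_exp_mul_I_eq (P.isPreconnected_diff hAf)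
      (θ := fun y => Θ (S.wordMap v y) - Θ y)
      ((hΘ.continuousOn.comp (S.continuous_wordMap v).continuousOn
        fun y hy => hS.wordMap_mem_diff hv hy).sub hΘ.continuousOn)
      (fun a ha b hb => (hexp a ha).trans (hexp b hb).symm) hy hz
  obtain ⟨M, hM⟩ := P.exists_bound_isArgumentOn hΘ
  set β := Θ (S.wordMap v z) - Θ z with hβ
  have hiter : ∀ t : ℕ, ∃ y ∈ P.carrier \ {A}, Θ y = Θ z + t * β := by
    intro t
    induction t with
    | zero => exact ⟨z, hz, by simp⟩
    | succ t ih =>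
      obtain ⟨y, hy, e⟩ := ih
      refine ⟨_, hS.wordMap_mem_diff hv hy, ?_⟩
      push_cast
      linarith [hconst y hy]
  have hβ0 : β = 0 := by
    by_contra hne
    obtain ⟨t, ht⟩ := exists_nat_gt (2 * M / |β|)
    rw [div_lt_iff₀ (abs_pos.2 hne)] at ht
    obtain ⟨y, hy, e⟩ := hiter t
    have h1 : (t : ℝ) * |β| ≤ |Θ y| + |Θ z| := by
      rw [← Nat.abs_cast t, ← abs_mul, show (t : ℝ) * β = Θ y - Θ z by linarith]
      exact abs_sub _ _
    linarith [hM y hy, hM z hz]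
  linarith

theorem wordMult_eq_norm {A : ℂ} (hA : A ∈ P.vertexSet) {v : List (Fin m)}
    (hv : S.wordMap v A = A) : S.wordMult v = ‖S.wordMult v‖ := by
  obtain ⟨Θ, hΘ⟩ := P.exists_isArgumentOn (P.vertexSet_subset_frontier hA)
  obtain ⟨B, hB, hBA⟩ := P.exists_vertex_ne A
  have hBd : B ∈ P.carrier \ {A} := ⟨P.vertexSet_subset_carrier hB, hBA⟩
  have h1 := hS.argument_wordMap hA hv hΘ hBd
  have hBd' := hS.wordMap_mem_diff hv hBd
  have h2 := hΘ.exp_eq hBd' hBd'.2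
  have h3 := hΘ.exp_eq hBd hBA
  have hsub : S.wordMap v B - A = S.wordMult v * (B - A) := by
    conv_lhs => rw [← hv]
    rw [wordMap_sub]
  rw [h1, h3, hsub, norm_mul] at h2
  have hB0 : B - A ≠ 0 := sub_ne_zero.2 hBA
  have hB1 : (‖B - A‖ : ℂ) ≠ 0 := by simpa using hB0
  have hv1 : (‖S.wordMult v‖ : ℂ) ≠ 0 := by simpa using S.wordMult_ne_zero v
  push_cast at h2
  field_simp at h2
  exact h2.symm

/-- Only one of the polygons `P_k` contains a given cyclic vertex. -/
theorem eq_of_mem_piece {A : ℂ} (hA : A ∈ P.vertexSet) {k l : Fin m} {v : List (Fin m)}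
    (hv : S.wordMap (k :: v) A = A) (hl : A ∈ S.map l '' P.carrier) : l = k := by
  by_contra hlk
  obtain ⟨ρ, hρ, hrad⟩ := P.exists_radial A
  have hr := hS.wordMult_eq_norm hA hv
  set r := ‖S.wordMult (k :: v)‖ with hrdef
  have hr0 : 0 < r := norm_pos_iff.2 (S.wordMult_ne_zero _)
  have hr1 : r < 1 := S.norm_wordMult_lt_one (by simp)
  obtain ⟨a, ha, hla⟩ := hl
  obtain ⟨j, rfl⟩ := hS.mem_vertexSet_of_map hA ha hla
  set b := P.vertices (finRotate n j)
  have hba : 0 < ‖b - P.vertices j‖ := norm_pos_iff.2 (sub_ne_zero.2 (P.vertices_finRotate_ne j))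
  have hml : 0 < ‖(S.map l).mult‖ := norm_pos_iff.2 (S.map l).mult_ne_zero
  -- The word `k :: v` acts as the homothety with center `A` and ratio `r`. A point `z` of `P_l`
  -- closer to `A` than `r * ρ` is its value at a point of `P`, hence lies in `P_k` too; a second
  -- common point besides `A` contradicts (D2). The bound on `t` places `z` that close.
  obtain ⟨t, ht0, ht⟩ : ∃ t : ℝ, 0 < t ∧ t < min 1 (r * ρ / (‖(S.map l).mult‖ * ‖b - P.vertices j‖)) :=
    exists_between (lt_min one_pos (by positivity))
  have ht1 := ht.trans_le (min_le_left _ _)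
  have ht2 := ht.trans_le (min_le_right _ _)
  rw [lt_div_iff₀ (by positivity)] at ht2
  have hy : P.vertices j + t * (b - P.vertices j) ∈ P.carrier := by
    apply P.segment_subset_carrier j
    rw [segment_eq_image']
    exact ⟨t, ⟨ht0.le, ht1.le⟩, by simp [b]⟩
  set z := S.map l (P.vertices j + t * (b - P.vertices j)) with hz
  have hzA : z - A = (S.map l).mult * (t * (b - P.vertices j)) := by
    rw [hz, ← hla, map_sub]; ring
  have hznorm : ‖z - A‖ = t * (‖(S.map l).mult‖ * ‖b - P.vertices j‖) := by
    rw [hzA, norm_mul, norm_mul, Complex.norm_real, Real.norm_of_nonneg ht0.le]; ring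
  have hzlt : ‖z - A‖ < r * ρ := by rw [hznorm]; exact ht2
  have hzC : z ∈ P.carrier := hS.image_subset l ⟨_, hy, rfl⟩
  have hx := hrad z hzC (by rw [dist_eq_norm]; nlinarith) (1 / r) (by positivity) (by
    rw [dist_eq_norm, add_sub_cancel_left, norm_mul, Complex.norm_real,
      Real.norm_of_nonneg (by positivity), div_mul_eq_mul_div, one_mul, div_lt_iff₀ hr0]
    linarith)
  have hzk : z ∈ S.map k '' P.carrier := by
    refine ⟨_, S.wordMap_mem hS.image_subset v hx, ?_⟩
    have h1 := S.wordMap_sub (k :: v) (A + ((1 / r : ℝ) : ℂ) * (z - A)) A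
    rw [hv, hr, wordMap_cons, add_sub_cancel_left] at h1
    have hr' : (r : ℂ) ≠ 0 := by exact_mod_cast hr0.ne'
    push_cast at h1 ⊢
    rw [← mul_assoc, mul_one_div_cancel hr', one_mul] at h1
    exact sub_left_injective h1
  have := hS.inter_subsingleton hlk ⟨_, hy, rfl⟩ hzk ⟨_, P.vertexSet_subset_carrier ⟨j, rfl⟩, hla⟩
    ⟨_, S.wordMap_mem hS.image_subset v (P.vertexSet_subset_carrier hA), hv⟩
  have h0 : ‖z - A‖ = 0 := by rw [sub_eq_zero.2 this, norm_zero]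
  rw [hznorm] at h0
  exact absurd h0 (by positivity)

/-- The first letter of the fixing word must be `i`, and moving it to the end gives a word that
fixes `z`. -/
theorem isCyclicVertex_of_map {A z : ℂ} {i : Fin m} (hA : S.IsCyclicVertex P A)
    (hz : z ∈ P.carrier) (e : S.map i z = A) : S.IsCyclicVertex P z := by
  obtain ⟨hAV, w, hw, hwA⟩ := hA
  obtain ⟨k, w, rfl⟩ := List.exists_cons_of_ne_nil hw
  have hik := hS.eq_of_mem_piece hAV hwA ⟨z, hz, e⟩
  subst hik
  have hzw : S.wordMap w A = z := S.map_injective i (hwA.trans e.symm)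
  refine ⟨hS.mem_vertexSet_of_map hAV hz e, w ++ [i], by simp, ?_⟩
  rw [wordMap_append, wordMap_cons, wordMap_nil, id_eq, e, hzw]

theorem eq_of_mem_pieces {A : ℂ} (hA : S.IsCyclicVertex P A) {k l : Fin m}
    (hk : A ∈ S.map k '' P.carrier) (hl : A ∈ S.map l '' P.carrier) : k = l := by
  obtain ⟨hAV, w, hw, hwA⟩ := hA
  obtain ⟨i, w, rfl⟩ := List.exists_cons_of_ne_nil hw
  rw [hS.eq_of_mem_piece hAV hwA hk, hS.eq_of_mem_piece hAV hwA hl]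

/-- A cyclic vertex lies in only one polygon `P_k`, and its preimage there is cyclic again, so the
letters are forced one by one. -/
theorem exists_eq_append {A : ℂ} (hA : S.IsCyclicVertex P A) {v s : List (Fin m)} {a b : ℂ}
    (ha : a ∈ P.carrier) (hb : b ∈ P.carrier) (hv : S.wordMap v a = A) (hs : S.wordMap s b = A)
    (hlen : v.length ≤ s.length) : ∃ s', s = v ++ s' := by
  induction v generalizing A s with
  | nil => exact ⟨s, rfl⟩
  | cons i v ih =>
    cases s with
    | nil => simp at hlen
    | cons j s =>
      have hvC := S.wordMap_mem hS.image_subset v ha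
      have hsC := S.wordMap_mem hS.image_subset s hb
      have hij := hS.eq_of_mem_pieces hA ⟨_, hvC, hv⟩ ⟨_, hsC, hs⟩
      subst hij
      obtain ⟨s', rfl⟩ := ih (hS.isCyclicVertex_of_map hA hvC hv) rfl
        (S.map_injective i (hs.trans hv.symm)) (by simpa using hlen)
      exact ⟨s', rfl⟩

end IsContractiblePolygonal

/-! ### Chains of edges in the level sets -/

/-- `x` and `y` are the endpoints of a side of a polygon `P_u`, `|u| = k`, and differ from `A`. -/
def EdgeStep (S : SimilaritySystem m) (P : DiskPolygon n) (k : ℕ) (A x y : ℂ) : Prop :=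
  ∃ u : List (Fin m), u.length = k ∧ ∃ i j : Fin n, (j = finRotate n i ∨ i = finRotate n j) ∧
    x = S.wordMap u (P.vertices i) ∧ y = S.wordMap u (P.vertices j) ∧ x ≠ A ∧ y ≠ A

theorem EdgeStep.map {k : ℕ} {A x y : ℂ} (h : S.EdgeStep P k A x y) (i : Fin m) :
    S.EdgeStep P (k + 1) (S.map i A) (S.map i x) (S.map i y) := by
  obtain ⟨u, hu, a, b, hab, rfl, rfl, hx, hy⟩ := h
  exact ⟨i :: u, by simp [hu], a, b, hab, rfl, rfl, (S.map_injective i).ne hx,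
    (S.map_injective i).ne hy⟩

/-- Within each `P_l` the chains come from the previous level with `S_l⁻¹ A` in place of `A`. That
point may lie outside `P`, whence the conditional hypothesis on `A`. Different polygons are linked
at shared vertices, none of which is `A`. -/
theorem IsContractiblePolygonal.reflTransGen_edgeStep (hS : S.IsContractiblePolygonal P) (k : ℕ)
    {A : ℂ} (hA : A ∈ P.carrier → S.IsCyclicVertex P A) {u w : List (Fin m)}
    (hu : u.length = k) (hw : w.length = k) {a b : ℂ} (ha : a ∈ P.vertexSet)
    (hb : b ∈ P.vertexSet) (huA : S.wordMap u a ≠ A) (hwA : S.wordMap w b ≠ A) :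
    Relation.ReflTransGen (S.EdgeStep P k A) (S.wordMap u a) (S.wordMap w b) := by
  induction k generalizing A u w a b with
  | zero =>
    rw [List.length_eq_zero_iff] at hu hw
    subst hu hw
    obtain ⟨i, rfl⟩ := ha
    obtain ⟨j, rfl⟩ := hb
    refine (P.reflTransGen_edge A huA hwA).lift P.vertices fun i j h => ?_
    exact ⟨[], rfl, i, j, h.1, rfl, rfl, h.2.1, h.2.2⟩
  | succ k ih =>
    obtain ⟨i, u, rfl⟩ := List.exists_cons_of_length_eq_add_one hu
    obtain ⟨j, w, rfl⟩ := List.exists_cons_of_length_eq_add_one hw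
    have hpiece : ∀ (l : Fin m) (u w : List (Fin m)) (a b : ℂ), u.length = k → w.length = k →
        a ∈ P.vertexSet → b ∈ P.vertexSet → S.wordMap (l :: u) a ≠ A → S.wordMap (l :: w) b ≠ A →
        Relation.ReflTransGen (S.EdgeStep P (k + 1) A) (S.wordMap (l :: u) a)
          (S.wordMap (l :: w) b) := by
      intro l u w a b hu hw ha hb huA hwA
      obtain ⟨A', rfl⟩ : ∃ A', S.map l A' = A :=
        ⟨(A - (S.map l).center) / (S.map l).mult + (S.map l).center, by
          have := (S.map l).mult_ne_zero
          field_simp; ring⟩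
      have hA' : A' ∈ P.carrier → S.IsCyclicVertex P A' := fun h =>
        hS.isCyclicVertex_of_map (hA (hS.image_subset l ⟨_, h, rfl⟩)) h rfl
      exact (ih hA' hu hw ha hb (fun h => huA (congrArg (S.map l) h))
        (fun h => hwA (congrArg (S.map l) h))).lift
        (S.map l) fun x y h => h.map l
    have hij := hS.reflTransGen_piece i j
    replace hw : w.length = k := by simpa using hw
    induction hij generalizing w b with
    | refl => exact hpiece i u w a b (by simpa using hu) hw ha hb huA hwA
    | @tail p l _ hpl ih' =>
      by_cases hpl' : p = l
      · subst hpl'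
        exact ih' hb w hwA hw
      obtain ⟨z, ⟨c, hc, hcz⟩, ⟨d, hd, hdz⟩⟩ := hpl
      have hzA : z ≠ A := fun h => by
        have hp : A ∈ S.map p '' P.carrier := ⟨c, P.vertexSet_subset_carrier hc, hcz.trans h⟩
        have hl : A ∈ S.map l '' P.carrier := ⟨d, P.vertexSet_subset_carrier hd, hdz.trans h⟩
        exact hpl' (hS.eq_of_mem_pieces (hA (hS.image_subset p hp)) hp hl)
      obtain ⟨x, hx, c', hc', rfl⟩ := S.exists_wordMap_eq hS.vertexSet_subset k hc
      obtain ⟨y, hy, d', hd', rfl⟩ := S.exists_wordMap_eq hS.vertexSet_subset k hd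
      have h1 := ih' hc' x (by rw [wordMap_cons, hcz]; exact hzA) hx
      have h2 := hpiece l y w d' b hy hw hd' hb (by rw [wordMap_cons, hdz]; exact hzA) hwA
      rw [wordMap_cons _ p, hcz, ← hdz] at h1
      exact h1.trans h2

end SimilaritySystem

/-! ### Variation of the argument along paths -/

/-- There is a path from `x` to `y` in `X \ {A}` along which `arg (z - A)` varies by `α`. -/
def HasVariation (X : Set ℂ) (A x y : ℂ) (α : ℝ) : Prop :=
  ∃ (γ : Path x y) (θ : C(unitInterval, ℝ)), (∀ t, γ t ∈ X \ {A}) ∧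
    (∀ t, γ t - A = ‖γ t - A‖ * Complex.exp (θ t * Complex.I)) ∧ α = θ 1 - θ 0

namespace HasVariation

variable {X : Set ℂ} {A x y z : ℂ} {α β : ℝ}

theorem refl (hx : x ∈ X) (hxA : x ≠ A) : HasVariation X A x x 0 :=
  ⟨Path.refl x, ContinuousMap.const _ (x - A).arg, fun _ => ⟨hx, hxA⟩,
    fun _ => isArgument_arg (fun _ : ℂ => x - A) x, by simp⟩

theorem mono {Y : Set ℂ} (h : HasVariation X A x y α) (hXY : X ⊆ Y) : HasVariation Y A x y α := by
  obtain ⟨γ, θ, hγ, hθ, e⟩ := h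
  exact ⟨γ, θ, fun t => ⟨hXY (hγ t).1, (hγ t).2⟩, hθ, e⟩

theorem trans (h₁ : HasVariation X A x y α) (h₂ : HasVariation X A y z β) :
    HasVariation X A x z (α + β) := by
  obtain ⟨γ₁, θ₁, hγ₁, hθ₁, rfl⟩ := h₁
  obtain ⟨γ₂, θ₂, hγ₂, hθ₂, rfl⟩ := h₂
  -- Both arguments are arguments of `y - A`, so `c` is a multiple of `2π` and may be added to the
  -- second one.
  set c := θ₁ 1 - θ₂ 0 with hc
  have hyA : y - A ≠ 0 := by
    have := (hγ₁ 1).2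
    rw [γ₁.target] at this
    exact sub_ne_zero.2 this
  have hexp : Complex.exp ((c : ℂ) * Complex.I) = 1 := by
    have e₁ := hθ₁ 1
    have e₂ := hθ₂ 0
    rw [γ₁.target] at e₁
    rw [γ₂.source] at e₂
    rw [hc]
    push_cast
    rw [sub_mul, Complex.exp_sub, exp_eq_div_norm hyA e₁, exp_eq_div_norm hyA e₂]
    refine div_self (div_ne_zero hyA ?_)
    simpa using hyA
  let p₁ : Path (θ₁ 0) (θ₁ 1) := ⟨θ₁, rfl, rfl⟩
  let p₂ : Path (θ₁ 1) (θ₂ 1 + c) := ⟨⟨fun t => θ₂ t + c, by fun_prop⟩, by simp [hc], rfl⟩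
  refine ⟨γ₁.trans γ₂, (p₁.trans p₂).toContinuousMap, fun t => ?_, fun t => ?_, ?_⟩
  · rw [Path.trans_apply]
    split_ifs
    · exact hγ₁ _
    · exact hγ₂ _
  · change _ = _ * Complex.exp (((p₁.trans p₂) t : ℝ) * Complex.I)
    rw [Path.trans_apply, Path.trans_apply]
    split_ifs
    · exact hθ₁ _
    · have e : ∀ s, p₂ s = θ₂ s + c := fun s => rfl
      rw [e]
      push_cast
      rw [add_mul, Complex.exp_add, hexp, mul_one]
      exact hθ₂ _
  · change _ = (p₁.trans p₂) 1 - (p₁.trans p₂) 0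
    rw [Path.target, Path.source, hc]
    ring

/-- After division by `x - A` the segment runs from `1` inside the slit plane, which is star-shaped
about `1` and on which `Complex.arg` is continuous. -/
theorem of_segment (hX : segment ℝ x y ⊆ X) (hxA : x ≠ A)
    (h : (y - A) / (x - A) ∈ Complex.slitPlane) :
    HasVariation X A x y ((y - A) / (x - A)).arg := by
  set r := (y - A) / (x - A) with hr
  have hxA' : x - A ≠ 0 := sub_ne_zero.2 hxA
  have hslit : ∀ t : unitInterval, 1 + ((t : ℝ) : ℂ) * (r - 1) ∈ Complex.slitPlane := fun t => by
    have := Complex.starConvex_one_slitPlane.add_smul_sub_mem h t.2.1 t.2.2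
    simpa using this
  let γ : Path x y := ⟨⟨fun t => x + ((t : ℝ) : ℂ) * (y - x), by fun_prop⟩, by simp, by simp⟩
  have hγ : ∀ t : unitInterval, γ t = x + ((t : ℝ) : ℂ) * (y - x) := fun t => rfl
  have hγA : ∀ t : unitInterval, γ t - A = (x - A) * (1 + ((t : ℝ) : ℂ) * (r - 1)) := fun t => by
    rw [hγ, hr]
    field_simp
    ring
  have hcont : Continuous fun t : unitInterval => (1 + ((t : ℝ) : ℂ) * (r - 1)).arg := by
    rw [continuous_iff_continuousAt]
    intro t
    exact ContinuousAt.comp (g := Complex.arg) (Complex.continuousAt_arg (hslit t))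
      (Continuous.continuousAt (by fun_prop))
  refine ⟨γ, ⟨fun t => (x - A).arg + (1 + ((t : ℝ) : ℂ) * (r - 1)).arg, by fun_prop⟩,
    fun t => ⟨hX ?_, fun h0 => ?_⟩, fun t => ?_, ?_⟩
  · rw [segment_eq_image']
    exact ⟨t, t.2, by rw [hγ]; simp⟩
  · have h1 := hγA t
    rw [mem_singleton_iff.1 h0, sub_self] at h1
    exact mul_ne_zero hxA' (Complex.slitPlane_ne_zero (hslit t)) h1.symm
  · have h1 := (isArgument_arg fun _ : unitInterval => x - A).mul
      (isArgument_arg fun t : unitInterval => 1 + ((t : ℝ) : ℂ) * (r - 1)) t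
    rw [hγA]
    exact h1
  · simp

theorem eq_sub {Θ : ℂ → ℝ} (hΘ : IsArgumentOn Θ A (X \ {A})) (h : HasVariation X A x y α) :
    α = Θ y - Θ x := by
  obtain ⟨γ, θ, hγ, hθ, rfl⟩ := h
  have hk : ∀ t, Complex.exp (((Θ (γ t) - θ t : ℝ) : ℂ) * Complex.I) = 1 := fun t => by
    have h0 := sub_ne_zero.2 (hγ t).2
    push_cast
    rw [sub_mul, Complex.exp_sub, exp_eq_div_norm h0 (hθ t), hΘ.exp_eq (hγ t) (hγ t).2]
    exact div_self (div_ne_zero h0 (by simpa using h0))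
  have := eq_of_exp_mul_I_eq (θ := fun t => Θ (γ t) - θ t)
    ((hΘ.continuousOn.comp_continuous γ.continuous hγ).sub θ.continuous)
    (fun a b => (hk a).trans (hk b).symm) 0 1
  simp only [γ.source, γ.target] at this
  linarith

end HasVariation

theorem div_mem_slitPlane_of_notMem_segment {A x y : ℂ} (h : A ∉ segment ℝ x y) :
    (y - A) / (x - A) ∈ Complex.slitPlane := by
  have hxA : x - A ≠ 0 := sub_ne_zero.2 fun e => h (e ▸ left_mem_segment ℝ x y)
  rw [Complex.mem_slitPlane_iff]
  by_contra! hc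
  set r := (y - A) / (x - A) with hr
  have hre : r = ((-(-r.re) : ℝ) : ℂ) := Complex.ext (by simp) (by simp [hc.2])
  have hs : 0 ≤ -r.re := by linarith [hc.1]
  generalize -r.re = s at hre hs
  have hy : y - A = -s * (x - A) := by
    rw [← div_eq_iff hxA, ← hr, hre]; push_cast; ring
  apply h
  have h1 : (0:ℝ) < 1 + s := by linarith
  refine ⟨s / (1 + s), 1 / (1 + s), by positivity, by positivity, by field_simp; ring, ?_⟩
  have h2 : (1 + s : ℂ) ≠ 0 := by exact_mod_cast h1.ne'
  simp only [Complex.real_smul]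
  push_cast
  field_simp
  linear_combination hy

namespace SimilaritySystem

variable {m n : ℕ}

/-! ### The filter of small deformations -/

/-- A deformation of the system `S` (of any size). -/
structure Deformation (S : SimilaritySystem m) (P : DiskPolygon n) where
  /-- The number of vertices of the deformed polygon. -/
  vertexCount : ℕ
  /-- The deformed polygon. -/
  polygon : DiskPolygon vertexCount
  /-- The deformed system. -/
  system : SimilaritySystem m
  isGeneralized : system.IsGeneralizedPolygonal polygon
  /-- The bijection of the vertices. -/
  toFun : ℂ → ℂ
  bijOn_pieceVertices : BijOn toFun (S.pieceVertices P) (system.pieceVertices polygon)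
  bijOn_vertexSet : BijOn toFun P.vertexSet polygon.vertexSet
  exists_homeomorph : ∃ h : P.carrier ≃ₜ polygon.carrier,
    ∀ x : P.carrier, (x : ℂ) ∈ P.vertexSet → (h x : ℂ) = toFun x
  map_conj : ∀ k, ∀ x ∈ P.vertexSet, toFun (S.map k x) = system.map k (toFun x)

/-- The filter of the deformations of `S` that are close to the identity. -/
def nearby (S : SimilaritySystem m) (P : DiskPolygon n) : Filter (S.Deformation P) :=
  -- Only the finitely many vertices of the polygons `P_i` are measured, so smallness of a
  -- deformation becomes convergence in a finite product and estimates become limits along a filter.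
  Filter.comap (fun d (p : Fin m × Fin n) => d.toFun (S.map p.1 (P.vertices p.2)))
    (𝓝 fun p => S.map p.1 (P.vertices p.2))

variable {S : SimilaritySystem m} {P : DiskPolygon n}

theorem exists_pos_of_eventually_nearby {Q : S.Deformation P → Prop}
    (h : ∀ᶠ d in S.nearby P, Q d) :
    ∃ δ : ℝ, 0 < δ ∧ ∀ d : S.Deformation P, (∀ x ∈ S.pieceVertices P, ‖d.toFun x - x‖ < δ) → Q d := by
  obtain ⟨δ, hδ, hQ⟩ := (Metric.nhds_basis_ball.comap _).eventually_iff.1 h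
  refine ⟨δ, hδ, fun d hd => hQ ?_⟩
  rw [mem_preimage, Metric.mem_ball, dist_pi_lt_iff hδ]
  intro p
  rw [dist_eq_norm]
  exact hd _ (mem_iUnion.2 ⟨p.1, _, ⟨p.2, rfl⟩, rfl⟩)

theorem tendsto_toFun {x : ℂ} (hx : x ∈ S.pieceVertices P) :
    Filter.Tendsto (fun d => d.toFun x) (S.nearby P) (𝓝 x) := by
  obtain ⟨i, _, ⟨j, rfl⟩, rfl⟩ := mem_iUnion.1 hx
  exact (tendsto_pi_nhds.1 (Filter.tendsto_comap (f := fun (d : S.Deformation P)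
    (p : Fin m × Fin n) => d.toFun (S.map p.1 (P.vertices p.2))))) (i, j)

namespace IsContractiblePolygonal

variable (hS : S.IsContractiblePolygonal P)
include hS

theorem tendsto_vertex {x : ℂ} (hx : x ∈ P.vertexSet) :
    Filter.Tendsto (fun d => d.toFun x) (S.nearby P) (𝓝 x) :=
  tendsto_toFun (hS.vertexSet_subset_pieceVertices hx)

/-- The multiplier is the quotient of the differences of two vertices after and before the map. -/
theorem tendsto_mult (k : Fin m) :
    Filter.Tendsto (fun d => (d.system.map k).mult) (S.nearby P) (𝓝 (S.map k).mult) := by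
  set a := P.vertices P.zeroIndex with ha
  set b := P.vertices (finRotate n P.zeroIndex) with hb
  have hba : b ≠ a := P.vertices_finRotate_ne _
  have haV : a ∈ P.vertexSet := ⟨_, rfl⟩
  have hbV : b ∈ P.vertexSet := ⟨_, rfl⟩
  have hpiece : ∀ x ∈ P.vertexSet, S.map k x ∈ S.pieceVertices P := fun x hx =>
    mem_iUnion.2 ⟨k, x, hx, rfl⟩
  have h1 := ((tendsto_toFun (hpiece b hbV)).sub (tendsto_toFun (hpiece a haV))).div
    ((hS.tendsto_vertex hbV).sub (hS.tendsto_vertex haV)) (sub_ne_zero.2 hba)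
  rw [map_sub, mul_div_cancel_right₀ _ (sub_ne_zero.2 hba)] at h1
  refine h1.congr fun d => ?_
  have hne : d.toFun b - d.toFun a ≠ 0 :=
    sub_ne_zero.2 fun h => hba (d.bijOn_vertexSet.injOn hbV haV h)
  simp only [Pi.div_apply]
  rw [d.map_conj k b hbV, d.map_conj k a haV, map_sub, mul_div_cancel_right₀ _ hne]

theorem tendsto_map (k : Fin m) {g : S.Deformation P → ℂ} {z : ℂ}
    (hg : Filter.Tendsto g (S.nearby P) (𝓝 z)) :
    Filter.Tendsto (fun d => d.system.map k (g d)) (S.nearby P) (𝓝 (S.map k z)) := by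
  obtain ⟨a, haV⟩ := P.vertexSet_nonempty
  have h1 := (tendsto_toFun (mem_iUnion.2 ⟨k, a, haV, rfl⟩ : S.map k a ∈ S.pieceVertices P)).add
    ((hS.tendsto_mult k).mul (hg.sub (hS.tendsto_vertex haV)))
  rw [← map_sub, add_sub_cancel] at h1
  refine h1.congr fun d => ?_
  rw [d.map_conj k a haV, ← map_sub, add_sub_cancel]

theorem tendsto_wordMap (w : List (Fin m)) {g : S.Deformation P → ℂ} {z : ℂ}
    (hg : Filter.Tendsto g (S.nearby P) (𝓝 z)) :
    Filter.Tendsto (fun d => d.system.wordMap w (g d)) (S.nearby P) (𝓝 (S.wordMap w z)) := by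
  induction w with
  | nil => exact hg
  | cons i w ih => exact hS.tendsto_map i ih

theorem tendsto_wordMult (w : List (Fin m)) :
    Filter.Tendsto (fun d => d.system.wordMult w) (S.nearby P) (𝓝 (S.wordMult w)) := by
  induction w with
  | nil => simpa using tendsto_const_nhds
  | cons i w ih =>
    simp only [wordMult_cons]
    exact (hS.tendsto_mult i).mul ih

/-- If `e` bounds the distance of the two codings for all addresses, removing one letter improves
the bound to `q' * e + ε * (1 - q')`; the iterates tend to `ε`. -/
theorem eventually_coding {ε : ℝ} (hε : 0 < ε) :
    ∀ᶠ d in S.nearby P, ∀ σ, ‖d.system.coding σ - S.coding σ‖ ≤ ε := by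
  obtain ⟨q, hq0, hq1, hq⟩ := S.exists_ratio
  obtain ⟨q', hqq', hq'1⟩ := exists_between hq1
  have hq'0 := hq0.trans hqq'
  obtain ⟨D, hD⟩ := S.isAttractor_attractor.isCompact.isBounded.exists_norm_le
  have hD0 : 0 ≤ D := (norm_nonneg _).trans (hD _ (S.coding_mem fun _ => ⟨0, S.pos⟩))
  have hη : 0 < ε * (1 - q') / 2 := by
    have : 0 < 1 - q' := by linarith
    positivity
  have e1 : ∀ᶠ d in S.nearby P, ∀ k, ‖(d.system.map k).mult‖ < q' :=
    Filter.eventually_all.2 fun k =>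
      (hS.tendsto_mult k).norm.eventually (gt_mem_nhds ((hq k).trans_lt hqq'))
  have e2 : ∀ᶠ d in S.nearby P, ∀ k, ‖d.system.map k 0 - S.map k 0‖ < ε * (1 - q') / 2 :=
    Filter.eventually_all.2 fun k => by
      have := ((hS.tendsto_map k (tendsto_const_nhds (x := (0 : ℂ)))).sub_const (S.map k 0)).norm
      rw [sub_self, norm_zero] at this
      exact this.eventually (gt_mem_nhds hη)
  have e3 : ∀ᶠ d in S.nearby P, ∀ k,
      ‖(d.system.map k).mult - (S.map k).mult‖ < ε * (1 - q') / 2 / (D + 1) :=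
    Filter.eventually_all.2 fun k => by
      have := ((hS.tendsto_mult k).sub_const (S.map k).mult).norm
      rw [sub_self, norm_zero] at this
      exact this.eventually (gt_mem_nhds (by positivity))
  filter_upwards [e1, e2, e3] with d h1 h2 h3
  have hclose : ∀ k, ∀ z ∈ S.attractor, ‖d.system.map k z - S.map k z‖ ≤ ε * (1 - q') := by
    intro k z hz
    have e : d.system.map k z - S.map k z = (d.system.map k 0 - S.map k 0) +
        ((d.system.map k).mult - (S.map k).mult) * z := by ring
    rw [e]
    refine (norm_add_le _ _).trans ?_
    rw [norm_mul]
    have h4 : ‖(d.system.map k).mult - (S.map k).mult‖ * ‖z‖ ≤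
        ε * (1 - q') / 2 / (D + 1) * (D + 1) :=
      mul_le_mul (h3 k).le ((hD z hz).trans (by linarith)) (norm_nonneg _) (by positivity)
    rw [div_mul_cancel₀ _ (by positivity)] at h4
    linarith [h2 k]
  obtain ⟨D', hD'⟩ := d.system.isAttractor_attractor.isCompact.isBounded.exists_norm_le
  have key : ∀ (N : ℕ) (σ : ℕ → Fin m),
      ‖d.system.coding σ - S.coding σ‖ ≤ ε + q' ^ N * (D' + D) := by
    intro N
    induction N with
    | zero =>
      intro σ
      have := norm_sub_le (d.system.coding σ) (S.coding σ)
      linarith [hD' _ (d.system.coding_mem σ), hD _ (S.coding_mem σ)]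
    | succ N ih =>
      intro σ
      rw [d.system.coding_eq σ, S.coding_eq σ]
      set x := d.system.coding fun k => σ (k + 1)
      set y := S.coding fun k => σ (k + 1)
      have e : d.system.map (σ 0) x - S.map (σ 0) y =
        (d.system.map (σ 0) x - d.system.map (σ 0) y) + (d.system.map (σ 0) y - S.map (σ 0) y) := by
        ring
      rw [e]
      refine (norm_add_le _ _).trans ?_
      rw [map_sub, norm_mul]
      have h4 := mul_le_mul (h1 (σ 0)).le (ih fun k => σ (k + 1)) (norm_nonneg _) hq'0.le
      have h5 := hclose (σ 0) y (S.coding_mem _)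
      rw [pow_succ']
      nlinarith
  intro σ
  have ht : Filter.Tendsto (fun N : ℕ => ε + q' ^ N * (D' + D)) Filter.atTop
      (𝓝 (ε + 0 * (D' + D))) :=
    ((tendsto_pow_atTop_nhds_zero_of_lt_one hq'0.le hq'1).mul_const _).const_add _
  rw [zero_mul, add_zero] at ht
  exact ge_of_tendsto' ht fun N => key N σ

/-! ### Rotation angles of small deformations -/

theorem mem_vertexSet_of_mem_pieceVertices {B z : ℂ} (hB : B ∈ S.pieceVertices P) {i : Fin m}
    (hz : z ∈ P.carrier) (e : S.map i z = B) : z ∈ P.vertexSet := by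
  obtain ⟨k, a, ha, hk⟩ := mem_iUnion.1 hB
  by_cases hki : k = i
  · subst hki
    rwa [S.map_injective _ (e.trans hk.symm)]
  · have : B ∈ S.map k '' P.carrier ∩ S.map i '' P.carrier :=
      ⟨⟨a, P.vertexSet_subset_carrier ha, hk⟩, ⟨z, hz, e⟩⟩
    rw [hS.inter_eq k i hki] at this
    obtain ⟨-, b, hb, hb'⟩ := this
    rwa [S.map_injective _ (e.trans hb'.symm)]

/-- The deformed position of a level vertex does not depend on how it is written as `S_w b`. At the
first letter where two words differ, the point lies in two polygons, so it comes from vertices and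
`f` decides. -/
theorem wordMap_conj_eq (d : S.Deformation P) {u w : List (Fin m)} (hlen : u.length = w.length)
    {a b : ℂ} (ha : a ∈ P.vertexSet) (hb : b ∈ P.vertexSet)
    (e : S.wordMap u a = S.wordMap w b) :
    d.system.wordMap u (d.toFun a) = d.system.wordMap w (d.toFun b) := by
  induction u generalizing w with
  | nil =>
    rw [List.length_nil, eq_comm, List.length_eq_zero_iff] at hlen
    subst hlen
    exact congrArg d.toFun e
  | cons i u ih =>
    cases w with
    | nil => simp at hlen
    | cons j w =>
      have hlen' : u.length = w.length := by simpa using hlen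
      by_cases hij : i = j
      · subst hij
        rw [wordMap_cons, wordMap_cons, ih hlen' (S.map_injective i e)]
      · have huC := S.wordMap_mem hS.image_subset u (P.vertexSet_subset_carrier ha)
        have hwC := S.wordMap_mem hS.image_subset w (P.vertexSet_subset_carrier hb)
        have hmem : S.wordMap (i :: u) a ∈ S.map i '' P.carrier ∩ S.map j '' P.carrier :=
          ⟨⟨_, huC, rfl⟩, ⟨_, hwC, e.symm⟩⟩
        rw [hS.inter_eq i j hij] at hmem
        have hB : S.wordMap (i :: u) a ∈ S.pieceVertices P := mem_iUnion.2 ⟨i, hmem.1⟩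
        have hu := hS.mem_vertexSet_of_mem_pieceVertices hB huC rfl
        have hw := hS.mem_vertexSet_of_mem_pieceVertices hB hwC e.symm
        rw [wordMap_cons, wordMap_cons, hS.wordMap_conj d.map_conj hu ha rfl,
          hS.wordMap_conj d.map_conj hw hb rfl, ← d.map_conj i _ hu, ← d.map_conj j _ hw]
        exact congrArg d.toFun e

/-- Every preimage in `P` of the vertex `A` under `S_u` is a vertex, and a side contains no vertices
except its endpoints. -/
theorem notMem_segment_of_edgeStep {A : ℂ} (hA : A ∈ P.vertexSet) {u : List (Fin m)} {i j : Fin n}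
    (hij : j = finRotate n i ∨ i = finRotate n j) (hi : S.wordMap u (P.vertices i) ≠ A)
    (hj : S.wordMap u (P.vertices j) ≠ A) :
    A ∉ segment ℝ (S.wordMap u (P.vertices i)) (S.wordMap u (P.vertices j)) := by
  have key : ∀ i : Fin n, S.wordMap u (P.vertices i) ≠ A →
      S.wordMap u (P.vertices (finRotate n i)) ≠ A →
      A ∉ segment ℝ (S.wordMap u (P.vertices i)) (S.wordMap u (P.vertices (finRotate n i))) := by
    intro i h1 h2 h
    rw [segment_eq_image'] at h
    obtain ⟨t, ht, h⟩ := h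
    set c := P.vertices i + t • (P.vertices (finRotate n i) - P.vertices i) with hc
    have hcs : c ∈ segment ℝ (P.vertices i) (P.vertices (finRotate n i)) := by
      rw [segment_eq_image']
      exact ⟨t, ht, rfl⟩
    have hcA : S.wordMap u c = A := by
      rw [← h]
      have h3 := S.wordMap_sub u c (P.vertices i)
      simp only [wordMap_sub, Complex.real_smul]
      rw [hc, Complex.real_smul] at h3
      linear_combination h3
    obtain ⟨l, hl⟩ := hS.mem_vertexSet_of_wordMap hA (P.segment_subset_carrier i hcs) hcA
    rw [← hl] at hcs hcA
    rcases P.eq_or_eq_of_mem_edge hcs with rfl | rfl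
    · exact h1 hcA
    · exact h2 hcA
  rcases hij with rfl | rfl
  · exact key i hi hj
  · rw [segment_symm]
    exact key j hj hi

omit hS in
-- The extension of `f` to a homeomorphism of the polygons is used here: adjacent vertices remain
-- adjacent.
theorem segment_subset_levelUnion {i j : Fin n} (hij : j = finRotate n i ∨ i = finRotate n j)
    (u : List (Fin m)) (d : S.Deformation P) :
    segment ℝ (d.system.wordMap u (d.toFun (P.vertices i)))
      (d.system.wordMap u (d.toFun (P.vertices j))) ⊆ d.system.levelUnion d.polygon u.length := by
  obtain ⟨h, hh⟩ := d.exists_homeomorph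
  have hseg : segment ℝ (d.toFun (P.vertices i)) (d.toFun (P.vertices j)) ⊆ d.polygon.carrier := by
    rcases hij with rfl | rfl
    · exact P.segment_subset_of_homeomorph d.bijOn_vertexSet h hh i
    · rw [segment_symm]
      exact P.segment_subset_of_homeomorph d.bijOn_vertexSet h hh j
  intro z hz
  rw [segment_eq_image'] at hz
  obtain ⟨t, ht, rfl⟩ := hz
  refine mem_iUnion.2 ⟨⟨u, rfl⟩, d.toFun (P.vertices i) +
    t • (d.toFun (P.vertices j) - d.toFun (P.vertices i)), hseg ?_, ?_⟩
  · rw [segment_eq_image']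
    exact ⟨t, ht, rfl⟩
  · have h3 := d.system.wordMap_sub u (d.toFun (P.vertices i) +
      t • (d.toFun (P.vertices j) - d.toFun (P.vertices i))) (d.toFun (P.vertices i))
    simp only [Complex.real_smul] at h3 ⊢
    rw [wordMap_sub]
    linear_combination h3

/-- The identical deformation. -/
def identical : S.Deformation P where
  vertexCount := n
  polygon := P
  system := S
  isGeneralized := hS.toIsGeneralizedPolygonal
  toFun := id
  bijOn_pieceVertices := bijOn_id _
  bijOn_vertexSet := bijOn_id _
  exists_homeomorph := ⟨Homeomorph.refl _, fun _ _ => rfl⟩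
  map_conj := fun _ _ _ => rfl

/-- A chain of edges gives paths in the level sets of all small deformations, along which the
variations of the argument depend continuously on the deformation. -/
theorem exists_variation {k : ℕ} {A : ℂ} (hA : A ∈ P.vertexSet) {u₀ : List (Fin m)}
    (hu₀ : u₀.length = k) {a₀ : ℂ} (ha₀ : a₀ ∈ P.vertexSet) (hxA : S.wordMap u₀ a₀ ≠ A) {y : ℂ}
    (h : Relation.ReflTransGen (S.EdgeStep P k A) (S.wordMap u₀ a₀) y) :
    ∃ (α₀ : ℝ) (α : S.Deformation P → ℝ),
      HasVariation (S.levelUnion P k) A (S.wordMap u₀ a₀) y α₀ ∧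
      Filter.Tendsto α (S.nearby P) (𝓝 α₀) ∧
      ∀ᶠ d in S.nearby P, ∀ w : List (Fin m), w.length = k → ∀ b ∈ P.vertexSet,
        S.wordMap w b = y →
        HasVariation (d.system.levelUnion d.polygon k) (d.toFun A)
          (d.system.wordMap u₀ (d.toFun a₀)) (d.system.wordMap w (d.toFun b)) (α d) := by
  induction h with
  | refl =>
    refine ⟨0, fun _ => 0, HasVariation.refl ?_ hxA, tendsto_const_nhds, ?_⟩
    · exact mem_iUnion.2 ⟨⟨u₀, hu₀⟩, a₀, P.vertexSet_subset_carrier ha₀, rfl⟩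
    · have h1 := (hS.tendsto_wordMap u₀ (hS.tendsto_vertex ha₀)).sub (hS.tendsto_vertex hA)
      filter_upwards [h1.eventually_ne (sub_ne_zero.2 hxA)] with d hd w hw b hb e
      rw [hS.wordMap_conj_eq d (hw.trans hu₀.symm) hb ha₀ e]
      refine HasVariation.refl (mem_iUnion.2 ⟨⟨u₀, hu₀⟩, _, ?_, rfl⟩) (sub_ne_zero.1 hd)
      exact d.polygon.vertexSet_subset_carrier (d.bijOn_vertexSet.mapsTo ha₀)
  | @tail y z _ hyz ih =>
    obtain ⟨α₀, α, h1, h2, h3⟩ := ih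
    obtain ⟨u, hu, i, j, hij, rfl, rfl, hi, hj⟩ := hyz
    -- As `A` is not on the edge, the quotient lies in the slit plane, which is open and on which
    -- `Complex.arg` is continuous, so the variation along the deformed edge converges.
    have hslit := div_mem_slitPlane_of_notMem_segment (hS.notMem_segment_of_edgeStep hA hij hi hj)
    have hiV : P.vertices i ∈ P.vertexSet := ⟨i, rfl⟩
    have hjV : P.vertices j ∈ P.vertexSet := ⟨j, rfl⟩
    have ht : Filter.Tendsto (fun d : S.Deformation P =>
        (d.system.wordMap u (d.toFun (P.vertices j)) - d.toFun A) /
        (d.system.wordMap u (d.toFun (P.vertices i)) - d.toFun A)) (S.nearby P)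
        (𝓝 ((S.wordMap u (P.vertices j) - A) / (S.wordMap u (P.vertices i) - A))) :=
      ((hS.tendsto_wordMap u (hS.tendsto_vertex hjV)).sub (hS.tendsto_vertex hA)).div
        ((hS.tendsto_wordMap u (hS.tendsto_vertex hiV)).sub (hS.tendsto_vertex hA))
        (sub_ne_zero.2 hi)
    refine ⟨α₀ + ((S.wordMap u (P.vertices j) - A) / (S.wordMap u (P.vertices i) - A)).arg,
      fun d => α d + ((d.system.wordMap u (d.toFun (P.vertices j)) - d.toFun A) /
        (d.system.wordMap u (d.toFun (P.vertices i)) - d.toFun A)).arg, ?_, ?_, ?_⟩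
    · refine h1.trans (HasVariation.of_segment ?_ hi hslit)
      have := segment_subset_levelUnion hij u hS.identical
      rw [hu] at this
      exact this
    · exact h2.add ((Complex.continuousAt_arg hslit).tendsto.comp ht)
    · filter_upwards [h3, ht.eventually (Complex.isOpen_slitPlane.mem_nhds hslit)] with d hd3 hd w hw
        b hb e
      rw [hS.wordMap_conj_eq d (hw.trans hu.symm) hb hjV e]
      refine (hd3 u hu _ hiV rfl).trans (HasVariation.of_segment ?_ ?_ hd)
      · have := segment_subset_levelUnion hij u d
        rwa [hu] at this
      · intro h0
        rw [h0, sub_self, div_zero] at hd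
        simp at hd

/-- Near the identity the rotation angle at a cyclic vertex is small. -/
theorem exists_isRotationAngle {A : ℂ} (hA : A ∈ P.vertexSet) {v : List (Fin m)}
    (hv : S.IsShortestFixing A v) :
    ∃ α : S.Deformation P → ℝ, Filter.Tendsto α (S.nearby P) (𝓝 0) ∧
      ∀ᶠ d in S.nearby P, d.system.IsShortestFixing (d.toFun A) v ∧
        d.system.IsRotationAngle d.polygon (d.toFun A) v (α d) := by
  obtain ⟨hv0, hvA, hvmin⟩ := hv
  have hcyc : S.IsCyclicVertex P A := ⟨hA, v, hv0, hvA⟩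
  obtain ⟨B, hB, hBA⟩ := P.exists_vertex_ne A
  -- By (D3) the vertex `B` is also a vertex of a polygon of level `v.length`, so the chain from `B`
  -- to `S_v B` can stay in that level.
  obtain ⟨u, hu, a, ha, hua⟩ := S.exists_wordMap_eq hS.vertexSet_subset v.length hB
  have hvB : S.wordMap v B ≠ A := fun h => hBA (S.wordMap_injective v (h.trans hvA.symm))
  have hchain := hS.reflTransGen_edgeStep v.length (fun _ => hcyc) hu rfl ha hB
    (by rw [hua]; exact hBA) hvB
  obtain ⟨α₀, α, h1, h2, h3⟩ := hS.exists_variation hA hu ha (by rw [hua]; exact hBA) hchain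
  rw [hua] at h1
  -- Before deformation the path stays in `P`, where the argument is single-valued and `S_v` does
  -- not change it.
  have hα₀ : α₀ = 0 := by
    obtain ⟨Θ, hΘ⟩ := P.exists_isArgumentOn (P.vertexSet_subset_frontier hA)
    have h4 := (h1.mono (Y := P.carrier) (by
      refine iUnion_subset fun w => ?_
      rintro _ ⟨z, hz, rfl⟩
      exact S.wordMap_mem hS.image_subset w hz)).eq_sub hΘ
    rw [h4, hS.argument_wordMap hA hvA hΘ ⟨P.vertexSet_subset_carrier hB, hBA⟩, sub_self]
  subst hα₀
  refine ⟨α, h2, ?_⟩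
  -- Minimality of `v` survives small deformations because only finitely many shorter words compete.
  have hfin : {w : List (Fin m) | w.length < v.length ∧ w ≠ []}.Finite :=
    (List.finite_length_lt (Fin m) v.length).subset fun w hw => hw.1
  have hmin : ∀ᶠ d in S.nearby P, ∀ w ∈ {w : List (Fin m) | w.length < v.length ∧ w ≠ []},
      d.system.wordMap w (d.toFun A) - d.toFun A ≠ 0 :=
    (Filter.eventually_all_finite hfin).2 fun w hw =>
      ((hS.tendsto_wordMap w (hS.tendsto_vertex hA)).sub (hS.tendsto_vertex hA)).eventually_ne
        (sub_ne_zero.2 fun h => absurd (hvmin w hw.2 h) (not_le.2 hw.1))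
  filter_upwards [h3, hmin] with d hd hdmin
  refine ⟨⟨hv0, hS.wordMap_conj d.map_conj hA hA hvA, fun w hw hwA => ?_⟩, d.toFun B,
    d.bijOn_vertexSet.mapsTo hB, fun h => hBA (d.bijOn_vertexSet.injOn hB hA h), ?_⟩
  · by_contra! hlt
    exact hdmin w ⟨hlt, hw⟩ (sub_eq_zero.2 hwA)
  · have h5 := hd v rfl B hB rfl
    rw [hS.wordMap_conj d.map_conj hB ha hua] at h5
    exact h5

end IsContractiblePolygonal

end SimilaritySystem

/-! ### Directions -/

theorem norm_div_norm_sub_le {u v : ℂ} (hu : u ≠ 0) (hv : v ≠ 0) :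
    ‖u / ‖u‖ - v / ‖v‖‖ ≤ 2 * ‖u - v‖ / ‖u‖ := by
  have hu' : 0 < ‖u‖ := norm_pos_iff.2 hu
  have hv' : 0 < ‖v‖ := norm_pos_iff.2 hv
  have huc : (‖u‖ : ℂ) ≠ 0 := by exact_mod_cast hu'.ne'
  have hvc : (‖v‖ : ℂ) ≠ 0 := by exact_mod_cast hv'.ne'
  have e : u / ‖u‖ - v / ‖v‖ = (u - v) / ‖u‖ + v / ‖v‖ * (((‖v‖ - ‖u‖ : ℝ) : ℂ) / ‖u‖) := by
    push_cast; field_simp; ring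
  rw [e]
  refine (norm_add_le _ _).trans ?_
  rw [norm_div, norm_mul, norm_div, norm_div, Complex.norm_real, Complex.norm_real, norm_norm, norm_norm,
    div_self hv'.ne', one_mul, ← add_div]
  gcongr
  have := abs_norm_sub_norm_le v u
  rw [norm_sub_rev v u] at this
  rw [Complex.norm_real, Real.norm_eq_abs]
  linarith

/-- The twisting factor `e ^ (-i lam log r)` of a spiral with parameter `lam`. -/
def spiralFactor (lam r : ℝ) : ℂ := Complex.exp (((-(lam * Real.log r) : ℝ) : ℂ) * Complex.I)

theorem norm_spiralFactor (lam r : ℝ) : ‖spiralFactor lam r‖ = 1 := Complex.norm_exp_ofReal_mul_I _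

theorem spiralFactor_mul (lam : ℝ) {r s : ℝ} (hr : r ≠ 0) (hs : s ≠ 0) :
    spiralFactor lam (r * s) = spiralFactor lam r * spiralFactor lam s := by
  rw [spiralFactor, spiralFactor, spiralFactor, ← Complex.exp_add, Real.log_mul hr hs]
  push_cast
  ring_nf

theorem norm_spiralFactor_sub_one_le (lam r : ℝ) :
    ‖spiralFactor lam r - 1‖ ≤ |lam| * |Real.log r| := by
  have := Real.norm_exp_I_mul_ofReal_sub_one_le (x := -(lam * Real.log r))
  rw [Real.norm_eq_abs, abs_neg, abs_mul, mul_comm Complex.I] at this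
  exact this

/-- The direction of `z`, untwisted by a spiral with parameter `lam`. -/
def spiralDir (lam : ℝ) (z : ℂ) : ℂ := z / ‖z‖ * spiralFactor lam ‖z‖

theorem norm_spiralDir (lam : ℝ) {z : ℂ} (hz : z ≠ 0) : ‖spiralDir lam z‖ = 1 := by
  rw [spiralDir, norm_mul, norm_spiralFactor, norm_div, Complex.norm_real, norm_norm, mul_one,
    div_self (norm_ne_zero_iff.2 hz)]

/-- A multiplier `r e ^ (i lam log r)` has `spiralDir` equal to `1`, and by multiplicativity it
disappears from any product. -/
theorem spiralDir_mul (lam : ℝ) {z w : ℂ} (hz : z ≠ 0) (hw : w ≠ 0) :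
    spiralDir lam (z * w) = spiralDir lam z * spiralDir lam w := by
  rw [spiralDir, spiralDir, spiralDir, norm_mul,
    spiralFactor_mul lam (norm_ne_zero_iff.2 hz) (norm_ne_zero_iff.2 hw)]
  push_cast
  rw [mul_div_mul_comm]
  ring

theorem norm_spiralDir_sub_le (lam : ℝ) {z w : ℂ} (hz : z ≠ 0) (hw : w ≠ 0) :
    ‖spiralDir lam z - w / ‖w‖‖ ≤ |lam| * |Real.log ‖z‖| + 2 * ‖z - w‖ / ‖z‖ := by
  have e : spiralDir lam z - w / ‖w‖ =
      z / ‖z‖ * (spiralFactor lam ‖z‖ - 1) + (z / ‖z‖ - w / ‖w‖) := by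
    rw [spiralDir]; ring
  rw [e]
  refine (norm_add_le _ _).trans (add_le_add ?_ (norm_div_norm_sub_le hz hw))
  rw [norm_mul, norm_div, Complex.norm_real, norm_norm, div_self (norm_ne_zero_iff.2 hz), one_mul]
  exact norm_spiralFactor_sub_one_le _ _

/-! ### Rotation accumulated along a word. -/

namespace SimilaritySystem

variable {m n : ℕ} {S : SimilaritySystem m} {P : DiskPolygon n}

/-- The rotation that the deformation adds to the map `S_w`, untwisted with parameter `lam`. -/
def twist (d : S.Deformation P) (lam : ℝ) (w : List (Fin m)) : ℂ :=
  spiralDir lam (d.system.wordMult w) / (S.wordMult w / ‖S.wordMult w‖)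

theorem norm_twist (d : S.Deformation P) (lam : ℝ) (w : List (Fin m)) : ‖twist d lam w‖ = 1 := by
  rw [twist, norm_div, norm_spiralDir _ (d.system.wordMult_ne_zero w), norm_div, Complex.norm_real,
    norm_norm, div_self (norm_ne_zero_iff.2 (S.wordMult_ne_zero w)), div_one]

theorem twist_append (d : S.Deformation P) (lam : ℝ) (u w : List (Fin m)) :
    twist d lam (u ++ w) = twist d lam u * twist d lam w := by
  rw [twist, twist, twist, wordMult_append, wordMult_append,
    spiralDir_mul _ (d.system.wordMult_ne_zero u) (d.system.wordMult_ne_zero w), norm_mul]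
  push_cast
  rw [mul_div_mul_comm, mul_div_mul_comm]

theorem spiralDir_wordMult (d : S.Deformation P) (lam : ℝ) (w : List (Fin m)) :
    spiralDir lam (d.system.wordMult w) = twist d lam w * (S.wordMult w / ‖S.wordMult w‖) := by
  rw [twist, div_mul_cancel₀]
  exact div_ne_zero (S.wordMult_ne_zero w) (by simpa using S.wordMult_ne_zero w)

theorem norm_twist_sub_one_le_length {d : S.Deformation P} {lam ε : ℝ}
    (h : ∀ k, ‖twist d lam [k] - 1‖ ≤ ε) (w : List (Fin m)) :
    ‖twist d lam w - 1‖ ≤ w.length * ε := by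
  induction w with
  | nil => simp [twist, spiralDir, spiralFactor]
  | cons k w ih =>
    have e : twist d lam (k :: w) - 1 = twist d lam [k] * (twist d lam w - 1) + (twist d lam [k] - 1) := by
      rw [← List.singleton_append, twist_append]; ring
    rw [e]
    refine (norm_add_le _ _).trans ?_
    rw [norm_mul, norm_twist, one_mul, List.length_cons]
    push_cast
    linarith [h k]

theorem exists_isShortestFixing {C : ℂ} {s : List (Fin m)} (hs : s ≠ [])
    (hsC : S.wordMap s C = C) : ∃ v, S.IsShortestFixing C v := by
  classical
  have hex : ∃ l, ∃ v : List (Fin m), v.length = l ∧ v ≠ [] ∧ S.wordMap v C = C :=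
    ⟨_, s, rfl, hs, hsC⟩
  obtain ⟨v, hvl, hv, hvC⟩ := Nat.find_spec hex
  exact ⟨v, hv, hvC, fun u hu huC => hvl ▸ Nat.find_min' hex ⟨u, rfl, hu, huC⟩⟩

theorem exists_pos_separation (S : SimilaritySystem m) (P : DiskPolygon n) : ∃ c > 0, ∀ A ∈ P.vertexSet, ∀ k, ∀ z ∈ S.map k '' P.carrier,
    dist z A < c → A ∈ S.map k '' P.carrier := by
  have key : ∀ p : P.vertexSet × Fin m, ∃ c > 0, ∀ z ∈ S.map p.2 '' P.carrier,
      dist z p.1 < c → (p.1 : ℂ) ∈ S.map p.2 '' P.carrier := by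
    rintro ⟨A, k⟩
    by_cases h : (A : ℂ) ∈ S.map k '' P.carrier
    · exact ⟨1, one_pos, fun _ _ _ => h⟩
    · obtain ⟨c, hc, hsub⟩ := Metric.isOpen_iff.1
        (isClosed_piece (S := S) (P := P) k).isOpen_compl A h
      exact ⟨c, hc, fun z hz hzA => absurd hz (hsub hzA)⟩
  choose c hc h using key
  have : Finite P.vertexSet := P.vertexSet_finite.to_subtype
  have : Nonempty (P.vertexSet × Fin m) := ⟨⟨⟨_, P.zeroIndex, rfl⟩, ⟨0, S.pos⟩⟩⟩
  obtain ⟨p, hp⟩ := Finite.exists_min c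
  exact ⟨c p, hc p, fun A hA k z hz hzA => h ⟨⟨A, hA⟩, k⟩ z hz (hzA.trans_le (hp _))⟩

namespace IsContractiblePolygonal

variable (hS : S.IsContractiblePolygonal P)
include hS

/-! ### Loops in the graph of the vertices -/

/-- A long word that maps a vertex to a vertex contains a loop. -/
theorem exists_loop {w : List (Fin m)} {a A : ℂ} (hA : A ∈ P.vertexSet) (ha : a ∈ P.vertexSet)
    (hw : S.wordMap w a = A) (hlen : n ≤ w.length) :
    ∃ (u s t : List (Fin m)), w = u ++ (s ++ t) ∧ s ≠ [] ∧
      S.wordMap s (S.wordMap t a) = S.wordMap t a ∧ S.wordMap t a ∈ P.vertexSet := by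
  have hdrop : ∀ p, S.wordMap (w.drop p) a ∈ P.vertexSet := fun p => by
    have h1 : S.wordMap (w.take p) (S.wordMap (w.drop p) a) = A := by
      rw [← wordMap_append, List.take_append_drop, hw]
    exact hS.mem_vertexSet_of_wordMap hA
      (S.wordMap_mem hS.image_subset _ (P.vertexSet_subset_carrier ha)) h1
  choose g hg using hdrop
  -- The `n + 1` suffixes of lengths `w.length - p` send `a` to vertices of `P`, of which there are
  -- `n`.
  obtain ⟨p, p', hpp, hgp⟩ := Fintype.exists_ne_map_eq_of_card_lt
    (fun p : Fin (n + 1) => g p) (by simp)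
  wlog hlt : p < p' generalizing p p'
  · exact this p' p hpp.symm hgp.symm (lt_of_le_of_ne (not_lt.1 hlt) hpp.symm)
  have hlt' : (p : ℕ) < p' := hlt
  have hp' : (p' : ℕ) ≤ w.length := (Nat.lt_succ_iff.1 p'.2).trans hlen
  have hst : w.drop p = (w.drop p).take (p' - p) ++ w.drop p' := by
    conv_lhs => rw [← List.take_append_drop (p' - p) (w.drop p)]
    rw [List.drop_drop, Nat.add_sub_cancel' hlt'.le]
  refine ⟨w.take p, (w.drop p).take (p' - p), w.drop p', ?_, ?_, ?_, ?_⟩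
  · rw [← hst, List.take_append_drop]
  · intro h0
    have := congrArg List.length h0
    rw [List.length_take, List.length_drop, List.length_nil] at this
    omega
  · rw [← wordMap_append, ← hst, ← hg, ← hg]
    exact congrArg _ hgp
  · rw [← hg]; exact ⟨_, rfl⟩

/-- Loops have twist `1` and can be cut out until fewer than `n` letters are left; the errors of
unimodular factors add up. Only loops at vertices leading to `A` occur. -/
theorem norm_twist_sub_one_le {d : S.Deformation P} {lam ε : ℝ}
    (h : ∀ k, ‖twist d lam [k] - 1‖ ≤ ε) {A : ℂ} (hA : A ∈ P.vertexSet)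
    (hloop : ∀ (u s : List (Fin m)), ∀ C ∈ P.vertexSet, s ≠ [] → S.wordMap s C = C →
      S.wordMap u C = A → twist d lam s = 1) (w : List (Fin m)) {a : ℂ} (ha : a ∈ P.vertexSet)
    (hw : S.wordMap w a = A) : ‖twist d lam w - 1‖ ≤ n * ε := by
  induction hl : w.length using Nat.strong_induction_on generalizing w with
  | _ l ih =>
    subst hl
    rcases lt_or_ge w.length n with hlt | hge
    · refine (norm_twist_sub_one_le_length h w).trans ?_
      have hε : 0 ≤ ε := (norm_nonneg _).trans (h ⟨0, S.pos⟩)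
      gcongr
    · obtain ⟨u, s, t, rfl, hs, hsC, hC⟩ := hS.exists_loop hA ha hw hge
      have hw' : S.wordMap (u ++ t) a = A := by
        rw [← hw, wordMap_append, wordMap_append, wordMap_append, hsC]
      have h1 := ih _ (by
        rw [List.length_append, List.length_append, List.length_append]
        have := List.length_pos_iff.2 hs
        omega) (u ++ t) hw' rfl
      have h2 := hloop u s _ hC hs hsC (by rw [← wordMap_append]; exact hw')
      rwa [twist_append, twist_append, h2, one_mul, ← twist_append]

/-- Every word that fixes a cyclic vertex is a power of the shortest one. -/
theorem twist_eq_one_of_fixing {d : S.Deformation P} {lam : ℝ} {C : ℂ} (hC : C ∈ P.vertexSet)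
    {v : List (Fin m)} (hv : S.IsShortestFixing C v) (hv1 : twist d lam v = 1)
    {s : List (Fin m)} (hs : S.wordMap s C = C) : twist d lam s = 1 := by
  induction hl : s.length using Nat.strong_induction_on generalizing s with
  | _ l ih =>
    subst hl
    obtain ⟨hv0, hvC, hmin⟩ := hv
    have hCC := P.vertexSet_subset_carrier hC
    by_cases hs0 : s = []
    · subst hs0
      simp [twist, spiralDir, spiralFactor]
    · obtain ⟨s', rfl⟩ := hS.exists_eq_append ⟨hC, v, hv0, hvC⟩ hCC hCC hvC hs (hmin s hs0 hs)
      have hs' : S.wordMap s' C = C := by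
        rw [wordMap_append] at hs
        exact S.wordMap_injective v (hs.trans hvC.symm)
      rw [twist_append, hv1, one_mul]
      refine ih _ ?_ hs' rfl
      rw [List.length_append]
      have := List.length_pos_iff.2 hv0
      omega

/-- The deformed multiplier is `|μ| e ^ (i α)` and `lam * log |μ| = α`, so the spiral factor cancels
it, while the original multiplier is a positive real. -/
theorem twist_eq_one_of_isRotationAngle {d : S.Deformation P} {C : ℂ} (hC : C ∈ P.vertexSet)
    {v : List (Fin m)} (hv : S.IsShortestFixing C v) {α : ℝ}
    (hα : d.system.IsRotationAngle d.polygon (d.toFun C) v α) :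
    twist d (α / Real.log ‖d.system.wordMult v‖) v = 1 := by
  have hvC := hS.wordMap_conj d.map_conj hC hC hv.2.1
  obtain ⟨B, -, hBA, γ, θ, hγ, hθ, rfl⟩ := hα
  have e0 := hθ 0
  have e1 := hθ 1
  rw [γ.source] at e0
  rw [γ.target] at e1
  have hB0 : B - d.toFun C ≠ 0 := sub_ne_zero.2 hBA
  have hsub : d.system.wordMap v B - d.toFun C = d.system.wordMult v * (B - d.toFun C) := by
    conv_lhs => rw [← hvC]
    rw [wordMap_sub]
  set μ := d.system.wordMult v with hμ
  have hμ0 : μ ≠ 0 := d.system.wordMult_ne_zero v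
  have hμ1 : ‖μ‖ < 1 := d.system.norm_wordMult_lt_one hv.1
  have hlog : Real.log ‖μ‖ ≠ 0 := (Real.log_neg (norm_pos_iff.2 hμ0) hμ1).ne
  have hexp : μ / ‖μ‖ = Complex.exp (((θ 1 - θ 0 : ℝ) : ℂ) * Complex.I) := by
    push_cast
    rw [sub_mul, Complex.exp_sub, exp_eq_div_norm hB0 e0,
      exp_eq_div_norm (by rw [hsub]; exact mul_ne_zero hμ0 hB0) e1, hsub, norm_mul]
    have h1 : (‖μ‖ : ℂ) ≠ 0 := by simpa using hμ0
    have h2 : (‖B - d.toFun C‖ : ℂ) ≠ 0 := by simpa using hB0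
    push_cast
    field_simp
  have hd1 : S.wordMult v / ‖S.wordMult v‖ = 1 := by
    conv_lhs => rw [hS.wordMult_eq_norm hC hv.2.1]
    have : (‖S.wordMult v‖ : ℂ) ≠ 0 := by simpa using S.wordMult_ne_zero v
    rw [Complex.norm_real, norm_norm]
    exact div_self this
  rw [twist, hd1, div_one, spiralDir, ← hμ, hexp, spiralFactor, div_mul_cancel₀ _ hlog,
    ← Complex.exp_add]
  push_cast
  ring_nf
  exact Complex.exp_zero

/-- Parameter matching gives a common parameter at each vertex `B`, and up to the corresponding
spiral the maps `S_w` with `S_w a = B` are deformed little, uniformly in `w`. -/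
theorem eventually_exists_parameter {ε : ℝ} (hε : 0 < ε) :
    ∀ᶠ d in S.nearby P, d.system.ParameterMatching d.polygon → ∀ B ∈ S.pieceVertices P,
      ∃ lam : ℝ, |lam| ≤ ε ∧ ∀ w : List (Fin m), w ≠ [] → ∀ a ∈ P.vertexSet,
        S.wordMap w a = B → ‖twist d lam w - 1‖ ≤ ε := by
  classical
  have hε₁ : 0 < ε / (n + 1) := by positivity
  -- At most `n` letters remain after cutting loops, and the first letter is treated separately.
  set ε₁ := ε / (n + 1) with hε₁def
  obtain ⟨L, hL⟩ : ∃ L : ℝ, ∀ k, |Real.log ‖(S.map k).mult‖| + 1 ≤ L := by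
    have : Nonempty (Fin m) := ⟨⟨0, S.pos⟩⟩
    obtain ⟨k, hk⟩ := Finite.exists_max fun k => |Real.log ‖(S.map k).mult‖| + 1
    exact ⟨_, hk⟩
  have hL0 : 0 < L := by
    have := hL ⟨0, S.pos⟩
    have := abs_nonneg (Real.log ‖(S.map ⟨0, S.pos⟩).mult‖)
    linarith
  -- With `|log r| ≤ L` this makes the spiral factor of a single letter cost at most `ε₁ / 2`.
  set ε₂ := min ε (ε₁ / (2 * L)) with hε₂
  have hε₂0 : 0 < ε₂ := lt_min hε (by positivity)
  have hletter : ∀ᶠ d in S.nearby P, ∀ k, ∀ lam : ℝ, |lam| ≤ ε₂ → ‖twist d lam [k] - 1‖ ≤ ε₁ := by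
    refine Filter.eventually_all.2 fun k => ?_
    have hm0 := (S.map k).mult_ne_zero
    have t1 := (((hS.tendsto_mult k).sub_const (S.map k).mult).norm.const_mul 2).div
      (hS.tendsto_mult k).norm (norm_ne_zero_iff.2 hm0)
    rw [sub_self, norm_zero, mul_zero, zero_div] at t1
    have t2 := ((hS.tendsto_mult k).norm.log (norm_ne_zero_iff.2 hm0)).abs
    filter_upwards [t1.eventually (gt_mem_nhds (show 0 < ε₁ / 2 by positivity)),
      t2.eventually (gt_mem_nhds (show |Real.log ‖(S.map k).mult‖| < L by linarith [hL k]))]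
      with d h1 h2 lam hlam
    have e : twist d lam [k] - 1 = (spiralDir lam (d.system.map k).mult -
        (S.map k).mult / ‖(S.map k).mult‖) / ((S.map k).mult / ‖(S.map k).mult‖) := by
      have h0 : (S.map k).mult / ‖(S.map k).mult‖ ≠ 0 := div_ne_zero hm0 (by simpa using hm0)
      rw [sub_div, div_self h0]
      simp [twist, wordMult]
    rw [e, norm_div, norm_div, Complex.norm_real, norm_norm, div_self (norm_ne_zero_iff.2 hm0), div_one]
    refine (norm_spiralDir_sub_le lam (d.system.map k).mult_ne_zero hm0).trans ?_
    have h3 : |lam| * |Real.log ‖(d.system.map k).mult‖| ≤ ε₁ / (2 * L) * L :=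
      mul_le_mul (hlam.trans (min_le_right _ _)) h2.le (abs_nonneg _) (by positivity)
    have h4 : ε₁ / (2 * L) * L = ε₁ / 2 := by field_simp
    have h1' : 2 * ‖(d.system.map k).mult - (S.map k).mult‖ / ‖(d.system.map k).mult‖ < ε₁ / 2 := h1
    linarith
  have hcyc : ∀ C : ℂ, ∃ (v : List (Fin m)) (α : S.Deformation P → ℝ), C ∈ P.vertexSet →
      (∃ v, S.IsShortestFixing C v) → S.IsShortestFixing C v ∧
      ∀ᶠ d in S.nearby P, d.system.IsShortestFixing (d.toFun C) v ∧
        d.system.IsRotationAngle d.polygon (d.toFun C) v (α d) ∧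
        |α d / Real.log ‖d.system.wordMult v‖| ≤ ε₂ := by
    intro C
    by_cases h : C ∈ P.vertexSet ∧ ∃ v, S.IsShortestFixing C v
    swap
    · exact ⟨[], fun _ => 0, fun h1 h2 => absurd ⟨h1, h2⟩ h⟩
    obtain ⟨hC, v, hv⟩ := h
    obtain ⟨α, hα0, hα⟩ := hS.exists_isRotationAngle hC hv
    refine ⟨v, α, fun _ _ => ⟨hv, ?_⟩⟩
    have hv0 := norm_ne_zero_iff.2 (S.wordMult_ne_zero v)
    have ht := (hα0.div ((hS.tendsto_wordMult v).norm.log hv0)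
      (Real.log_neg (norm_pos_iff.2 (S.wordMult_ne_zero v)) (S.norm_wordMult_lt_one hv.1)).ne).abs
    rw [zero_div, abs_zero] at ht
    filter_upwards [hα, ht.eventually (gt_mem_nhds hε₂0)] with d h1 h2
    exact ⟨h1.1, h1.2, h2.le⟩
  choose v α hvα using hcyc
  have hcyc' : ∀ᶠ d in S.nearby P, ∀ C ∈ P.vertexSet, (∃ v, S.IsShortestFixing C v) →
      d.system.IsShortestFixing (d.toFun C) (v C) ∧
        d.system.IsRotationAngle d.polygon (d.toFun C) (v C) (α C d) ∧
        |α C d / Real.log ‖d.system.wordMult (v C)‖| ≤ ε₂ := by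
    refine (Filter.eventually_all_finite P.vertexSet_finite).2 fun C hC => ?_
    by_cases h : ∃ v, S.IsShortestFixing C v
    · filter_upwards [(hvα C hC h).2] with d hd _ using hd
    · exact Filter.Eventually.of_forall fun d h' => absurd h' h
  filter_upwards [hletter, hcyc'] with d hd1 hd2 hmatch B hB
  have hBword : ∀ u : List (Fin m), ∀ C ∈ P.vertexSet, u ≠ [] → S.wordMap u C = B →
      d.system.wordMap u (d.toFun C) = d.toFun B := by
    intro u C hC hu e
    obtain ⟨k, u, rfl⟩ := List.exists_cons_of_ne_nil hu
    have hz := hS.mem_vertexSet_of_mem_pieceVertices hB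
      (S.wordMap_mem hS.image_subset u (P.vertexSet_subset_carrier hC)) e
    rw [wordMap_cons, hS.wordMap_conj d.map_conj hz hC rfl, ← d.map_conj k _ hz, ← e, wordMap_cons]
  -- Parameter matching makes the parameters of all cyclic vertices over `B` equal. If there are
  -- none, no loops occur and `0` serves.
  obtain ⟨lam, hlam, hcommon⟩ : ∃ lam : ℝ, |lam| ≤ ε₂ ∧ ∀ u : List (Fin m), u ≠ [] →
      ∀ C ∈ P.vertexSet, (∃ v, S.IsShortestFixing C v) → S.wordMap u C = B →
        lam = α C d / Real.log ‖d.system.wordMult (v C)‖ := by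
    by_cases h : ∃ u : List (Fin m), u ≠ [] ∧ ∃ C ∈ P.vertexSet,
      (∃ v, S.IsShortestFixing C v) ∧ S.wordMap u C = B
    · obtain ⟨u, hu, C, hC, hCv, huC⟩ := h
      refine ⟨_, (hd2 C hC hCv).2.2, fun u' hu' C' hC' hCv' huC' => ?_⟩
      have h1 := hd2 C hC hCv
      have h2 := hd2 C' hC' hCv'
      exact hmatch (d.toFun B) (d.bijOn_pieceVertices.mapsTo hB) (d.toFun C) (d.toFun C')
        ⟨d.bijOn_vertexSet.mapsTo hC, v C, h1.1.1, h1.1.2.1⟩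
        ⟨d.bijOn_vertexSet.mapsTo hC', v C', h2.1.1, h2.1.2.1⟩ u u' hu hu'
        (hBword u C hC hu huC) (hBword u' C' hC' hu' huC') _ _
        ⟨v C, α C d, h1.1, h1.2.1, rfl⟩ ⟨v C', α C' d, h2.1, h2.2.1, rfl⟩
    · push Not at h
      exact ⟨0, by rw [abs_zero]; exact hε₂0.le,
        fun u hu C hC hCv huC => absurd huC (h u hu C hC hCv)⟩
  refine ⟨lam, hlam.trans (min_le_left _ _), fun w hw a ha hwa => ?_⟩
  -- The point `B` need not be a vertex of `P`, but its preimage under the first letter is, and the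
  -- loop argument applies there.
  obtain ⟨k, w, rfl⟩ := List.exists_cons_of_ne_nil hw
  have hz := hS.mem_vertexSet_of_mem_pieceVertices hB
    (S.wordMap_mem hS.image_subset w (P.vertexSet_subset_carrier ha)) hwa
  have hletter' := fun k => hd1 k lam hlam
  have hw1 := hS.norm_twist_sub_one_le hletter' hz (fun u s C hC hs hsC huC => by
    have hex := exists_isShortestFixing hs hsC
    have hlamC := hcommon (k :: u) (by simp) C hC hex (by rw [wordMap_cons, huC]; exact hwa)
    have h1 := hS.twist_eq_one_of_isRotationAngle hC (hvα C hC hex).1 (hd2 C hC hex).2.1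
    rw [← hlamC] at h1
    exact hS.twist_eq_one_of_fixing hC (hvα C hC hex).1 h1 hsC) w ha rfl
  have e : twist d lam (k :: w) - 1 =
      twist d lam [k] * (twist d lam w - 1) + (twist d lam [k] - 1) := by
    rw [← List.singleton_append, twist_append]; ring
  rw [e]
  refine (norm_add_le _ _).trans ?_
  rw [norm_mul, norm_twist, one_mul]
  have h5 : (n + 1) * ε₁ = ε := by rw [hε₁def]; field_simp
  linarith [hletter' k]

/-! ### Zooming in at a vertex -/

/-- While the point is within `c` of the vertex, its first letter belongs to a polygon containing
that vertex and can be removed, which magnifies the distance by at least `1 / q`. The same word is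
removed from both systems. -/
theorem exists_zoom {d : S.Deformation P} {c : ℝ} (hc : 0 < c)
    (h : ∀ A ∈ P.vertexSet, ∀ σ, ‖d.system.coding σ - d.toFun A‖ < c →
      A ∈ S.map (σ 0) '' P.carrier) {A : ℂ} (hA : A ∈ P.vertexSet) {σ : ℕ → Fin m}
    (hσ : d.system.coding σ ≠ d.toFun A) :
    ∃ (w : List (Fin m)) (τ : ℕ → Fin m), ∃ a ∈ P.vertexSet, S.wordMap w a = A ∧
      d.system.coding σ = d.system.wordMap w (d.system.coding τ) ∧
      S.coding σ = S.wordMap w (S.coding τ) ∧ c ≤ ‖d.system.coding τ - d.toFun a‖ := by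
  obtain ⟨q, hq0, hq1, hq⟩ := d.system.exists_ratio
  have key : ∀ (N : ℕ), ∀ A ∈ P.vertexSet, ∀ σ, c * q ^ N ≤ ‖d.system.coding σ - d.toFun A‖ →
      ∃ (w : List (Fin m)) (τ : ℕ → Fin m), ∃ a ∈ P.vertexSet, S.wordMap w a = A ∧
      d.system.coding σ = d.system.wordMap w (d.system.coding τ) ∧
      S.coding σ = S.wordMap w (S.coding τ) ∧ c ≤ ‖d.system.coding τ - d.toFun a‖ := by
    intro N
    induction N with
    | zero => intro A hA σ hle; exact ⟨[], σ, A, hA, rfl, rfl, rfl, by simpa using hle⟩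
    | succ N ih =>
      intro A hA σ hle
      rcases le_or_gt c ‖d.system.coding σ - d.toFun A‖ with hcle | hlt
      · exact ⟨[], σ, A, hA, rfl, rfl, rfl, hcle⟩
      · obtain ⟨z, hz, hzA⟩ := h A hA σ hlt
        have hzV := hS.mem_vertexSet_of_map hA hz hzA
        have e : d.system.coding σ - d.toFun A = (d.system.map (σ 0)).mult *
            ((d.system.coding fun k => σ (k + 1)) - d.toFun z) := by
          rw [d.system.coding_eq σ, ← hzA, d.map_conj _ z hzV, map_sub]
        rw [e, norm_mul, pow_succ, ← mul_assoc, mul_comm _ ‖_ - _‖] at hle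
        obtain ⟨w, τ, a, ha, hw, h1, h2, h3⟩ := ih z hzV (fun k => σ (k + 1))
          (le_of_mul_le_mul_right (hle.trans
            (mul_le_mul_of_nonneg_left (hq (σ 0)) (norm_nonneg _))) hq0)
        refine ⟨σ 0 :: w, τ, a, ha, ?_, ?_, ?_, h3⟩
        · rw [wordMap_cons, hw, hzA]
        · rw [d.system.coding_eq σ, wordMap_cons, h1]
        · rw [S.coding_eq σ, wordMap_cons, h2]
  have hpos : 0 < ‖d.system.coding σ - d.toFun A‖ := norm_pos_iff.2 (sub_ne_zero.2 hσ)
  obtain ⟨N, hN⟩ := exists_pow_lt_of_lt_one (div_pos hpos hc) hq1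
  rw [lt_div_iff₀ hc, mul_comm] at hN
  exact key N A hA σ hN.le

end IsContractiblePolygonal

end SimilaritySystem

/-! ### Separation of the deformed pieces. -/

namespace SimilaritySystem

variable {m n : ℕ} {S : SimilaritySystem m} {P : DiskPolygon n}

namespace IsContractiblePolygonal

variable (hS : S.IsContractiblePolygonal P)
include hS

/-- Close to a vertex `B` the attractor of a small deformation with matching parameters is, in
logarithmic coordinates, a small perturbation of a shear of the original one. -/
theorem eventually_direction {B : ℂ} (hB : B ∈ S.pieceVertices P) {ρ η : ℝ} (hρ : 0 < ρ)
    (hη : 0 < η) : ∃ ρ₁ > 0, ∀ᶠ d in S.nearby P, d.system.ParameterMatching d.polygon →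
      ∃ lam : ℝ, ∀ i, ∀ A ∈ P.vertexSet, S.map i A = B → ∀ σ,
        d.system.map i (d.system.coding σ) ≠ d.toFun B →
        ‖d.system.map i (d.system.coding σ) - d.toFun B‖ < ρ₁ →
        S.map i (S.coding σ) ≠ B ∧ dist (S.map i (S.coding σ)) B < ρ ∧
        ‖spiralDir lam (d.system.map i (d.system.coding σ) - d.toFun B) -
          (S.map i (S.coding σ) - B) / ‖S.map i (S.coding σ) - B‖‖ < η := by
  obtain ⟨c₀, hc₀, hsep⟩ := exists_pos_separation S P
  obtain ⟨q, hq0, hq1, hq⟩ := S.exists_ratio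
  obtain ⟨D₀, hD₀⟩ := S.isAttractor_attractor.isCompact.isBounded.exists_norm_le
  have hD₀0 : 0 ≤ D₀ := (norm_nonneg _).trans (hD₀ _ (S.coding_mem fun _ => ⟨0, S.pos⟩))
  -- A displacement of at most `2 * ε₁ ≤ c₀ / 4` keeps a point within `c` of a deformed vertex
  -- within `c₀` of the original one. The zoomed vector `u` below satisfies `c ≤ ‖u‖ ≤ D`, so `L`
  -- bounds its logarithm. The twist and the spiral factor of `u` cost together `ε * (1 + L) = η /
  -- 4`, the displacement another `η / 4`.
  set c := c₀ / 2 with hc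
  have hc0 : 0 < c := by positivity
  set D := 2 * D₀ + 1 with hD
  have hD0 : 0 < D := by positivity
  set L := |Real.log c| + |Real.log D| with hL
  have hL0 : 0 ≤ L := by positivity
  set ε := η / (4 * (1 + L)) with hε
  have hε0 : 0 < ε := by positivity
  set ε₁ := min (1 / 2) (min (c₀ / 8) (c * η / 16)) with hε₁
  have hε₁0 : 0 < ε₁ := lt_min (by norm_num) (lt_min (by positivity) (by positivity))
  have hε₁a : ε₁ ≤ 1 / 2 := min_le_left _ _
  have hε₁b : ε₁ ≤ c₀ / 8 := (min_le_right _ _).trans (min_le_left _ _)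
  have hε₁c : ε₁ ≤ c * η / 16 := (min_le_right _ _).trans (min_le_right _ _)
  have : Nonempty (Fin m) := ⟨⟨0, S.pos⟩⟩
  obtain ⟨k₀, hk₀⟩ := Finite.exists_min fun k => ‖(S.map k).mult‖
  set a := ‖(S.map k₀).mult‖ / 2 with ha
  have hk₀0 : 0 < ‖(S.map k₀).mult‖ := norm_pos_iff.2 (S.map k₀).mult_ne_zero
  have ha0 : 0 < a := by positivity
  have ha1 : a < 1 := by linarith [(S.map k₀).norm_mult_lt_one]
  -- More than `p` letters shrink the original vectors below `ρ`. As `a` bounds the deformed ratios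
  -- from below, a distance under `c * a ^ p` can occur only for words with more than `p` letters.
  obtain ⟨p, hp⟩ := exists_pow_lt_of_lt_one (show 0 < ρ / D by positivity) hq1
  rw [lt_div_iff₀ hD0] at hp
  have e1 : ∀ᶠ d in S.nearby P, ∀ k, a ≤ ‖(d.system.map k).mult‖ :=
    Filter.eventually_all.2 fun k =>
      ((hS.tendsto_mult k).norm.eventually (lt_mem_nhds (show a < ‖(S.map k).mult‖ by
        linarith [hk₀ k]))).mono fun _ h => h.le
  have e2 : ∀ᶠ d in S.nearby P, ∀ A ∈ P.vertexSet, ‖d.toFun A - A‖ < ε₁ :=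
    (Filter.eventually_all_finite P.vertexSet_finite).2 fun A hA => by
      have := ((hS.tendsto_vertex hA).sub_const A).norm
      rw [sub_self, norm_zero] at this
      exact this.eventually (gt_mem_nhds hε₁0)
  refine ⟨c * a ^ p, by positivity, ?_⟩
  filter_upwards [e1, e2, hS.eventually_coding hε₁0, hS.eventually_exists_parameter hε0]
    with d h1 h2 h3 h4 hmatch
  obtain ⟨lam, hlam, htwist⟩ := h4 hmatch B hB
  refine ⟨lam, fun i A hA hiA σ hne hlt => ?_⟩
  have hdiff : ∀ (τ : ℕ → Fin m), ∀ b ∈ P.vertexSet,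
      ‖(d.system.coding τ - d.toFun b) - (S.coding τ - b)‖ ≤ 2 * ε₁ := by
    intro τ b hb
    have e : (d.system.coding τ - d.toFun b) - (S.coding τ - b) =
        (d.system.coding τ - S.coding τ) - (d.toFun b - b) := by ring
    rw [e]
    refine (norm_sub_le _ _).trans ?_
    linarith [h3 τ, h2 b hb]
  have hzoom : ∀ A ∈ P.vertexSet, ∀ σ, ‖d.system.coding σ - d.toFun A‖ < c →
      A ∈ S.map (σ 0) '' P.carrier := by
    intro A hA σ hσ
    refine hsep A hA (σ 0) (S.coding σ) ?_ ?_
    · rw [S.coding_eq σ]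
      exact ⟨_, hS.attractor_subset_carrier (S.coding_mem _), rfl⟩
    · rw [dist_eq_norm]
      have := norm_sub_norm_le (S.coding σ - A) (d.system.coding σ - d.toFun A)
      rw [norm_sub_rev (S.coding σ - A)] at this
      linarith [hdiff σ A hA]
  have hfB : d.toFun B = d.system.map i (d.toFun A) := by rw [← hiA, d.map_conj i A hA]
  obtain ⟨w, τ, b, hb, hwb, hw1, hw2, hw3⟩ := hS.exists_zoom hc0 hzoom hA (σ := σ)
    (fun h => hne (by rw [h, hfB]))
  have hfA := hS.wordMap_conj d.map_conj hA hb hwb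
  set u := d.system.coding τ - d.toFun b with hu
  set v := S.coding τ - b with hv
  have huv : ‖u - v‖ ≤ 2 * ε₁ := hdiff τ b hb
  have hx : d.system.map i (d.system.coding σ) - d.toFun B = d.system.wordMult (i :: w) * u := by
    rw [hfB, hw1, ← hfA, hu, ← wordMap_sub]; rfl
  have hy : S.map i (S.coding σ) - B = S.wordMult (i :: w) * v := by
    rw [hw2, ← hiA, ← hwb, hv, ← wordMap_sub]; rfl
  have hu0 : u ≠ 0 := norm_pos_iff.1 (hc0.trans_le hw3)
  have hvn := norm_sub_norm_le u v
  have hv0 : v ≠ 0 := norm_pos_iff.1 (by linarith)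
  have hμ' := d.system.wordMult_ne_zero (i :: w)
  have hμ := S.wordMult_ne_zero (i :: w)
  have hvD : ‖v‖ ≤ 2 * D₀ := by
    have := norm_sub_le (S.coding τ) b
    linarith [hD₀ _ (S.coding_mem τ), hD₀ _ (hS.vertexSet_subset_attractor hb)]
  have huD : ‖u‖ ≤ D := by linarith
  refine ⟨?_, ?_, ?_⟩
  · rw [← sub_ne_zero, hy]
    exact mul_ne_zero hμ hv0
  · rw [hx, norm_mul] at hlt
    have h5 : ‖d.system.wordMult (i :: w)‖ < a ^ p := by
      by_contra! hge
      have := mul_le_mul hw3 hge (by positivity) (norm_nonneg _)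
      linarith [mul_comm ‖u‖ ‖d.system.wordMult (i :: w)‖]
    have h6 := (d.system.le_norm_wordMult ha0.le h1 (i :: w)).trans_lt h5
    have h7 : p < (i :: w).length := (pow_lt_pow_iff_right_of_lt_one₀ ha0 ha1).1 h6
    rw [dist_eq_norm, hy, norm_mul]
    have h8 : ‖S.wordMult (i :: w)‖ ≤ q ^ p := (S.norm_wordMult_le hq _).trans
      (pow_le_pow_of_le_one hq0.le hq1.le h7.le)
    refine lt_of_le_of_lt (mul_le_mul h8 ?_ (norm_nonneg _) (by positivity)) hp
    linarith
  -- The first summand is the rotation error of the word, the second the change of direction at the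
  -- definite scale of `u`.
  · have e : spiralDir lam (d.system.wordMult (i :: w) * u) -
        S.wordMult (i :: w) * v / ‖S.wordMult (i :: w) * v‖ =
        S.wordMult (i :: w) / ‖S.wordMult (i :: w)‖ *
        ((twist d lam (i :: w) - 1) * spiralDir lam u + (spiralDir lam u - v / ‖v‖)) := by
      rw [spiralDir_mul _ hμ' hu0, spiralDir_wordMult, norm_mul]
      push_cast
      rw [mul_div_mul_comm]
      ring
    rw [hx, hy, e, norm_mul, norm_div, Complex.norm_real, norm_norm,
      div_self (norm_ne_zero_iff.2 hμ), one_mul]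
    refine lt_of_le_of_lt (norm_add_le _ _) ?_
    rw [norm_mul, norm_spiralDir _ hu0, mul_one]
    have h5 := htwist (i :: w) (by simp) b hb (by rw [wordMap_cons, hwb]; exact hiA)
    have h6 := norm_spiralDir_sub_le lam hu0 hv0
    have h7 : |Real.log ‖u‖| ≤ L := by
      have hl1 := Real.log_le_log hc0 hw3
      have hl2 := Real.log_le_log (hc0.trans_le hw3) huD
      rw [abs_le]
      have := neg_abs_le (Real.log c)
      have := le_abs_self (Real.log D)
      have := abs_nonneg (Real.log c)
      have := abs_nonneg (Real.log D)
      constructor <;> linarith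
    have h8 : |lam| * |Real.log ‖u‖| ≤ ε * L := mul_le_mul hlam h7 (abs_nonneg _) hε0.le
    have h9 : 2 * ‖u - v‖ / ‖u‖ ≤ η / 4 := by
      rw [div_le_iff₀ (hc0.trans_le hw3)]
      nlinarith
    have h10 : ε * (1 + L) = η / 4 := by
      rw [hε]; field_simp
    linarith

/-- Compactness settles disjoint polygons and points away from the common vertex `B`; close to `B`
the angular gap is compared with the untwisted directions. -/
theorem eventually_inter_subset {i j : Fin m} (hij : i ≠ j) :
    ∀ᶠ d in S.nearby P, d.system.ParameterMatching d.polygon →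
      d.system.map i '' d.system.attractor ∩ d.system.map j '' d.system.attractor ⊆
      d.system.map i '' d.polygon.vertexSet ∩ d.system.map j '' d.polygon.vertexSet := by
  have hmem : ∀ k σ, S.map k (S.coding σ) ∈ S.map k '' P.carrier := fun k σ =>
    ⟨_, hS.attractor_subset_carrier (S.coding_mem σ), rfl⟩
  have hcompact : ∀ k, IsCompact (S.map k '' P.carrier) := fun k =>
    P.isCompact_carrier.image (S.continuous_map k)
  by_cases hdisj : Disjoint (S.map i '' P.carrier) (S.map j '' P.carrier)
  · obtain ⟨r, hr, hdist⟩ := exists_pos_forall_le_dist (hcompact i) (hcompact j).isClosed hdisj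
    filter_upwards [hS.eventually_coding (show 0 < r / 3 by positivity)] with d hd _
    rintro _ ⟨⟨x, hx, rfl⟩, ⟨y, hy, hxy⟩⟩
    rw [attractor_eq_range] at hx hy
    obtain ⟨σ, rfl⟩ := hx
    obtain ⟨τ, rfl⟩ := hy
    exfalso
    have h1 := hdist _ (hmem i σ) _ (hmem j τ)
    have h2 := hd (consAddress i σ)
    have h3 := hd (consAddress j τ)
    rw [coding_consAddress, coding_consAddress] at h2 h3
    rw [hxy] at h3
    rw [dist_eq_norm] at h1
    have h4 := norm_sub_le (d.system.map i (d.system.coding σ) - S.map j (S.coding τ))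
      (d.system.map i (d.system.coding σ) - S.map i (S.coding σ))
    rw [sub_sub_sub_cancel_left] at h4
    linarith
  · obtain ⟨B, hBi, hBj⟩ := not_disjoint_iff.1 hdisj
    have hBV : B ∈ S.map i '' P.vertexSet ∩ S.map j '' P.vertexSet := by
      rw [← hS.inter_eq i j hij]
      exact ⟨hBi, hBj⟩
    have hB : B ∈ S.pieceVertices P := mem_iUnion.2 ⟨i, hBV.1⟩
    obtain ⟨⟨a, ha, hia⟩, b, hb, hjb⟩ := hBV
    have honly : ∀ z ∈ S.map i '' P.carrier, z ∈ S.map j '' P.carrier → z = B :=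
      fun z hzi hzj => hS.inter_subsingleton hij hzi hzj hBi hBj
    obtain ⟨ρ, hρ, η, hη, hgap⟩ := (isRadialAt_piece i B).exists_direction_gap
      (isRadialAt_piece j B) (hcompact i) (hcompact j) honly
    obtain ⟨ρ₁, hρ₁, hdir⟩ := hS.eventually_direction hB hρ (half_pos hη)
    obtain ⟨r, hr, hdist⟩ := exists_pos_forall_le_dist
      ((hcompact i).diff (Metric.isOpen_ball (x := B) (ε := ρ₁ / 2)))
      (hcompact j).isClosed (disjoint_left.2 fun z hz hzj => hz.2 (by
        rw [honly z hz.1 hzj]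
        exact Metric.mem_ball_self (by positivity)))
    have htB := ((tendsto_toFun hB).sub_const B).norm
    rw [sub_self, norm_zero] at htB
    filter_upwards [hdir, hS.eventually_coding (lt_min (show 0 < r / 3 by positivity)
      (show 0 < ρ₁ / 8 by positivity)), htB.eventually (gt_mem_nhds (show 0 < ρ₁ / 8 by positivity))]
      with d hd hcod hfB hmatch
    obtain ⟨lam, hlam⟩ := hd hmatch
    rintro x ⟨⟨_, hx, rfl⟩, ⟨_, hy, hxy⟩⟩
    rw [attractor_eq_range] at hx hy
    obtain ⟨σ, rfl⟩ := hx
    obtain ⟨τ, rfl⟩ := hy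
    set x := d.system.map i (d.system.coding σ) with hxdef
    suffices hxB : x = d.toFun B by
      rw [hxB]
      exact ⟨⟨d.toFun a, d.bijOn_vertexSet.mapsTo ha, by rw [← d.map_conj i a ha, hia]⟩,
        ⟨d.toFun b, d.bijOn_vertexSet.mapsTo hb, by rw [← d.map_conj j b hb, hjb]⟩⟩
    by_contra hxB
    have h2 := hcod (consAddress i σ)
    have h3 := hcod (consAddress j τ)
    rw [coding_consAddress, coding_consAddress] at h2 h3
    rw [hxy] at h3
    rcases lt_or_ge ‖x - d.toFun B‖ ρ₁ with hlt | hge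
    -- The vector `spiralDir lam (x - d.toFun B)` is the same for both pieces, so the two original
    -- points would have directions less than `η` apart.
    · obtain ⟨h4, h5, h6⟩ := hlam i a ha hia σ hxB hlt
      obtain ⟨h7, h8, h9⟩ := hlam j b hb hjb τ (fun h => hxB (hxy.symm.trans h))
        (lt_of_eq_of_lt (congrArg (fun y => ‖y - d.toFun B‖) hxy) hlt)
      replace h9 : ‖spiralDir lam (d.system.map j (d.system.coding τ) - d.toFun B) -
        (S.map j (S.coding τ) - B) / ‖S.map j (S.coding τ) - B‖‖ < η / 2 := h9
      rw [hxy] at h9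
      have h10 := hgap _ (hmem i σ) _ (hmem j τ) h4 h7 h5 h8
      have h11 := norm_sub_le
        (spiralDir lam (x - d.toFun B) - (S.map j (S.coding τ) - B) / ‖S.map j (S.coding τ) - B‖)
        (spiralDir lam (x - d.toFun B) - (S.map i (S.coding σ) - B) / ‖S.map i (S.coding σ) - B‖)
      rw [sub_sub_sub_cancel_left] at h11
      linarith
    · have hmin1 := min_le_left (r / 3) (ρ₁ / 8)
      have hmin2 := min_le_right (r / 3) (ρ₁ / 8)
      -- A deformed point far from the image of `B` comes from a point of `P_i` outside a ball
      -- around `B`, where `P_j` is at distance at least `r`.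
      have hfar : S.map i (S.coding σ) ∈ S.map i '' P.carrier \ Metric.ball B (ρ₁ / 2) := by
        refine ⟨hmem i σ, fun hball => ?_⟩
        rw [Metric.mem_ball, dist_eq_norm] at hball
        have e : x - d.toFun B = (x - S.map i (S.coding σ)) + (S.map i (S.coding σ) - B) -
            (d.toFun B - B) := by ring
        have h4 := norm_sub_le ((x - S.map i (S.coding σ)) + (S.map i (S.coding σ) - B))
          (d.toFun B - B)
        rw [← e] at h4
        have h5 := norm_add_le (x - S.map i (S.coding σ)) (S.map i (S.coding σ) - B)
        linarith
      have h1 := hdist _ hfar _ (hmem j τ)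
      rw [dist_eq_norm] at h1
      have h4 := norm_sub_le (x - S.map j (S.coding τ)) (x - S.map i (S.coding σ))
      rw [sub_sub_sub_cancel_left] at h4
      linarith

theorem eventually_isSeparatedBy : ∀ᶠ d in S.nearby P, d.system.ParameterMatching d.polygon →
    d.system.IsSeparatedBy d.polygon.vertexSet := by
  have h : ∀ᶠ d in S.nearby P, ∀ i j, i ≠ j → d.system.ParameterMatching d.polygon →
      d.system.map i '' d.system.attractor ∩ d.system.map j '' d.system.attractor ⊆
      d.system.map i '' d.polygon.vertexSet ∩ d.system.map j '' d.polygon.vertexSet := by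
    refine Filter.eventually_all.2 fun i => Filter.eventually_all.2 fun j => ?_
    by_cases hij : i = j
    · exact Filter.Eventually.of_forall fun d h => absurd hij h
    · exact (hS.eventually_inter_subset hij).mono fun d hd _ => hd
  filter_upwards [h] with d hd hmatch
  exact ⟨d.isGeneralized.vertexSet_subset_attractor, d.isGeneralized.vertexSet_subset,
    fun i j hij => hd i j hij hmatch⟩

end IsContractiblePolygonal

/-- Two systems that are separated by conjugate sets of vertices have homeomorphic attractors. -/
theorem Deformation.nonempty_homeomorph (d : S.Deformation P) (hS : S.IsContractiblePolygonal P)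
    (h : d.system.IsSeparatedBy d.polygon.vertexSet) :
    Nonempty (S.attractor ≃ₜ d.system.attractor) := by
  -- The inverse of the vertex bijection is a conjugacy from the deformed system back to `S` and
  -- gives the converse identifications.
  set g := Function.invFunOn d.toFun (S.pieceVertices P) with hg
  have hgf : ∀ x ∈ S.pieceVertices P, g (d.toFun x) = x :=
    d.bijOn_pieceVertices.injOn.leftInvOn_invFunOn
  have hVp := hS.vertexSet_subset_pieceVertices
  refine nonempty_homeomorph_of_coding fun σ τ => ⟨fun e => ?_, fun e => ?_⟩
  · exact hS.isSeparatedBy.coding_eq_coding (P.vertexSet_finite.image _).isBounded d.map_conj e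
  · refine h.coding_eq_coding (f := g) (d.polygon.vertexSet_finite.image _).isBounded ?_ e
    intro k y hy
    obtain ⟨x, hx, rfl⟩ := d.bijOn_vertexSet.surjOn hy
    rw [← d.map_conj k x hx, hgf _ (mem_iUnion.2 ⟨k, x, hx, rfl⟩), hgf x (hVp hx)]

end SimilaritySystem

end

theorem theorem27 {m n : ℕ} (P : DiskPolygon n) (S : SimilaritySystem m)
    (hS : S.IsContractiblePolygonal P) :
    ∃ δ : ℝ, 0 < δ ∧
      ∀ (n' : ℕ) (P' : DiskPolygon n') (S' : SimilaritySystem m),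
        S'.IsGeneralizedPolygonal P' → S.IsDeformation δ P S' P' → S'.ParameterMatching P' →
          IsDendrite S'.attractor ∧ Nonempty (S'.attractor ≃ₜ S.attractor) := by
  obtain ⟨δ, hδ, h⟩ := SimilaritySystem.exists_pos_of_eventually_nearby hS.eventually_isSeparatedBy
  refine ⟨δ, hδ, fun n' P' S' hS' hdef hmatch => ?_⟩
  obtain ⟨f, hpv, hV, hh, hclose, hconj⟩ := hdef
  let d : S.Deformation P := ⟨n', P', S', hS', f, hpv, hV, hh, hconj⟩
  obtain ⟨e⟩ := d.nonempty_homeomorph hS (h d hclose hmatch)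
  exact ⟨hS.isDendrite_attractor.of_homeomorph e, ⟨e.symm⟩⟩
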